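/- All vector spaces and algebras are over $\mathbb{Q}$ and graded by the non-negative integers. Let $\mathcal{B}$ be a graded commutative algebra, let $W$ be a graded vector space that is zero in all even degrees, and let $\Lambda W$ be the free graded commutative algebra on $W$. In $\mathcal{B}\otimes\Lambda W\otimes\Lambda W$ write $w=1\otimes w\otimes 1$ and $w'=1\otimes 1\otimes w$ for $w\in W$, and in $\mathcal{B}\otimes\Lambda W\otimes\Lambda W\otimes\Lambda W$ write $w,w',w''$ similarly. The projections to $\mathcal{B}$ are the identity on $\mathcal{B}$ and kill the generators $w,w',w''$. Definitions. Let $d_B$ be a differential (a derivation of degree $+1$ with square zero) on $\mathcal{B}$. * A relative model $(\mathcal{B},d_B)\to(\mathcal{B}\otimes\Lambda W,D)$ is a differential $D$ on $\mathcal{B}\otimes\Lambda W$ extending $d_B$, where $W$ is concentrated in positive degrees and has a well-ordered homogeneous basis $(w_i)$ such that $D(w_i)\in\mathcal{B}\otimes\Lambda(w_j: j<i)$ for all $i$. The algebras $\mathcal{B}\otimes\Lambda W\otimes\Lambda W=(\mathcal{B}\otimes\Lambda W)\otimes_{\mathcal{B}}(\mathcal{B}\otimes\Lambda W)$ and $\mathcal{B}\otimes\Lambda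 W\otimes\Lambda W\otimes\Lambda W$ carry the induced tensor product differentials. * Let $\Lambda(t,dt)$ be the free graded commutative DG algebra with $|t|=0$, $d(t)=dt$, and let $p_0,p_1:\Lambda(t,dt)\to\mathbb{Q}$ be the evaluations at $t=0,1$. Two DG algebra maps $\psi_0,\psi_1: A\to E$ between DG algebras of the above kind are homotopic under and over $\mathcal{B}$ if there is a DG algebra map $H:A\to E\otimes\Lambda(t,dt)$ that is the identity on $\mathcal{B}$, commutes with the projections to $\mathcal{B}$ (respectively $\mathcal{B}\otimes\Lambda(t,dt)$), and satisfies $p_i\circ H=\psi_i$ for $i=0,1$. * A fibrewise multiplication of models is a DG algebra map $C:(\mathcal{B}\otimes\Lambda W,D)\to(\mathcal{B}\otimes\Lambda W\otimes\Lambda W,D)$ that is the identity on $\mathcal{B}$, commutes with the projections to $\mathcal{B}$, and satisfies $C(w)-w-w'\in\mathcal{B}\otimes\Lambda^+W\otimes\Lambda^+W$ for all $w\in W$. It is associative if $(C\otimes_{\mathcal{B}}1)\circ C$ and $(1\otimes_{\mathcal{B}}C)\circ C$ are homotopic under and over $\mathcal{B}$. * Two such pairs are equivalent, $(D_1,C_1)\equiv^{\mathcal{B}}_{\mathcal{B}}(D_2,C_2)$,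 if there is a DG algebra isomorphism $\phi:(\mathcal{B}\otimes\Lambda W,D_2)\to(\mathcal{B}\otimes\Lambda W,D_1)$ that is the identity on $\mathcal{B}$ and commutes with the projections, such that $C_1\circ\phi$ and $(\phi\otimes_{\mathcal{B}}\phi)\circ C_2$ are homotopic under and over $\mathcal{B}$. * The standard multiplication $C_0:\mathcal{B}\otimes\Lambda W\to\mathcal{B}\otimes\Lambda W\otimes\Lambda W$ is the algebra map that is the identity on $\mathcal{B}$ and satisfies $C_0(w)=w+w'$ for $w\in W$. Theorem. (1) Let $(\mathcal{B},d_B)\to(\mathcal{B}\otimes\Lambda W,D)$ be a relative model whose projection $\mathcal{B}\otimes\Lambda W\to\mathcal{B}$ is a DG algebra map, and let $C$ be a fibrewise multiplication of models on it. Suppose that $\mathcal{B}$ and $W$ are of finite type (finite-dimensional in each degree), that $H(\mathcal{B},d_B)$ vanishes in odd degrees, and (as above) that $W$ is zero in even degrees. If $C$ is associative, then $C_0$ is a fibrewise multiplication of models for the differential $d_B\otimes 1$, and $(D,C)\equiv^{\mathcal{B}}_{\mathcal{B}}(d_B\otimes 1,C_0)$. (2) Let $\alpha,\beta,\gamma,\delta:\mathcal{B}\otimes\Lambda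 W\otimes\Lambda W\to\mathcal{B}\otimes\Lambda W\otimes\Lambda W\otimes\Lambda W$ be the algebra maps that are the identity on $\mathcal{B}$ and are given on generators by $\alpha(w)=w$, $\alpha(w')=w'$; $\beta(w)=w+w'$, $\beta(w')=w''$; $\gamma(w)=w$, $\gamma(w')=w'+w''$; $\delta(w)=w'$, $\delta(w')=w''$. Let $(w_i)$ be a homogeneous basis of $W$ with totally ordered index set, let $r\ge 3$, and let $\chi\in\sum_{1\le s\le r-1}\mathcal{B}\otimes\Lambda^sW\otimes\Lambda^{r-s}W$. If $\alpha(\chi)+\beta(\chi)=\gamma(\chi)+\delta(\chi)$, then $$\chi=\sum_I b_I\,(S_I-w_I-w'_I)$$ for suitable $b_I\in\mathcal{B}$, almost all zero, where the sum is over strictly increasing sequences $I=(i_1<\cdots<i_r)$, and $w_I=w_{i_1}\cdots w_{i_r}$, $w'_I=w'_{i_1}\cdots w'_{i_r}$, $S_I=(w_{i_1}+w'_{i_1})\cdots(w_{i_r}+w'_{i_r})$. -/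

import Mathlib

open scoped TensorProduct DirectSum Polynomial

noncomputable section

namespace FibrewiseModels

universe u v w

/-! ## Graded algebras and differentials over `ℚ` -/

section Basic

variable {A : Type u} [Ring A] [Algebra ℚ A]

/-- Graded commutativity: `x y = (-1)^{|x||y|} y x`. -/
def IsGradedCommutative (𝒜 : ℕ → Submodule ℚ A) : Prop :=
  ∀ (i j : ℕ) (x y : A), x ∈ 𝒜 i → y ∈ 𝒜 j → x * y = (-1 : ℚ) ^ (i * j) • (y * x)

/-- `d` is a differential of degree `+1` on the graded algebra `(A, 𝒜)`: it squares to zero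
and is a (graded) derivation. -/
structure IsDifferential (𝒜 : ℕ → Submodule ℚ A) (d : A →ₗ[ℚ] A) : Prop where
  map_mem : ∀ (n : ℕ) (x : A), x ∈ 𝒜 n → d x ∈ 𝒜 (n + 1)
  sq_zero : ∀ x : A, d (d x) = 0
  leibniz : ∀ (n : ℕ) (x y : A), x ∈ 𝒜 n → d (x * y) = d x * y + (-1 : ℚ) ^ n • (x * d y)

/-- The cohomology of `(A, d)` vanishes in odd degrees: every cocycle of odd degree is a
coboundary. -/
def HasZeroOddCohomology (𝒜 : ℕ → Submodule ℚ A) (d : A →ₗ[ℚ] A) : Prop :=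
  ∀ n : ℕ, Odd n → ∀ x ∈ 𝒜 n, d x = 0 → ∃ y : A, d y = x

/-- A linear map is a morphism of DG algebras: it is multiplicative and unital, preserves
degrees, and commutes with the differentials. -/
structure IsDGMap {A' : Type v} [Ring A'] [Algebra ℚ A']
    (𝒜 : ℕ → Submodule ℚ A) (d : A →ₗ[ℚ] A)
    (𝒜' : ℕ → Submodule ℚ A') (d' : A' →ₗ[ℚ] A') (f : A →ₗ[ℚ] A') : Prop where
  map_one : f 1 = 1
  map_mul : ∀ x y : A, f (x * y) = f x * f y
  map_mem : ∀ (n : ℕ) (x : A), x ∈ 𝒜 n → f x ∈ 𝒜' n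
  map_d : ∀ x : A, f (d x) = d' (f x)

/-- The degree involution `x ↦ (-1)^{|x|} x`. -/
def signInv (𝒜 : ℕ → Submodule ℚ A) [GradedAlgebra 𝒜] : A →ₗ[ℚ] A :=
  (DirectSum.toModule ℚ ℕ A fun i => (-1 : ℚ) ^ i • (𝒜 i).subtype) ∘ₗ
    (DirectSum.decomposeLinearEquiv 𝒜).toLinearMap

end Basic

/-- A graded vector space is of finite type if it is finite-dimensional in each degree. -/
def IsFiniteType {V : Type u} [AddCommGroup V] [Module ℚ V] (𝒱 : ℕ → Submodule ℚ V) : Prop :=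
  ∀ n : ℕ, FiniteDimensional ℚ (𝒱 n)

/-! ## The total grading on the graded tensor product -/

section Tensor

variable {A : Type u} [Ring A] [Algebra ℚ A] (𝒜 : ℕ → Submodule ℚ A) [GradedAlgebra 𝒜]
variable {L : Type v} [Ring L] [Algebra ℚ L] (ℒ : ℕ → Submodule ℚ L) [GradedAlgebra ℒ]

/-- The linear map out of `A ⊗ L` defined by a bilinear map. -/
def tlift {M : Type w} [AddCommGroup M] [Module ℚ M] (f : A →ₗ[ℚ] L →ₗ[ℚ] M) :
    (𝒜 ᵍ⊗[ℚ] ℒ) →ₗ[ℚ] M :=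
  TensorProduct.lift f ∘ₗ (GradedTensorProduct.of ℚ 𝒜 ℒ).symm.toLinearMap

@[simp]
theorem tlift_tmul {M : Type w} [AddCommGroup M] [Module ℚ M] (f : A →ₗ[ℚ] L →ₗ[ℚ] M)
    (a : A) (l : L) : tlift 𝒜 ℒ f (a ᵍ⊗ₜ[ℚ] l) = f a l := rfl

/-- The bilinear map `(a, l) ↦ a ⊗ l`. -/
def tmk : A →ₗ[ℚ] L →ₗ[ℚ] (𝒜 ᵍ⊗[ℚ] ℒ) :=
  (TensorProduct.mk ℚ A L).compr₂ (GradedTensorProduct.of ℚ 𝒜 ℒ).toLinearMap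

@[simp]
theorem tmk_apply (a : A) (l : L) : tmk 𝒜 ℒ a l = a ᵍ⊗ₜ[ℚ] l := rfl

/-- The total grading on `A ⊗ L`: degree `n` is spanned by `a ⊗ l` with `|a| + |l| = n`. -/
def tensorGr (n : ℕ) : Submodule ℚ (𝒜 ᵍ⊗[ℚ] ℒ) :=
  Submodule.span ℚ {z | ∃ (i j : ℕ) (a : A) (l : L),
    i + j = n ∧ a ∈ 𝒜 i ∧ l ∈ ℒ j ∧ z = a ᵍ⊗ₜ[ℚ] l}

variable {𝒜 ℒ} in
theorem tmul_mem_tensorGr {i j : ℕ} {a : A} {l : L} (ha : a ∈ 𝒜 i) (hl : l ∈ ℒ j) :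
    (a ᵍ⊗ₜ[ℚ] l) ∈ tensorGr 𝒜 ℒ (i + j) :=
  Submodule.subset_span ⟨i, j, a, l, rfl, ha, hl, rfl⟩

/-- Auxiliary: the homogeneous part of the decomposition map. -/
def tensorDecAux (i j : ℕ) : 𝒜 i →ₗ[ℚ] ℒ j →ₗ[ℚ] ⨁ n, tensorGr 𝒜 ℒ n :=
  LinearMap.mk₂ ℚ
    (fun a l => DirectSum.lof ℚ ℕ (fun n => tensorGr 𝒜 ℒ n) (i + j)
      ⟨(a : A) ᵍ⊗ₜ[ℚ] (l : L), tmul_mem_tensorGr a.2 l.2⟩)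
    (fun a a' l => by
      rw [← map_add]; congr 1; ext1
      exact LinearMap.map_add₂ (tmk 𝒜 ℒ) _ _ _)
    (fun c a l => by
      rw [← map_smul]; congr 1)
    (fun a l l' => by
      rw [← map_add]; congr 1; ext1
      exact map_add (tmk 𝒜 ℒ (a : A)) _ _)
    (fun c a l => by
      rw [← map_smul]; congr 1; ext1
      exact map_smul (tmk 𝒜 ℒ (a : A)) _ _)

/-- Auxiliary: the decomposition map of the total grading. -/
def tensorDec : (𝒜 ᵍ⊗[ℚ] ℒ) →ₗ[ℚ] ⨁ n, tensorGr 𝒜 ℒ n :=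
  tlift 𝒜 ℒ <|
    ((DirectSum.toModule ℚ ℕ ((⨁ j, ℒ j) →ₗ[ℚ] ⨁ n, tensorGr 𝒜 ℒ n) fun i =>
      LinearMap.flip <| DirectSum.toModule ℚ ℕ (𝒜 i →ₗ[ℚ] ⨁ n, tensorGr 𝒜 ℒ n) fun j =>
        (tensorDecAux 𝒜 ℒ i j).flip).compl₁₂
      (DirectSum.decomposeLinearEquiv 𝒜).toLinearMap
      (DirectSum.decomposeLinearEquiv ℒ).toLinearMap)

theorem tensorDec_tmul {i j : ℕ} {a : A} {l : L} (ha : a ∈ 𝒜 i) (hl : l ∈ ℒ j) :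
    tensorDec 𝒜 ℒ (a ᵍ⊗ₜ[ℚ] l) = DirectSum.lof ℚ ℕ (fun n => tensorGr 𝒜 ℒ n) (i + j)
      ⟨a ᵍ⊗ₜ[ℚ] l, tmul_mem_tensorGr ha hl⟩ := by
  lift a to 𝒜 i using ha
  lift l to ℒ j using hl
  simp only [tensorDec, tlift_tmul, LinearMap.compl₁₂_apply, LinearEquiv.coe_coe,
    DirectSum.decomposeLinearEquiv_apply, DirectSum.decompose_coe]
  rw [← DirectSum.lof_eq_of ℚ, ← DirectSum.lof_eq_of ℚ, DirectSum.toModule_lof,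
    LinearMap.flip_apply, DirectSum.toModule_lof]
  rfl

theorem tensorDec_of_mem {n : ℕ} {z : 𝒜 ᵍ⊗[ℚ] ℒ} (hz : z ∈ tensorGr 𝒜 ℒ n) :
    tensorDec 𝒜 ℒ z = DirectSum.lof ℚ ℕ (fun n => tensorGr 𝒜 ℒ n) n ⟨z, hz⟩ := by
  induction hz using Submodule.span_induction with
  | mem x h =>
    obtain ⟨i, j, a, l, rfl, ha, hl, rfl⟩ := h
    exact tensorDec_tmul 𝒜 ℒ ha hl
  | zero => rw [map_zero]; exact (map_zero _).symm
  | add x y _ _ hx hy => rw [map_add, hx, hy, ← map_add]; rfl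
  | smul c x _ hx => rw [map_smul, hx, ← map_smul]; rfl

theorem coe_tensorDec (z : 𝒜 ᵍ⊗[ℚ] ℒ) :
    DirectSum.coeLinearMap (tensorGr 𝒜 ℒ) (tensorDec 𝒜 ℒ z) = z := by
  suffices h : (DirectSum.coeLinearMap (tensorGr 𝒜 ℒ)) ∘ₗ tensorDec 𝒜 ℒ = LinearMap.id from
    LinearMap.congr_fun h z
  apply GradedTensorProduct.hom_ext
  ext1
  refine DirectSum.decompose_lhom_ext 𝒜 fun i => ?_
  ext1 a
  refine DirectSum.decompose_lhom_ext ℒ fun j => ?_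
  ext1 l
  change DirectSum.coeLinearMap (tensorGr 𝒜 ℒ) (tensorDec 𝒜 ℒ ((a : A) ᵍ⊗ₜ[ℚ] (l : L))) = _
  rw [tensorDec_tmul 𝒜 ℒ a.2 l.2, DirectSum.coeLinearMap_lof]
  rfl

instance tensorGradedMonoid : SetLike.GradedMonoid (tensorGr 𝒜 ℒ) where
  one_mem := tmul_mem_tensorGr (i := 0) (j := 0) SetLike.GradedOne.one_mem
    SetLike.GradedOne.one_mem
  mul_mem := by
    intro m n x y hx hy
    induction hx using Submodule.span_induction with
    | mem x h =>
      obtain ⟨i, j, a, l, rfl, ha, hl, rfl⟩ := h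
      induction hy using Submodule.span_induction with
      | mem y h' =>
        obtain ⟨i', j', a', l', rfl, ha', hl', rfl⟩ := h'
        have := GradedTensorProduct.tmul_coe_mul_coe_tmul 𝒜 ℒ a ⟨l, hl⟩ ⟨a', ha'⟩ l'
        dsimp only at this
        rw [this, Units.smul_def]
        refine zsmul_mem ?_ _
        have h2 := tmul_mem_tensorGr (SetLike.GradedMul.mul_mem ha ha')
          (SetLike.GradedMul.mul_mem hl hl')
        rwa [add_add_add_comm] at h2
      | zero => rw [mul_zero]; exact Submodule.zero_mem _
      | add y y' _ _ h1 h2 => rw [mul_add]; exact Submodule.add_mem _ h1 h2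
      | smul c y _ h => rw [mul_smul_comm]; exact Submodule.smul_mem _ _ h
    | zero => rw [zero_mul]; exact Submodule.zero_mem _
    | add y y' _ _ h1 h2 => rw [add_mul]; exact Submodule.add_mem _ h1 h2
    | smul c y _ h => rw [smul_mul_assoc]; exact Submodule.smul_mem _ _ h

instance tensorGradedAlgebra : GradedAlgebra (tensorGr 𝒜 ℒ) where
  toDecomposition := DirectSum.Decomposition.ofLinearMap _ (tensorDec 𝒜 ℒ)
    (LinearMap.ext fun z => coe_tensorDec 𝒜 ℒ z)
    (by
      ext n x : 2
      simp only [LinearMap.comp_apply, DirectSum.coeLinearMap_lof, LinearMap.id_apply]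
      rw [tensorDec_of_mem 𝒜 ℒ x.2])

end Tensor

/-! ## The free graded commutative algebra `ΛW` -/

section Free

variable {W : Type v} [AddCommGroup W] [Module ℚ W] (𝓦 : ℕ → Submodule ℚ W)

/-- The relations `u v = (-1)^{|u||v|} v u` between homogeneous elements of `W`. -/
inductive FreeRel : TensorAlgebra ℚ W → TensorAlgebra ℚ W → Prop
  | swap (i j : ℕ) (x y : W) (hx : x ∈ 𝓦 i) (hy : y ∈ 𝓦 j) :
      FreeRel (TensorAlgebra.ι ℚ x * TensorAlgebra.ι ℚ y)
        ((-1 : ℚ) ^ (i * j) • (TensorAlgebra.ι ℚ y * TensorAlgebra.ι ℚ x))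

/-- The free graded commutative algebra `ΛW` on the graded vector space `W`: the quotient of
the tensor algebra by the relations `u v = (-1)^{|u||v|} v u`. -/
abbrev FreeGCA : Type v := RingQuot (FreeRel 𝓦)

namespace FreeGCA

/-- The inclusion `W → ΛW`. -/
def ι : W →ₗ[ℚ] FreeGCA 𝓦 :=
  (RingQuot.mkAlgHom ℚ (FreeRel 𝓦)).toLinearMap ∘ₗ TensorAlgebra.ι ℚ

theorem ι_mul_ι {i j : ℕ} {x y : W} (hx : x ∈ 𝓦 i) (hy : y ∈ 𝓦 j) :
    ι 𝓦 x * ι 𝓦 y = (-1 : ℚ) ^ (i * j) • (ι 𝓦 y * ι 𝓦 x) := by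
  have := RingQuot.mkAlgHom_rel ℚ (FreeRel.swap (𝓦 := 𝓦) i j x y hx hy)
  rw [map_mul, map_smul, map_mul] at this
  exact this

/-- The universal property of `ΛW`. -/
def lift {A : Type w} [Semiring A] [Algebra ℚ A] (f : W →ₗ[ℚ] A)
    (hf : ∀ (i j : ℕ) (x y : W), x ∈ 𝓦 i → y ∈ 𝓦 j →
      f x * f y = (-1 : ℚ) ^ (i * j) • (f y * f x)) : FreeGCA 𝓦 →ₐ[ℚ] A :=
  RingQuot.liftAlgHom ℚ ⟨TensorAlgebra.lift ℚ f, by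
    rintro _ _ ⟨i, j, x, y, hx, hy⟩
    simpa using hf i j x y hx hy⟩

@[simp]
theorem lift_ι {A : Type w} [Semiring A] [Algebra ℚ A] (f : W →ₗ[ℚ] A)
    (hf : ∀ (i j : ℕ) (x y : W), x ∈ 𝓦 i → y ∈ 𝓦 j →
      f x * f y = (-1 : ℚ) ^ (i * j) • (f y * f x)) (x : W) :
    lift 𝓦 f hf (ι 𝓦 x) = f x := by
  simp [lift, ι]

theorem algHom_ext {A : Type w} [Semiring A] [Algebra ℚ A] {f g : FreeGCA 𝓦 →ₐ[ℚ] A}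
    (h : ∀ x, f (ι 𝓦 x) = g (ι 𝓦 x)) : f = g := by
  apply RingQuot.ringQuot_ext'
  ext x
  exact h x

/-- The augmentation `ΛW → ℚ` sending `W` to zero. -/
def aug : FreeGCA 𝓦 →ₐ[ℚ] ℚ := lift 𝓦 0 (by simp)

/-- The word-length submodule `Λ^s W`, spanned by the products of `s` elements of `W`. -/
def word (s : ℕ) : Submodule ℚ (FreeGCA 𝓦) := LinearMap.range (ι 𝓦) ^ s

/-- The grading on `ΛW`: degree `n` is spanned by the products `w₁ ⋯ w_k` of homogeneous
elements of `W` with `|w₁| + ⋯ + |w_k| = n`. -/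
def gr (n : ℕ) : Submodule ℚ (FreeGCA 𝓦) :=
  Submodule.span ℚ {z | ∃ l : List (Σ i, 𝓦 i),
    (l.map Sigma.fst).sum = n ∧ z = (l.map fun p => ι 𝓦 (p.2 : W)).prod}

theorem ι_mem_gr {i : ℕ} {x : W} (hx : x ∈ 𝓦 i) : ι 𝓦 x ∈ gr 𝓦 i :=
  Submodule.subset_span ⟨[⟨i, x, hx⟩], by simp, by simp⟩

instance grGradedMonoid : SetLike.GradedMonoid (gr 𝓦) where
  one_mem := Submodule.subset_span ⟨[], by simp, by simp⟩
  mul_mem := by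
    intro m n x y hx hy
    have h := Submodule.mul_mem_mul hx hy
    rw [gr, gr, Submodule.span_mul_span] at h
    refine Submodule.span_mono ?_ h
    rintro _ ⟨_, ⟨l, rfl, rfl⟩, _, ⟨l', rfl, rfl⟩, rfl⟩
    exact ⟨l ++ l', by simp, by simp⟩

/-- Auxiliary: the inclusion of a homogeneous element of `W` into the direct sum. -/
def decAux (i : ℕ) : 𝓦 i →ₗ[ℚ] ⨁ n, gr 𝓦 n :=
  DirectSum.lof ℚ ℕ (fun n => gr 𝓦 n) i ∘ₗ
    ((ι 𝓦) ∘ₗ (𝓦 i).subtype).codRestrict (gr 𝓦 i) fun x => ι_mem_gr 𝓦 x.2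

theorem decAux_apply {i : ℕ} (x : 𝓦 i) :
    decAux 𝓦 i x = DirectSum.of (fun n => gr 𝓦 n) i ⟨ι 𝓦 x, ι_mem_gr 𝓦 x.2⟩ := rfl

variable [DirectSum.Decomposition 𝓦]

/-- Auxiliary: the linear map `W → ⨁ₙ (ΛW)ₙ`. -/
def decLin : W →ₗ[ℚ] ⨁ n, gr 𝓦 n :=
  DirectSum.toModule ℚ ℕ _ (decAux 𝓦) ∘ₗ (DirectSum.decomposeLinearEquiv 𝓦).toLinearMap

theorem decLin_apply {i : ℕ} (x : 𝓦 i) :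
    decLin 𝓦 (x : W) = DirectSum.of (fun n => gr 𝓦 n) i ⟨ι 𝓦 x, ι_mem_gr 𝓦 x.2⟩ := by
  rw [decLin, LinearMap.comp_apply, LinearEquiv.coe_coe, DirectSum.decomposeLinearEquiv_apply,
    DirectSum.decompose_coe, ← DirectSum.lof_eq_of ℚ, DirectSum.toModule_lof, decAux_apply]

theorem decLin_mul (i j : ℕ) (x y : W) (hx : x ∈ 𝓦 i) (hy : y ∈ 𝓦 j) :
    decLin 𝓦 x * decLin 𝓦 y = (-1 : ℚ) ^ (i * j) • (decLin 𝓦 y * decLin 𝓦 x) := by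
  lift x to 𝓦 i using hx
  lift y to 𝓦 j using hy
  rw [decLin_apply, decLin_apply, DirectSum.of_mul_of, DirectSum.of_mul_of,
    ← DirectSum.lof_eq_of ℚ, ← DirectSum.lof_eq_of ℚ, ← map_smul, DirectSum.lof_eq_of,
    DirectSum.lof_eq_of]
  apply DirectSum.of_eq_of_gradedMonoid_eq
  refine Sigma.subtype_ext (add_comm _ _) ?_
  exact ι_mul_ι 𝓦 x.2 y.2

/-- Auxiliary: the decomposition map of `ΛW`. -/
def dec : FreeGCA 𝓦 →ₐ[ℚ] ⨁ n, gr 𝓦 n :=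
  lift (A := ⨁ n, gr 𝓦 n) 𝓦 (decLin 𝓦) (decLin_mul 𝓦)

theorem dec_ι (x : W) : dec 𝓦 (ι 𝓦 x) = decLin 𝓦 x :=
  lift_ι (A := ⨁ n, gr 𝓦 n) 𝓦 (decLin 𝓦) (decLin_mul 𝓦) x

theorem dec_prod (l : List (Σ i, 𝓦 i))
    (h : (l.map fun p => ι 𝓦 (p.2 : W)).prod ∈ gr 𝓦 (l.map Sigma.fst).sum) :
    dec 𝓦 (l.map fun p => ι 𝓦 (p.2 : W)).prod =
      DirectSum.of (fun n => gr 𝓦 n) (l.map Sigma.fst).sum ⟨_, h⟩ := by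
  induction l with
  | nil => exact map_one (dec 𝓦)
  | cons p l ih =>
    have hl : (l.map fun p => ι 𝓦 (p.2 : W)).prod ∈ gr 𝓦 (l.map Sigma.fst).sum :=
      Submodule.subset_span ⟨l, rfl, rfl⟩
    have key : dec 𝓦 (ι 𝓦 (p.2 : W) * (l.map fun p => ι 𝓦 (p.2 : W)).prod) =
        DirectSum.of (fun n => gr 𝓦 n) (p.1 + (l.map Sigma.fst).sum)
          ⟨ι 𝓦 (p.2 : W) * (l.map fun p => ι 𝓦 (p.2 : W)).prod,
            SetLike.GradedMul.mul_mem (ι_mem_gr 𝓦 p.2.2) hl⟩ := by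
      rw [map_mul, ih hl, dec_ι, decLin_apply, DirectSum.of_mul_of]
      rfl
    exact key

instance gradedAlgebra : GradedAlgebra (gr 𝓦) :=
  GradedAlgebra.ofAlgHom _ (dec 𝓦)
    (by
      apply algHom_ext
      intro x
      simp only [AlgHom.comp_apply, AlgHom.id_apply, dec_ι]
      induction x using DirectSum.Decomposition.inductionOn 𝓦 with
      | zero => simp
      | homogeneous x => rw [decLin_apply, DirectSum.coeAlgHom_of]
      | add x y hx hy => rw [map_add, map_add, hx, hy, map_add])
    (by
      rintro n ⟨x, hx⟩
      induction hx using Submodule.span_induction with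
      | mem x h =>
        obtain ⟨l, rfl, rfl⟩ := h
        exact dec_prod 𝓦 l _
      | zero => dsimp only; rw [map_zero]; exact (map_zero _).symm
      | add x y _ _ hx hy =>
        dsimp only at hx hy ⊢
        rw [map_add, hx, hy, ← map_add]; rfl
      | smul c x _ hx =>
        dsimp only at hx ⊢
        rw [map_smul, hx, ← DirectSum.lof_eq_of ℚ, ← map_smul]; rfl)

end FreeGCA

end Free

/-! ## The DG algebra `Λ(t, dt)` -/

/-- `Λ(t, dt) = ℚ[t] ⊕ ℚ[t] dt` with `dt dt = 0`; the element `p + q dt` has first component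
`p` and second component `q`. -/
abbrev LambdaT : Type := TrivSqZeroExt ℚ[X] ℚ[X]

namespace LambdaT

/-- The grading of `Λ(t, dt)`: `|t| = 0` and `|dt| = 1`. -/
def gr : ℕ → Submodule ℚ LambdaT
  | 0 =>
    { carrier := {x | x.snd = 0}
      add_mem' := by intro a b ha hb; simp_all
      zero_mem' := by simp
      smul_mem' := by intro c a ha; simp_all }
  | 1 =>
    { carrier := {x | x.fst = 0}
      add_mem' := by intro a b ha hb; simp_all
      zero_mem' := by simp
      smul_mem' := by intro c a ha; simp_all }
  | _ + 2 => ⊥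

theorem mem_gr_zero {x : LambdaT} : x ∈ gr 0 ↔ x.snd = 0 := Iff.rfl

theorem mem_gr_one {x : LambdaT} : x ∈ gr 1 ↔ x.fst = 0 := Iff.rfl

theorem mem_gr_add_two {n : ℕ} {x : LambdaT} : x ∈ gr (n + 2) ↔ x = 0 := Iff.rfl

instance grGradedMonoid : SetLike.GradedMonoid gr where
  one_mem := by simp [mem_gr_zero]
  mul_mem := by
    intro m n x y hx hy
    match m, n, hx, hy with
    | 0, 0, hx, hy => rw [mem_gr_zero] at *; simp [hx, hy]
    | 0, 1, hx, hy => rw [mem_gr_zero] at hx; rw [mem_gr_one] at *; simp [hy]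
    | 1, 0, hx, hy => rw [mem_gr_zero] at hy; rw [mem_gr_one] at *; simp [hx]
    | 1, 1, hx, hy =>
      rw [mem_gr_one] at *
      rw [show 1 + 1 = 0 + 2 from rfl, mem_gr_add_two]
      ext <;> simp [hx, hy]
    | m + 2, n, hx, hy => rw [mem_gr_add_two] at hx; rw [hx, zero_mul]; exact zero_mem _
    | m, n + 2, hx, hy => rw [mem_gr_add_two] at hy; rw [hy, mul_zero]; exact zero_mem _

/-- Auxiliary: the degree `0` part of an element. -/
def proj0 : LambdaT →ₗ[ℚ] gr 0 where
  toFun x := ⟨TrivSqZeroExt.inl x.fst, TrivSqZeroExt.snd_inl _ _⟩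
  map_add' x y := by ext1; exact TrivSqZeroExt.inl_add _ _ _
  map_smul' c x := by ext1; exact TrivSqZeroExt.inl_smul _ _ _

/-- Auxiliary: the degree `1` part of an element. -/
def proj1 : LambdaT →ₗ[ℚ] gr 1 where
  toFun x := ⟨TrivSqZeroExt.inr x.snd, TrivSqZeroExt.fst_inr _ _⟩
  map_add' x y := by ext1; exact TrivSqZeroExt.inr_add _ _ _
  map_smul' c x := by ext1; exact TrivSqZeroExt.inr_smul _ _ _

theorem proj0_coe (x : gr 0) : proj0 x = x := by
  ext1; exact TrivSqZeroExt.ext rfl (x.2 : (x : LambdaT).snd = 0).symm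

theorem proj1_coe (x : gr 1) : proj1 x = x := by
  ext1; exact TrivSqZeroExt.ext (x.2 : (x : LambdaT).fst = 0).symm rfl

theorem proj0_of_fst {x : LambdaT} (h : x.fst = 0) : proj0 x = 0 := by
  ext1; exact TrivSqZeroExt.ext h rfl

theorem proj1_of_snd {x : LambdaT} (h : x.snd = 0) : proj1 x = 0 := by
  ext1; exact TrivSqZeroExt.ext rfl h

/-- Auxiliary: the decomposition map of `Λ(t, dt)`. -/
def dec : LambdaT →ₗ[ℚ] ⨁ n, gr n :=
  DirectSum.lof ℚ ℕ (fun n => gr n) 0 ∘ₗ proj0 + DirectSum.lof ℚ ℕ (fun n => gr n) 1 ∘ₗ proj1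

theorem dec_apply (x : LambdaT) : dec x = DirectSum.lof ℚ ℕ (fun n => gr n) 0 (proj0 x) +
    DirectSum.lof ℚ ℕ (fun n => gr n) 1 (proj1 x) := rfl

theorem dec_coe : ∀ (n : ℕ) (x : gr n), dec x = DirectSum.lof ℚ ℕ (fun n => gr n) n x
  | 0, x => by
    rw [dec_apply, proj0_coe, proj1_of_snd x.2, map_zero, add_zero]
  | 1, x => by
    rw [dec_apply, proj1_coe, proj0_of_fst x.2, map_zero, zero_add]
  | n + 2, x => by
    have hx : x = 0 := Subtype.ext x.2
    rw [hx, ZeroMemClass.coe_zero, map_zero, map_zero]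

instance gradedAlgebra : GradedAlgebra gr where
  toDecomposition := DirectSum.Decomposition.ofLinearMap _ dec
    (by
      ext1 x
      rw [LinearMap.comp_apply, dec_apply, map_add, DirectSum.coeLinearMap_lof,
        DirectSum.coeLinearMap_lof]
      exact TrivSqZeroExt.inl_fst_add_inr_snd_eq x)
    (by
      ext n x : 2
      simp only [LinearMap.comp_apply, DirectSum.coeLinearMap_lof, LinearMap.id_apply]
      exact dec_coe n x)

/-- The differential of `Λ(t, dt)`: `d(p + q dt) = p' dt`. -/
def d : LambdaT →ₗ[ℚ] LambdaT where
  toFun x := TrivSqZeroExt.inr (Polynomial.derivative x.fst)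
  map_add' x y := by
    rw [TrivSqZeroExt.fst_add, Polynomial.derivative_add, TrivSqZeroExt.inr_add]
  map_smul' c x := by
    rw [TrivSqZeroExt.fst_smul, Polynomial.derivative_smul, TrivSqZeroExt.inr_smul]; rfl

/-- The evaluation `Λ(t, dt) → ℚ` at `t = c`, `dt = 0`. -/
def ev (c : ℚ) : LambdaT →ₗ[ℚ] ℚ where
  toFun x := x.fst.eval c
  map_add' x y := by simp
  map_smul' a x := by simp

end LambdaT

/-! ## Linear maps out of tensor products -/

section Maps

variable {A : Type u} [Ring A] [Algebra ℚ A] (𝒜 : ℕ → Submodule ℚ A) [GradedAlgebra 𝒜]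
variable {A' : Type v} [Ring A'] [Algebra ℚ A'] (𝒜' : ℕ → Submodule ℚ A') [GradedAlgebra 𝒜']
variable {L : Type w} [Ring L] [Algebra ℚ L] (ℒ : ℕ → Submodule ℚ L) [GradedAlgebra ℒ]

/-- `f ⊗ 1 : A ⊗ L → A' ⊗ L`, `a ⊗ l ↦ f a ⊗ l`. -/
def mapLeft (f : A →ₗ[ℚ] A') : (𝒜 ᵍ⊗[ℚ] ℒ) →ₗ[ℚ] (𝒜' ᵍ⊗[ℚ] ℒ) :=
  tlift 𝒜 ℒ (tmk 𝒜' ℒ ∘ₗ f)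

/-- `a ⊗ l ↦ f a * g l`. -/
def mulExt {R : Type*} [Ring R] [Algebra ℚ R] (f : A →ₗ[ℚ] R) (g : L →ₗ[ℚ] R) :
    (𝒜 ᵍ⊗[ℚ] ℒ) →ₗ[ℚ] R :=
  tlift 𝒜 ℒ ((LinearMap.mul ℚ R).compl₁₂ f g)

/-- `a ⊗ l ↦ ε(l) f a`, for a linear form `ε` on `L`. -/
def contract {M : Type*} [AddCommGroup M] [Module ℚ M] (ε : L →ₗ[ℚ] ℚ) (f : A →ₗ[ℚ] M) :
    (𝒜 ᵍ⊗[ℚ] ℒ) →ₗ[ℚ] M :=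
  tlift 𝒜 ℒ ((LinearMap.lsmul ℚ M).flip.compl₁₂ f ε)

theorem mapLeft_tmul (f : A →ₗ[ℚ] A') (a : A) (l : L) :
    mapLeft 𝒜 𝒜' ℒ f (a ᵍ⊗ₜ[ℚ] l) = f a ᵍ⊗ₜ[ℚ] l := rfl

theorem mulExt_tmul {R : Type*} [Ring R] [Algebra ℚ R] (f : A →ₗ[ℚ] R) (g : L →ₗ[ℚ] R)
    (a : A) (l : L) : mulExt 𝒜 ℒ f g (a ᵍ⊗ₜ[ℚ] l) = f a * g l := rfl

theorem contract_tmul {M : Type*} [AddCommGroup M] [Module ℚ M] (ε : L →ₗ[ℚ] ℚ)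
    (f : A →ₗ[ℚ] M) (a : A) (l : L) : contract 𝒜 ℒ ε f (a ᵍ⊗ₜ[ℚ] l) = ε l • f a := rfl

variable {𝒜 ℒ} in
theorem tmul_swap {i j : ℕ} {a : A} {l : L} (ha : a ∈ 𝒜 i) (hl : l ∈ ℒ j) :
    ((1 : A) ᵍ⊗ₜ[ℚ] l * a ᵍ⊗ₜ[ℚ] (1 : L) : 𝒜 ᵍ⊗[ℚ] ℒ) =
      (-1 : ℚ) ^ (i * j) • (a ᵍ⊗ₜ[ℚ] (1 : L) * (1 : A) ᵍ⊗ₜ[ℚ] l) := by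
  have h := GradedTensorProduct.tmul_coe_mul_coe_tmul 𝒜 ℒ 1 ⟨l, hl⟩ ⟨a, ha⟩ 1
  dsimp only at h
  rw [h, GradedTensorProduct.tmul_one_mul_one_tmul, one_mul, mul_one, Units.smul_def,
    ← Int.cast_smul_eq_zsmul ℚ, mul_comm j i]
  simp

end Maps

/-! ## Homotopies under and over `B` -/

section Homotopy

variable {B : Type u} [Ring B] [Algebra ℚ B] (𝓑 : ℕ → Submodule ℚ B) [GradedAlgebra 𝓑]
variable {A : Type v} [Ring A] [Algebra ℚ A] (𝒜 : ℕ → Submodule ℚ A)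
variable {E : Type w} [Ring E] [Algebra ℚ E] (𝓔 : ℕ → Submodule ℚ E) [GradedAlgebra 𝓔]

/-- The differential of `E ⊗ Λ(t, dt)`: `x ⊗ u ↦ dx ⊗ u + (-1)^{|x|} x ⊗ du`. -/
def pathDiff (dE : E →ₗ[ℚ] E) : (𝓔 ᵍ⊗[ℚ] LambdaT.gr) →ₗ[ℚ] (𝓔 ᵍ⊗[ℚ] LambdaT.gr) :=
  tlift 𝓔 LambdaT.gr (tmk 𝓔 LambdaT.gr ∘ₗ dE) +
    tlift 𝓔 LambdaT.gr ((tmk 𝓔 LambdaT.gr).compl₁₂ (signInv 𝓔) LambdaT.d)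

/-- Two maps `ψ₀ ψ₁ : (A, dA) → (E, dE)` between DG algebras equipped with maps
`jA`, `jE` from `B` and `pA`, `pE` to `B` are DG homotopic under and over `B`: there is a DG
algebra map `H : A → E ⊗ Λ(t, dt)` which is the identity on `B`, commutes with the projections,
and satisfies `p₀ ∘ H = ψ₀` and `p₁ ∘ H = ψ₁`. -/
def HomotopicUnderOver (dA : A →ₗ[ℚ] A) (jA : B →ₗ[ℚ] A) (pA : A →ₗ[ℚ] B)
    (dE : E →ₗ[ℚ] E) (jE : B →ₗ[ℚ] E) (pE : E →ₗ[ℚ] B) (ψ₀ ψ₁ : A →ₗ[ℚ] E) : Prop :=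
  ∃ H : A →ₗ[ℚ] (𝓔 ᵍ⊗[ℚ] LambdaT.gr),
    IsDGMap 𝒜 dA (tensorGr 𝓔 LambdaT.gr) (pathDiff 𝓔 dE) H ∧
    (∀ b : B, H (jA b) = jE b ᵍ⊗ₜ[ℚ] (1 : LambdaT)) ∧
    (∀ x : A, mapLeft 𝓔 𝓑 LambdaT.gr pE (H x) = pA x ᵍ⊗ₜ[ℚ] (1 : LambdaT)) ∧
    (∀ x : A, contract 𝓔 LambdaT.gr (LambdaT.ev 0) LinearMap.id (H x) = ψ₀ x) ∧
    (∀ x : A, contract 𝓔 LambdaT.gr (LambdaT.ev 1) LinearMap.id (H x) = ψ₁ x)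

end Homotopy

/-! ## The algebras `E ⊗ ΛW` -/

section FreeExt

variable {E : Type u} [Ring E] [Algebra ℚ E] (𝓔 : ℕ → Submodule ℚ E) [GradedAlgebra 𝓔]
variable {W : Type v} [AddCommGroup W] [Module ℚ W] (𝓦 : ℕ → Submodule ℚ W)
  [DirectSum.Decomposition 𝓦]

/-- The graded algebra `E ⊗ ΛW`. With `E = B` this is `B ⊗ ΛW`; with `E = B ⊗ ΛW` this is
`B ⊗ ΛW ⊗ ΛW`, and so on. -/
abbrev FreeExt : Type (max u v) := 𝓔 ᵍ⊗[ℚ] (FreeGCA.gr 𝓦)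

/-- The grading of `E ⊗ ΛW`. -/
abbrev freeExtGr : ℕ → Submodule ℚ (FreeExt 𝓔 𝓦) := tensorGr 𝓔 (FreeGCA.gr 𝓦)

/-- The inclusion `E → E ⊗ ΛW`. -/
def inl : E →ₗ[ℚ] FreeExt 𝓔 𝓦 :=
  (GradedTensorProduct.includeLeft 𝓔 (FreeGCA.gr 𝓦)).toLinearMap

/-- The inclusion `ΛW → E ⊗ ΛW`. -/
def inr : FreeGCA 𝓦 →ₗ[ℚ] FreeExt 𝓔 𝓦 :=
  (GradedTensorProduct.includeRight 𝓔 (FreeGCA.gr 𝓦)).toLinearMap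

/-- The inclusion of the generators `W → E ⊗ ΛW`. -/
def gen : W →ₗ[ℚ] FreeExt 𝓔 𝓦 := inr 𝓔 𝓦 ∘ₗ FreeGCA.ι 𝓦

/-- The projection `E ⊗ ΛW → E → B` killing `W`, for a given projection `p : E → B`. -/
def projExt {B : Type w} [AddCommGroup B] [Module ℚ B] (p : E →ₗ[ℚ] B) :
    FreeExt 𝓔 𝓦 →ₗ[ℚ] B :=
  contract 𝓔 (FreeGCA.gr 𝓦) (FreeGCA.aug 𝓦).toLinearMap p

end FreeExt

/-! ## The algebras `B ⊗ ΛW`, `B ⊗ ΛW ⊗ ΛW`, `B ⊗ ΛW ⊗ ΛW ⊗ ΛW` -/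

section Models

variable {B : Type u} [Ring B] [Algebra ℚ B] (𝓑 : ℕ → Submodule ℚ B) [GradedAlgebra 𝓑]
variable {W : Type v} [AddCommGroup W] [Module ℚ W] (𝓦 : ℕ → Submodule ℚ W)
  [DirectSum.Decomposition 𝓦]

/-- `B ⊗ ΛW`. -/
abbrev Model₁ : Type (max u v) := FreeExt 𝓑 𝓦
/-- The grading of `B ⊗ ΛW`. -/
abbrev gr₁ : ℕ → Submodule ℚ (Model₁ 𝓑 𝓦) := freeExtGr 𝓑 𝓦
/-- `B ⊗ ΛW ⊗ ΛW`. -/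
abbrev Model₂ : Type (max u v) := FreeExt (gr₁ 𝓑 𝓦) 𝓦
/-- The grading of `B ⊗ ΛW ⊗ ΛW`. -/
abbrev gr₂ : ℕ → Submodule ℚ (Model₂ 𝓑 𝓦) := freeExtGr (gr₁ 𝓑 𝓦) 𝓦
/-- `B ⊗ ΛW ⊗ ΛW ⊗ ΛW`. -/
abbrev Model₃ : Type (max u v) := FreeExt (gr₂ 𝓑 𝓦) 𝓦
/-- The grading of `B ⊗ ΛW ⊗ ΛW ⊗ ΛW`. -/
abbrev gr₃ : ℕ → Submodule ℚ (Model₃ 𝓑 𝓦) := freeExtGr (gr₂ 𝓑 𝓦) 𝓦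

/-- The inclusion `B → B ⊗ ΛW`. -/
def base₁ : B →ₗ[ℚ] Model₁ 𝓑 𝓦 := inl 𝓑 𝓦
/-- The inclusion `B → B ⊗ ΛW ⊗ ΛW`. -/
def base₂ : B →ₗ[ℚ] Model₂ 𝓑 𝓦 := inl (gr₁ 𝓑 𝓦) 𝓦 ∘ₗ base₁ 𝓑 𝓦
/-- The inclusion `B → B ⊗ ΛW ⊗ ΛW ⊗ ΛW`. -/
def base₃ : B →ₗ[ℚ] Model₃ 𝓑 𝓦 := inl (gr₂ 𝓑 𝓦) 𝓦 ∘ₗ base₂ 𝓑 𝓦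

/-- The projection `B ⊗ ΛW → B`. -/
def proj₁ : Model₁ 𝓑 𝓦 →ₗ[ℚ] B := projExt 𝓑 𝓦 LinearMap.id
/-- The projection `B ⊗ ΛW ⊗ ΛW → B`. -/
def proj₂ : Model₂ 𝓑 𝓦 →ₗ[ℚ] B := projExt (gr₁ 𝓑 𝓦) 𝓦 (proj₁ 𝓑 𝓦)
/-- The projection `B ⊗ ΛW ⊗ ΛW ⊗ ΛW → B`. -/
def proj₃ : Model₃ 𝓑 𝓦 →ₗ[ℚ] B := projExt (gr₂ 𝓑 𝓦) 𝓦 (proj₂ 𝓑 𝓦)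

/-- The first inclusion `B ⊗ ΛW → B ⊗ ΛW ⊗ ΛW`, `b ⊗ l ↦ b ⊗ l ⊗ 1`. -/
def fst₂ : Model₁ 𝓑 𝓦 →ₗ[ℚ] Model₂ 𝓑 𝓦 := inl (gr₁ 𝓑 𝓦) 𝓦
/-- The second inclusion `B ⊗ ΛW → B ⊗ ΛW ⊗ ΛW`, `b ⊗ l ↦ b ⊗ 1 ⊗ l`. -/
def snd₂ : Model₁ 𝓑 𝓦 →ₗ[ℚ] Model₂ 𝓑 𝓦 :=
  mapLeft 𝓑 (gr₁ 𝓑 𝓦) (FreeGCA.gr 𝓦) (base₁ 𝓑 𝓦)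

/-- The inclusion `B ⊗ ΛW ⊗ ΛW → B ⊗ ΛW ⊗ ΛW ⊗ ΛW`, `b ⊗ l ⊗ l' ↦ b ⊗ l ⊗ l' ⊗ 1`. -/
def incl₁₂ : Model₂ 𝓑 𝓦 →ₗ[ℚ] Model₃ 𝓑 𝓦 := inl (gr₂ 𝓑 𝓦) 𝓦
/-- The inclusion `B ⊗ ΛW ⊗ ΛW → B ⊗ ΛW ⊗ ΛW ⊗ ΛW`, `b ⊗ l ⊗ l' ↦ b ⊗ 1 ⊗ l ⊗ l'`. -/
def incl₂₃ : Model₂ 𝓑 𝓦 →ₗ[ℚ] Model₃ 𝓑 𝓦 :=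
  mapLeft (gr₁ 𝓑 𝓦) (gr₂ 𝓑 𝓦) (FreeGCA.gr 𝓦) (snd₂ 𝓑 𝓦)

/-- The generator `w` of `B ⊗ ΛW ⊗ ΛW`, i.e. `1 ⊗ w ⊗ 1`. -/
def genFst : W →ₗ[ℚ] Model₂ 𝓑 𝓦 := fst₂ 𝓑 𝓦 ∘ₗ gen 𝓑 𝓦
/-- The generator `w'` of `B ⊗ ΛW ⊗ ΛW`, i.e. `1 ⊗ 1 ⊗ w`. -/
def genSnd : W →ₗ[ℚ] Model₂ 𝓑 𝓦 := snd₂ 𝓑 𝓦 ∘ₗ gen 𝓑 𝓦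

/-! ### Differentials -/

/-- The differential `d_B ⊗ 1` on `B ⊗ ΛW`. -/
def trivialDiff (dB : B →ₗ[ℚ] B) : Model₁ 𝓑 𝓦 →ₗ[ℚ] Model₁ 𝓑 𝓦 :=
  mapLeft 𝓑 𝓑 (FreeGCA.gr 𝓦) dB

/-- The differential `D ⊗_B 1 + 1 ⊗_B D` on `B ⊗ ΛW ⊗ ΛW = (B ⊗ ΛW) ⊗_B (B ⊗ ΛW)`:
it sends `x ⊗ l` to `D x ⊗ l + (-1)^{|x|} x · D(l)'`. -/
def diff₂ (D : Model₁ 𝓑 𝓦 →ₗ[ℚ] Model₁ 𝓑 𝓦) : Model₂ 𝓑 𝓦 →ₗ[ℚ] Model₂ 𝓑 𝓦 :=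
  mapLeft (gr₁ 𝓑 𝓦) (gr₁ 𝓑 𝓦) (FreeGCA.gr 𝓦) D +
    mulExt (gr₁ 𝓑 𝓦) (FreeGCA.gr 𝓦) (fst₂ 𝓑 𝓦 ∘ₗ signInv (gr₁ 𝓑 𝓦))
      (snd₂ 𝓑 𝓦 ∘ₗ D ∘ₗ inr 𝓑 𝓦)

/-- The differential `D ⊗_B 1 ⊗_B 1 + 1 ⊗_B D ⊗_B 1 + 1 ⊗_B 1 ⊗_B D` on
`B ⊗ ΛW ⊗ ΛW ⊗ ΛW`. -/
def diff₃ (D : Model₁ 𝓑 𝓦 →ₗ[ℚ] Model₁ 𝓑 𝓦) : Model₃ 𝓑 𝓦 →ₗ[ℚ] Model₃ 𝓑 𝓦 :=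
  mapLeft (gr₂ 𝓑 𝓦) (gr₂ 𝓑 𝓦) (FreeGCA.gr 𝓦) (diff₂ 𝓑 𝓦 D) +
    mulExt (gr₂ 𝓑 𝓦) (FreeGCA.gr 𝓦) (incl₁₂ 𝓑 𝓦 ∘ₗ signInv (gr₂ 𝓑 𝓦))
      (incl₂₃ 𝓑 𝓦 ∘ₗ snd₂ 𝓑 𝓦 ∘ₗ D ∘ₗ inr 𝓑 𝓦)

/-! ### Induced maps on tensor products over `B` -/

/-- `C ⊗_B 1 : B ⊗ ΛW ⊗ ΛW → B ⊗ ΛW ⊗ ΛW ⊗ ΛW`, `x ⊗ l ↦ C x ⊗ l`. -/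
def comulLeft (C : Model₁ 𝓑 𝓦 →ₗ[ℚ] Model₂ 𝓑 𝓦) : Model₂ 𝓑 𝓦 →ₗ[ℚ] Model₃ 𝓑 𝓦 :=
  mapLeft (gr₁ 𝓑 𝓦) (gr₂ 𝓑 𝓦) (FreeGCA.gr 𝓦) C

/-- `1 ⊗_B C : B ⊗ ΛW ⊗ ΛW → B ⊗ ΛW ⊗ ΛW ⊗ ΛW`: the product of the inclusion of the first
factor `B ⊗ ΛW` and of `C` on the second, with values in the second and third factors. -/
def comulRight (C : Model₁ 𝓑 𝓦 →ₗ[ℚ] Model₂ 𝓑 𝓦) : Model₂ 𝓑 𝓦 →ₗ[ℚ] Model₃ 𝓑 𝓦 :=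
  mulExt (gr₁ 𝓑 𝓦) (FreeGCA.gr 𝓦) (incl₁₂ 𝓑 𝓦 ∘ₗ fst₂ 𝓑 𝓦)
    (incl₂₃ 𝓑 𝓦 ∘ₗ C ∘ₗ inr 𝓑 𝓦)

/-- `φ ⊗_B φ : B ⊗ ΛW ⊗ ΛW → B ⊗ ΛW ⊗ ΛW`. -/
def tensorSq (φ : Model₁ 𝓑 𝓦 →ₗ[ℚ] Model₁ 𝓑 𝓦) : Model₂ 𝓑 𝓦 →ₗ[ℚ] Model₂ 𝓑 𝓦 :=
  mulExt (gr₁ 𝓑 𝓦) (FreeGCA.gr 𝓦) (fst₂ 𝓑 𝓦 ∘ₗ φ) (snd₂ 𝓑 𝓦 ∘ₗ φ ∘ₗ inr 𝓑 𝓦)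

/-! ### Relative models and fibrewise multiplications -/

/-- `(B, dB) → (B ⊗ ΛW, D)` is a relative model: `W` is concentrated in positive degrees, `D` is
a differential extending `dB`, and `W` has a well-ordered homogeneous basis `(wᵢ)` such that
`D wᵢ ∈ B ⊗ Λ(wⱼ : j < i)` (a Koszul-Sullivan basis). -/
structure IsRelativeModel (dB : B →ₗ[ℚ] B) (D : Model₁ 𝓑 𝓦 →ₗ[ℚ] Model₁ 𝓑 𝓦) : Prop where
  pos : 𝓦 0 = ⊥
  isDifferential : IsDifferential (gr₁ 𝓑 𝓦) D
  base : ∀ b : B, D (base₁ 𝓑 𝓦 b) = base₁ 𝓑 𝓦 (dB b)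
  ks : ∃ (I : Type v) (_ : LinearOrder I) (_ : WellFoundedLT I) (e : Module.Basis I ℚ W),
    (∀ i, ∃ n, e i ∈ 𝓦 n) ∧
    ∀ i, D (gen 𝓑 𝓦 (e i)) ∈
      Algebra.adjoin ℚ (Set.range (base₁ 𝓑 𝓦) ∪ (fun j => gen 𝓑 𝓦 (e j)) '' Set.Iio i)

/-- The subspace `B ⊗ Λ⁺W ⊗ Λ⁺W` of `B ⊗ ΛW ⊗ ΛW`. -/
def plusPlus : Submodule ℚ (Model₂ 𝓑 𝓦) :=
  Submodule.span ℚ {z | ∃ (b : B) (l l' : FreeGCA 𝓦), FreeGCA.aug 𝓦 l = 0 ∧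
    FreeGCA.aug 𝓦 l' = 0 ∧
    z = (b ᵍ⊗ₜ[ℚ] l : Model₁ 𝓑 𝓦) ᵍ⊗ₜ[ℚ] l'}

/-- `C : (B ⊗ ΛW, D) → (B ⊗ ΛW ⊗ ΛW, D)` is a fibrewise multiplication of models: a DG algebra
map which is the identity on `B`, commutes with the projections to `B`, and satisfies
`C(w) - w - w' ∈ B ⊗ Λ⁺W ⊗ Λ⁺W` for `w ∈ W`. -/
structure IsFibrewiseMultiplication (D : Model₁ 𝓑 𝓦 →ₗ[ℚ] Model₁ 𝓑 𝓦)
    (C : Model₁ 𝓑 𝓦 →ₗ[ℚ] Model₂ 𝓑 𝓦) : Prop where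
  isDGMap : IsDGMap (gr₁ 𝓑 𝓦) D (gr₂ 𝓑 𝓦) (diff₂ 𝓑 𝓦 D) C
  base : ∀ b : B, C (base₁ 𝓑 𝓦 b) = base₂ 𝓑 𝓦 b
  proj : ∀ x, proj₂ 𝓑 𝓦 (C x) = proj₁ 𝓑 𝓦 x
  unit : ∀ x : W, C (gen 𝓑 𝓦 x) - genFst 𝓑 𝓦 x - genSnd 𝓑 𝓦 x ∈ plusPlus 𝓑 𝓦

/-- `C` is associative: `(C ⊗_B 1) ∘ C` and `(1 ⊗_B C) ∘ C` are DG homotopic under and over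
`B`. -/
def IsAssociative (D : Model₁ 𝓑 𝓦 →ₗ[ℚ] Model₁ 𝓑 𝓦)
    (C : Model₁ 𝓑 𝓦 →ₗ[ℚ] Model₂ 𝓑 𝓦) : Prop :=
  HomotopicUnderOver 𝓑 (gr₁ 𝓑 𝓦) (gr₃ 𝓑 𝓦)
    D (base₁ 𝓑 𝓦) (proj₁ 𝓑 𝓦) (diff₃ 𝓑 𝓦 D) (base₃ 𝓑 𝓦) (proj₃ 𝓑 𝓦)
    (comulLeft 𝓑 𝓦 C ∘ₗ C) (comulRight 𝓑 𝓦 C ∘ₗ C)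

/-- The equivalence `(D₁, C₁) ≡ (D₂, C₂)` of fibrewise multiplications of models, under and
over `B`: there is a DG algebra isomorphism `φ : (B ⊗ ΛW, D₂) → (B ⊗ ΛW, D₁)` that is the
identity on `B` and commutes with the projections, such that `C₁ ∘ φ` and `(φ ⊗_B φ) ∘ C₂` are
DG homotopic under and over `B`. -/
def ModelEquivalent (D₁ : Model₁ 𝓑 𝓦 →ₗ[ℚ] Model₁ 𝓑 𝓦) (C₁ : Model₁ 𝓑 𝓦 →ₗ[ℚ] Model₂ 𝓑 𝓦)
    (D₂ : Model₁ 𝓑 𝓦 →ₗ[ℚ] Model₁ 𝓑 𝓦) (C₂ : Model₁ 𝓑 𝓦 →ₗ[ℚ] Model₂ 𝓑 𝓦) : Prop :=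
  ∃ φ : Model₁ 𝓑 𝓦 ≃ₗ[ℚ] Model₁ 𝓑 𝓦,
    IsDGMap (gr₁ 𝓑 𝓦) D₂ (gr₁ 𝓑 𝓦) D₁ φ.toLinearMap ∧
    (∀ b : B, φ (base₁ 𝓑 𝓦 b) = base₁ 𝓑 𝓦 b) ∧
    (∀ x, proj₁ 𝓑 𝓦 (φ x) = proj₁ 𝓑 𝓦 x) ∧
    HomotopicUnderOver 𝓑 (gr₁ 𝓑 𝓦) (gr₂ 𝓑 𝓦)
      D₂ (base₁ 𝓑 𝓦) (proj₁ 𝓑 𝓦) (diff₂ 𝓑 𝓦 D₁) (base₂ 𝓑 𝓦) (proj₂ 𝓑 𝓦)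
      (C₁ ∘ₗ φ.toLinearMap) (tensorSq 𝓑 𝓦 φ.toLinearMap ∘ₗ C₂)

/-! ### The standard multiplication -/

theorem genSum_mul (i j : ℕ) (x y : W) (hx : x ∈ 𝓦 i) (hy : y ∈ 𝓦 j) :
    (genFst 𝓑 𝓦 + genSnd 𝓑 𝓦) x * (genFst 𝓑 𝓦 + genSnd 𝓑 𝓦) y =
      (-1 : ℚ) ^ (i * j) • ((genFst 𝓑 𝓦 + genSnd 𝓑 𝓦) y * (genFst 𝓑 𝓦 + genSnd 𝓑 𝓦) x) := by
  have hgx : gen 𝓑 𝓦 x ∈ gr₁ 𝓑 𝓦 i := by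
    have := tmul_mem_tensorGr (𝒜 := 𝓑) (SetLike.GradedOne.one_mem : (1 : B) ∈ 𝓑 0)
      (FreeGCA.ι_mem_gr 𝓦 hx)
    rwa [zero_add] at this
  have hgy : gen 𝓑 𝓦 y ∈ gr₁ 𝓑 𝓦 j := by
    have := tmul_mem_tensorGr (𝒜 := 𝓑) (SetLike.GradedOne.one_mem : (1 : B) ∈ 𝓑 0)
      (FreeGCA.ι_mem_gr 𝓦 hy)
    rwa [zero_add] at this
  have h11 : genFst 𝓑 𝓦 x * genFst 𝓑 𝓦 y =
      (-1 : ℚ) ^ (i * j) • (genFst 𝓑 𝓦 y * genFst 𝓑 𝓦 x) := by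
    have := congrArg ((GradedTensorProduct.includeLeft (gr₁ 𝓑 𝓦) (FreeGCA.gr 𝓦)).comp
      (GradedTensorProduct.includeRight 𝓑 (FreeGCA.gr 𝓦))) (FreeGCA.ι_mul_ι 𝓦 hx hy)
    rw [map_mul, map_smul, map_mul] at this
    exact this
  have h22 : genSnd 𝓑 𝓦 x * genSnd 𝓑 𝓦 y =
      (-1 : ℚ) ^ (i * j) • (genSnd 𝓑 𝓦 y * genSnd 𝓑 𝓦 x) := by
    have := congrArg (GradedTensorProduct.includeRight (gr₁ 𝓑 𝓦) (FreeGCA.gr 𝓦))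
      (FreeGCA.ι_mul_ι 𝓦 hx hy)
    rw [map_mul, map_smul, map_mul] at this
    exact this
  have h21 : genSnd 𝓑 𝓦 x * genFst 𝓑 𝓦 y =
      (-1 : ℚ) ^ (i * j) • (genFst 𝓑 𝓦 y * genSnd 𝓑 𝓦 x) := by
    have := tmul_swap hgy (FreeGCA.ι_mem_gr 𝓦 hx)
    rw [mul_comm j i] at this
    exact this
  have h12 : genSnd 𝓑 𝓦 y * genFst 𝓑 𝓦 x =
      (-1 : ℚ) ^ (i * j) • (genFst 𝓑 𝓦 x * genSnd 𝓑 𝓦 y) :=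
    tmul_swap hgx (FreeGCA.ι_mem_gr 𝓦 hy)
  have hs : (-1 : ℚ) ^ (i * j) * (-1 : ℚ) ^ (i * j) = 1 := by
    rw [← mul_pow]; simp
  simp only [LinearMap.add_apply, mul_add, add_mul, smul_add]
  rw [h11, h22, h21, h12, smul_smul, hs, one_smul]
  abel

/-- The standard multiplication `C₀ : B ⊗ ΛW → B ⊗ ΛW ⊗ ΛW`: the algebra map that is the
identity on `B` and satisfies `C₀(w) = w + w'` for `w ∈ W`. -/
def stdMul : Model₁ 𝓑 𝓦 →ₗ[ℚ] Model₂ 𝓑 𝓦 :=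
  mulExt 𝓑 (FreeGCA.gr 𝓦) (base₂ 𝓑 𝓦)
    (FreeGCA.lift 𝓦 (genFst 𝓑 𝓦 + genSnd 𝓑 𝓦) (genSum_mul 𝓑 𝓦)).toLinearMap

theorem stdMul_base (b : B) : stdMul 𝓑 𝓦 (base₁ 𝓑 𝓦 b) = base₂ 𝓑 𝓦 b := by
  change base₂ 𝓑 𝓦 b * FreeGCA.lift 𝓦 (genFst 𝓑 𝓦 + genSnd 𝓑 𝓦) (genSum_mul 𝓑 𝓦) 1 = _
  rw [map_one, mul_one]

theorem stdMul_gen (x : W) : stdMul 𝓑 𝓦 (gen 𝓑 𝓦 x) = genFst 𝓑 𝓦 x + genSnd 𝓑 𝓦 x := by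
  change 1 * FreeGCA.lift 𝓦 (genFst 𝓑 𝓦 + genSnd 𝓑 𝓦) (genSum_mul 𝓑 𝓦) (FreeGCA.ι 𝓦 x) = _
  rw [FreeGCA.lift_ι, one_mul, LinearMap.add_apply]

/-! ### The four maps `α, β, γ, δ` -/

/-- `α(w) = w`, `α(w') = w'`. -/
def alphaMap : Model₂ 𝓑 𝓦 →ₗ[ℚ] Model₃ 𝓑 𝓦 := incl₁₂ 𝓑 𝓦
/-- `β(w) = w + w'`, `β(w') = w''`. -/
def betaMap : Model₂ 𝓑 𝓦 →ₗ[ℚ] Model₃ 𝓑 𝓦 := comulLeft 𝓑 𝓦 (stdMul 𝓑 𝓦)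
/-- `γ(w) = w`, `γ(w') = w' + w''`. -/
def gammaMap : Model₂ 𝓑 𝓦 →ₗ[ℚ] Model₃ 𝓑 𝓦 := comulRight 𝓑 𝓦 (stdMul 𝓑 𝓦)
/-- `δ(w) = w'`, `δ(w') = w''`. -/
def deltaMap : Model₂ 𝓑 𝓦 →ₗ[ℚ] Model₃ 𝓑 𝓦 := incl₂₃ 𝓑 𝓦

/-- The mixed elements of length `r`: the subspace `∑_{1 ≤ s ≤ r-1} B ⊗ Λ^s W ⊗ Λ^{r-s} W` of
`B ⊗ ΛW ⊗ ΛW`. -/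
def mixed (r : ℕ) : Submodule ℚ (Model₂ 𝓑 𝓦) :=
  Submodule.span ℚ {z | ∃ (s s' : ℕ) (b : B) (l l' : FreeGCA 𝓦), 1 ≤ s ∧ 1 ≤ s' ∧ s + s' = r ∧
    l ∈ FreeGCA.word 𝓦 s ∧ l' ∈ FreeGCA.word 𝓦 s' ∧
    z = (b ᵍ⊗ₜ[ℚ] l : Model₁ 𝓑 𝓦) ᵍ⊗ₜ[ℚ] l'}

/-- The ordered product `f(w_{i₁}) ⋯ f(w_{i_r})` in `B ⊗ ΛW ⊗ ΛW` for a sequence of elements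
of `W`; with `f(w) = w`, `w'`, `w + w'` this gives `w_I`, `w'_I`, `S_I`. -/
def wordProd (f : W →ₗ[ℚ] Model₂ 𝓑 𝓦) {r : ℕ} (x : Fin r → W) : Model₂ 𝓑 𝓦 :=
  (List.ofFn fun k => f (x k)).prod

end Models

end FibrewiseModels

end

/-! Everything is filtered by powers of the augmentation ideal `I`, the kernel of the projection to
`B`. Since `W` sits in positive degrees, `I ^ k` starts in degree `k`; hence anything true modulo
every power of `I` is true.

Trivialising `D`. Let `P` be `C` followed by the multiplication of `B ⊗ ΛW` (`sq`). By unitality `P`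
is multiplication by 2 on `I / I²`, hence by `2 ^ r` on `I ^ r / I ^ (r + 1)` (`Cong.pow`).
Eigenvalue separation lifts each basis element of `W` to a vector `τ i` with `P (τ i) = 2 τ i`
(`exists_eigen`). As `D` commutes with `P`, `D (τ i)` is again a 2-eigenvector; its part in `I²`
vanishes, so it is a `B`-linear combination of earlier `τ j`. All `τ j` have odd degree, so the
coefficients have odd degree; after passing to closed coordinates they are closed, hence exact, and
can be absorbed (`exists_closed_coordinates`). The resulting closed generators define a map from `(B
⊗ ΛW, d_B ⊗ 1)`, surjective by the filtration and injective by finite type (`exists_iso`).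

Trivialising `C`. For a closed generator `x` the deviation `C x - x - x'` is closed, of odd degree
and in `I²`. It is shown to be a coboundary modulo `I ^ r` for all `r ≥ 3` by induction. For `r = 3`
the leading part has word length two, so its coefficients in `B` are odd and a contraction of the
odd part of `B` applies (`mem_bdry_three`). For the step, write the deviation as a coboundary plus
`ρ` in `I ^ r`. Homotopy associativity makes `ρ` a cocycle modulo coboundaries, and `P x = 2 x`
makes it vanish on the diagonal. Evaluating `ρ` on maps whose linear parts are `p` and `q` in `ℕ ×
ℕ` gives an ordinary 2-cocycle `f p q`, homogeneous of degree `r ≥ 3` under doubling. Such a cocycle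
is symmetric, because its antisymmetrisation is biadditive and so scales by 4; vanishing on the
diagonal then forces `f (2p) (2q) = 2 f p q`, hence `f = 0` (`cocycle_eq_zero`,
`mem_bdry_of_cocycle`). Primitives of the deviations on a basis assemble to a homotopy, the source
having closed generators (`homotopicUnderOver_of_basis`).

Part (2) is the same cocycle argument for zero differential: subtracting the deviation of `m(χ) / (2
^ r - 2)`, where `m` is multiplication, makes `χ` vanish on the diagonal, so the difference lies in
`I ^ (r + 1)`; it is also an eigenvector for `2 ^ r`, hence zero (`exists_eq_cobd`). -/

open scoped TensorProduct DirectSum Polynomial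

noncomputable section

namespace FibrewiseModels

universe u v w

set_option linter.unusedSectionVars false

/-! ## Graded linear algebra -/

section Graded

variable {V : Type u} [AddCommGroup V] [Module ℚ V] (𝒱 : ℕ → Submodule ℚ V)
  [DirectSum.Decomposition 𝒱]
variable {V' : Type v} [AddCommGroup V'] [Module ℚ V'] (𝒱' : ℕ → Submodule ℚ V')
  [DirectSum.Decomposition 𝒱']

theorem decompose_map (k : ℕ) (f : V →ₗ[ℚ] V') (hf : ∀ n x, x ∈ 𝒱 n → f x ∈ 𝒱' (n + k))
    (x : V) (n : ℕ) :
    (DirectSum.decompose 𝒱' (f x) (n + k) : V') = f (DirectSum.decompose 𝒱 x n) := by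
  induction x using DirectSum.Decomposition.inductionOn 𝒱 with
  | zero => simp
  | @homogeneous i x =>
    by_cases h : i = n
    · subst h
      rw [DirectSum.decompose_of_mem_same _ (hf _ _ x.2), DirectSum.decompose_of_mem_same _ x.2]
    · rw [DirectSum.decompose_of_mem_ne _ (hf _ _ x.2) (by omega),
        DirectSum.decompose_of_mem_ne _ x.2 h, map_zero]
  | add x y hx hy => simp [DirectSum.decompose_add, hx, hy]

theorem decompose_map_zero (f : V →ₗ[ℚ] V') (hf : ∀ n x, x ∈ 𝒱 n → f x ∈ 𝒱' n)
    (x : V) (n : ℕ) :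
    (DirectSum.decompose 𝒱' (f x) n : V') = f (DirectSum.decompose 𝒱 x n) :=
  decompose_map 𝒱 𝒱' 0 f hf x n

theorem eq_zero_of_decompose (x : V) (h : ∀ n, (DirectSum.decompose 𝒱 x n : V) = 0) : x = 0 := by
  classical
  rw [← DirectSum.sum_support_decompose 𝒱 x]
  exact Finset.sum_eq_zero fun n _ => h n

theorem mem_of_decompose (S : Submodule ℚ V) (x : V)
    (h : ∀ n, (DirectSum.decompose 𝒱 x n : V) ∈ S) : x ∈ S := by
  classical
  rw [← DirectSum.sum_support_decompose 𝒱 x]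
  exact Submodule.sum_mem _ fun n _ => h n

end Graded

section Sign

variable {A : Type u} [Ring A] [Algebra ℚ A] (𝒜 : ℕ → Submodule ℚ A) [GradedAlgebra 𝒜]

theorem signInv_of_mem {n : ℕ} {x : A} (hx : x ∈ 𝒜 n) : signInv 𝒜 x = (-1 : ℚ) ^ n • x := by
  lift x to 𝒜 n using hx
  rw [signInv, LinearMap.comp_apply, LinearEquiv.coe_coe, DirectSum.decomposeLinearEquiv_apply,
    DirectSum.decompose_coe, ← DirectSum.lof_eq_of ℚ, DirectSum.toModule_lof]
  rfl

theorem neg_one_pow_mul_self (n : ℕ) : (-1 : ℚ) ^ n * (-1 : ℚ) ^ n = 1 := by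
  rw [← mul_pow]; simp

theorem signInv_signInv (x : A) : signInv 𝒜 (signInv 𝒜 x) = x := by
  induction x using DirectSum.Decomposition.inductionOn 𝒜 with
  | zero => simp
  | homogeneous x =>
    rw [signInv_of_mem 𝒜 x.2, map_smul, signInv_of_mem 𝒜 x.2, smul_smul, neg_one_pow_mul_self,
      one_smul]
  | add x y hx hy => rw [map_add, map_add, hx, hy]

/-- A derivation of degree `+1` of a graded algebra, not necessarily of square zero. -/
structure IsOddDerivation (d : A →ₗ[ℚ] A) : Prop where
  map_mem : ∀ (n : ℕ) (x : A), x ∈ 𝒜 n → d x ∈ 𝒜 (n + 1)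
  leibniz : ∀ (n : ℕ) (x y : A), x ∈ 𝒜 n → d (x * y) = d x * y + (-1 : ℚ) ^ n • (x * d y)

variable {𝒜}

theorem IsDifferential.isOddDerivation {d : A →ₗ[ℚ] A} (h : IsDifferential 𝒜 d) :
    IsOddDerivation 𝒜 d :=
  ⟨h.map_mem, h.leibniz⟩

theorem isOddDerivation_zero : IsOddDerivation 𝒜 (0 : A →ₗ[ℚ] A) :=
  ⟨fun _ _ _ => Submodule.zero_mem _, by simp⟩

theorem IsOddDerivation.leibniz_signInv {d : A →ₗ[ℚ] A} (h : IsOddDerivation 𝒜 d) (x y : A) :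
    d (x * y) = d x * y + signInv 𝒜 x * d y := by
  induction x using DirectSum.Decomposition.inductionOn 𝒜 with
  | zero => simp
  | homogeneous x => rw [h.leibniz _ _ _ x.2, signInv_of_mem 𝒜 x.2, smul_mul_assoc]
  | add x x' hx hy => rw [add_mul, map_add, hx, hy, map_add, map_add, add_mul, add_mul]; abel

theorem IsOddDerivation.map_one {d : A →ₗ[ℚ] A} (h : IsOddDerivation 𝒜 d) : d 1 = 0 := by
  have := h.leibniz 0 1 1 SetLike.GradedOne.one_mem
  simpa using this

theorem IsOddDerivation.map_signInv {d : A →ₗ[ℚ] A} (h : IsOddDerivation 𝒜 d) (x : A) :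
    d (signInv 𝒜 x) = -signInv 𝒜 (d x) := by
  induction x using DirectSum.Decomposition.inductionOn 𝒜 with
  | zero => simp
  | homogeneous x =>
    rw [signInv_of_mem 𝒜 x.2, map_smul, signInv_of_mem 𝒜 (h.map_mem _ _ x.2), pow_succ]
    simp
  | add x y hx hy => simp only [map_add, hx, hy]; abel

end Sign

/-! ## Graded tensor products -/

section Tensor

variable {A : Type u} [Ring A] [Algebra ℚ A] (𝒜 : ℕ → Submodule ℚ A) [GradedAlgebra 𝒜]
variable {L : Type v} [Ring L] [Algebra ℚ L] (ℒ : ℕ → Submodule ℚ L) [GradedAlgebra ℒ]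

variable {𝒜 ℒ} in
theorem tensor_hom_ext {M : Type*} [AddCommGroup M] [Module ℚ M]
    {f g : (𝒜 ᵍ⊗[ℚ] ℒ) →ₗ[ℚ] M}
    (h : ∀ i j a l, a ∈ 𝒜 i → l ∈ ℒ j → f (a ᵍ⊗ₜ[ℚ] l) = g (a ᵍ⊗ₜ[ℚ] l)) : f = g := by
  apply GradedTensorProduct.hom_ext
  ext1
  refine DirectSum.decompose_lhom_ext 𝒜 fun i => ?_
  ext1 a
  refine DirectSum.decompose_lhom_ext ℒ fun j => ?_
  ext1 l
  exact h i j a l a.2 l.2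

variable {𝒜 ℒ} in
theorem tensor_mem {S : Submodule ℚ (𝒜 ᵍ⊗[ℚ] ℒ)}
    (h : ∀ i j a l, a ∈ 𝒜 i → l ∈ ℒ j → (a ᵍ⊗ₜ[ℚ] l) ∈ S) (x : 𝒜 ᵍ⊗[ℚ] ℒ) : x ∈ S := by
  have : S.mkQ = 0 := tensor_hom_ext fun i j a l ha hl => by
    simpa using h i j a l ha hl
  have h2 := LinearMap.congr_fun this x
  simpa using h2

variable {𝒜 ℒ} in
theorem tensor_mem_of_tmul {S : Submodule ℚ (𝒜 ᵍ⊗[ℚ] ℒ)}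
    (h : ∀ a l, (a ᵍ⊗ₜ[ℚ] l) ∈ S) (x : 𝒜 ᵍ⊗[ℚ] ℒ) : x ∈ S :=
  tensor_mem (fun _ _ a l _ _ => h a l) x

theorem tmul_eq_mul (a : A) (l : L) :
    (a ᵍ⊗ₜ[ℚ] l : 𝒜 ᵍ⊗[ℚ] ℒ) = a ᵍ⊗ₜ[ℚ] (1 : L) * (1 : A) ᵍ⊗ₜ[ℚ] l :=
  (GradedTensorProduct.tmul_one_mul_one_tmul 𝒜 ℒ a l).symm

variable {𝒜 ℒ} in
theorem tmul_mul_tmul {i j : ℕ} {a' : A} {l : L} (hl : l ∈ ℒ j) (ha' : a' ∈ 𝒜 i) (a : A)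
    (l' : L) : (a ᵍ⊗ₜ[ℚ] l * a' ᵍ⊗ₜ[ℚ] l' : 𝒜 ᵍ⊗[ℚ] ℒ) =
      (-1 : ℚ) ^ (j * i) • ((a * a') ᵍ⊗ₜ[ℚ] (l * l')) := by
  have h := GradedTensorProduct.tmul_coe_mul_coe_tmul 𝒜 ℒ a ⟨l, hl⟩ ⟨a', ha'⟩ l'
  dsimp only at h
  rw [h, Units.smul_def, ← Int.cast_smul_eq_zsmul ℚ]
  simp

theorem add_tmul (a a' : A) (l : L) :
    ((a + a') ᵍ⊗ₜ[ℚ] l : 𝒜 ᵍ⊗[ℚ] ℒ) = a ᵍ⊗ₜ[ℚ] l + a' ᵍ⊗ₜ[ℚ] l :=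
  LinearMap.map_add₂ (tmk 𝒜 ℒ) a a' l

theorem tmul_smul (c : ℚ) (a : A) (l : L) :
    (a ᵍ⊗ₜ[ℚ] (c • l) : 𝒜 ᵍ⊗[ℚ] ℒ) = c • a ᵍ⊗ₜ[ℚ] l :=
  map_smul (tmk 𝒜 ℒ a) c l

theorem smul_tmul (c : ℚ) (a : A) (l : L) :
    ((c • a) ᵍ⊗ₜ[ℚ] l : 𝒜 ᵍ⊗[ℚ] ℒ) = c • a ᵍ⊗ₜ[ℚ] l :=
  LinearMap.map_smul₂ (tmk 𝒜 ℒ) c a l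

theorem tmul_zero (a : A) : (a ᵍ⊗ₜ[ℚ] (0 : L) : 𝒜 ᵍ⊗[ℚ] ℒ) = 0 := map_zero (tmk 𝒜 ℒ a)

theorem zero_tmul (l : L) : ((0 : A) ᵍ⊗ₜ[ℚ] l : 𝒜 ᵍ⊗[ℚ] ℒ) = 0 :=
  LinearMap.map_zero₂ (tmk 𝒜 ℒ) l

variable {𝒜 ℒ}

theorem IsGradedCommutative.of_span {R : Type*} [Ring R] [Algebra ℚ R]
    {ℛ : ℕ → Submodule ℚ R} (S : ℕ → Set R) (hS : ∀ n, ℛ n = Submodule.span ℚ (S n))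
    (h : ∀ i j, ∀ x ∈ S i, ∀ y ∈ S j, x * y = (-1 : ℚ) ^ (i * j) • (y * x)) :
    IsGradedCommutative ℛ := by
  intro i j x y hx hy
  rw [hS] at hx hy
  induction hx using Submodule.span_induction with
  | mem x hx =>
    induction hy using Submodule.span_induction with
    | mem y hy => exact h i j x hx y hy
    | zero => simp
    | add y y' _ _ h1 h2 => rw [mul_add, add_mul, smul_add, h1, h2]
    | smul c y _ h1 => rw [mul_smul_comm, smul_mul_assoc, h1, smul_comm]
  | zero => simp
  | add x x' _ _ h1 h2 => rw [mul_add, add_mul, smul_add, h1, h2]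
  | smul c x _ h1 => rw [mul_smul_comm, smul_mul_assoc, h1, smul_comm]

theorem IsGradedCommutative.tensor (hA : IsGradedCommutative 𝒜) (hL : IsGradedCommutative ℒ) :
    IsGradedCommutative (tensorGr 𝒜 ℒ) := by
  refine IsGradedCommutative.of_span _ (fun n => rfl) ?_
  rintro _ _ _ ⟨i, j, a, l, rfl, ha, hl, rfl⟩ _ ⟨i', j', a', l', rfl, ha', hl', rfl⟩
  rw [tmul_mul_tmul hl ha', tmul_mul_tmul hl' ha, hA _ _ _ _ ha ha', hL _ _ _ _ hl hl',
    smul_tmul, tmul_smul, smul_smul, smul_smul, smul_smul]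
  congr 1
  rw [← pow_add, ← pow_add, ← pow_add]
  have : (i + j) * (i' + j') + j' * i = (j * i' + (i * i' + j * j')) + 2 * (j' * i) := by ring
  rw [this, pow_add _ _ (2 * _), pow_mul]
  simp [add_assoc]

/-- The algebra map `a ⊗ l ↦ f a * g l`, for algebra maps `f` and `g` whose values commute in the
graded sense. -/
def mulExtHom {R : Type*} [Ring R] [Algebra ℚ R] (f : A →ₐ[ℚ] R) (g : L →ₐ[ℚ] R)
    (h : ∀ i j a l, a ∈ 𝒜 i → l ∈ ℒ j → f a * g l = (-1 : ℚ) ^ (i * j) • (g l * f a)) :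
    (𝒜 ᵍ⊗[ℚ] ℒ) →ₐ[ℚ] R :=
  GradedTensorProduct.lift 𝒜 ℒ f g fun i j a l => by
    rw [h i j a l a.2 l.2, Units.smul_def, ← Int.cast_smul_eq_zsmul ℚ, mul_comm i j]
    simp

theorem mulExtHom_tmul {R : Type*} [Ring R] [Algebra ℚ R] (f : A →ₐ[ℚ] R) (g : L →ₐ[ℚ] R)
    (h : ∀ i j a l, a ∈ 𝒜 i → l ∈ ℒ j → f a * g l = (-1 : ℚ) ^ (i * j) • (g l * f a))
    (a : A) (l : L) : mulExtHom f g h (a ᵍ⊗ₜ[ℚ] l) = f a * g l := rfl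

/-- A linear map out of a graded tensor product preserves degrees up to a shift if it does so
on homogeneous tensors. -/
theorem map_mem_of_tmul {M : Type*} [AddCommGroup M] [Module ℚ M] (ℳ : ℕ → Submodule ℚ M)
    (k : ℕ) (f : (𝒜 ᵍ⊗[ℚ] ℒ) →ₗ[ℚ] M)
    (h : ∀ i j a l, a ∈ 𝒜 i → l ∈ ℒ j → f (a ᵍ⊗ₜ[ℚ] l) ∈ ℳ (i + j + k)) (n : ℕ)
    (x : 𝒜 ᵍ⊗[ℚ] ℒ) (hx : x ∈ tensorGr 𝒜 ℒ n) : f x ∈ ℳ (n + k) := by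
  have : tensorGr 𝒜 ℒ n ≤ (ℳ (n + k)).comap f := by
    refine Submodule.span_le.2 ?_
    rintro _ ⟨i, j, a, l, rfl, ha, hl, rfl⟩
    exact h i j a l ha hl
  exact this hx

theorem inl_mem_tensorGr {i : ℕ} {a : A} (ha : a ∈ 𝒜 i) :
    (a ᵍ⊗ₜ[ℚ] (1 : L)) ∈ tensorGr 𝒜 ℒ i :=
  tmul_mem_tensorGr (j := 0) ha SetLike.GradedOne.one_mem

theorem inr_mem_tensorGr {j : ℕ} {l : L} (hl : l ∈ ℒ j) :
    ((1 : A) ᵍ⊗ₜ[ℚ] l) ∈ tensorGr 𝒜 ℒ j := by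
  simpa using tmul_mem_tensorGr (𝒜 := 𝒜) (i := 0) SetLike.GradedOne.one_mem hl

variable (𝒜 ℒ)

/-- The derivation `d_A ⊗ 1 + 1 ⊗ δ` of `A ⊗ L`, where `δ` is a derivation along the
inclusion of `L`. -/
def tensorDiff (dA : A →ₗ[ℚ] A) (δ : L →ₗ[ℚ] (𝒜 ᵍ⊗[ℚ] ℒ)) :
    (𝒜 ᵍ⊗[ℚ] ℒ) →ₗ[ℚ] (𝒜 ᵍ⊗[ℚ] ℒ) :=
  mapLeft 𝒜 𝒜 ℒ dA +
    mulExt 𝒜 ℒ ((GradedTensorProduct.includeLeft 𝒜 ℒ).toLinearMap ∘ₗ signInv 𝒜) δ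

variable {𝒜 ℒ}

theorem tensorDiff_tmul {i : ℕ} {a : A} (ha : a ∈ 𝒜 i) (l : L) (dA : A →ₗ[ℚ] A)
    (δ : L →ₗ[ℚ] (𝒜 ᵍ⊗[ℚ] ℒ)) :
    tensorDiff 𝒜 ℒ dA δ (a ᵍ⊗ₜ[ℚ] l) =
      dA a ᵍ⊗ₜ[ℚ] (1 : L) * (1 : A) ᵍ⊗ₜ[ℚ] l + (-1 : ℚ) ^ i • (a ᵍ⊗ₜ[ℚ] (1 : L) * δ l) := by
  rw [tensorDiff, LinearMap.add_apply, mapLeft_tmul, mulExt_tmul, LinearMap.comp_apply,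
    signInv_of_mem 𝒜 ha, map_smul, smul_mul_assoc, tmul_eq_mul]
  rfl

/-- `δ` takes values in all of `A ⊗ L`, because the differential of a generator may involve the
other factor. The Leibniz rule is checked on homogeneous pure tensors after graded commutativity has
moved every factor coming from `A` to the left. -/
theorem isOddDerivation_tensorDiff (hA : IsGradedCommutative 𝒜) (hL : IsGradedCommutative ℒ)
    {dA : A →ₗ[ℚ] A} (hd : IsOddDerivation 𝒜 dA) {δ : L →ₗ[ℚ] (𝒜 ᵍ⊗[ℚ] ℒ)}
    (hδ : ∀ j l, l ∈ ℒ j → δ l ∈ tensorGr 𝒜 ℒ (j + 1))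
    (hδ' : ∀ j l l', l ∈ ℒ j → δ (l * l') =
      δ l * (1 : A) ᵍ⊗ₜ[ℚ] l' + (-1 : ℚ) ^ j • ((1 : A) ᵍ⊗ₜ[ℚ] l * δ l')) :
    IsOddDerivation (tensorGr 𝒜 ℒ) (tensorDiff 𝒜 ℒ dA δ) := by
  have hT := hA.tensor hL
  refine ⟨fun n x hx => map_mem_of_tmul (tensorGr 𝒜 ℒ) 1 _ ?_ n x hx, ?_⟩
  · intro i j a l ha hl
    rw [tensorDiff_tmul ha]
    refine Submodule.add_mem _ ?_ (Submodule.smul_mem _ _ ?_)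
    · have := SetLike.GradedMul.mul_mem (inl_mem_tensorGr (ℒ := ℒ) (hd.map_mem _ _ ha))
        (inr_mem_tensorGr (𝒜 := 𝒜) hl)
      rwa [add_right_comm] at this
    · have := SetLike.GradedMul.mul_mem (inl_mem_tensorGr (ℒ := ℒ) ha) (hδ _ _ hl)
      rwa [← add_assoc] at this
  · intro n x y hx
    induction hx using Submodule.span_induction with
    | mem x hx =>
      obtain ⟨i, j, a, l, rfl, ha, hl, rfl⟩ := hx
      have key : tensorDiff 𝒜 ℒ dA δ ∘ₗ LinearMap.mulLeft ℚ (a ᵍ⊗ₜ[ℚ] l) =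
          LinearMap.mulLeft ℚ (tensorDiff 𝒜 ℒ dA δ (a ᵍ⊗ₜ[ℚ] l)) +
          (-1 : ℚ) ^ (i + j) • (LinearMap.mulLeft ℚ (a ᵍ⊗ₜ[ℚ] l) ∘ₗ tensorDiff 𝒜 ℒ dA δ) := by
        refine tensor_hom_ext fun i' j' a' l' ha' hl' => ?_
        simp only [LinearMap.comp_apply, LinearMap.mulLeft_apply, LinearMap.add_apply,
          LinearMap.smul_apply]
        rw [tmul_mul_tmul hl ha', map_smul,
          tensorDiff_tmul (SetLike.GradedMul.mul_mem ha ha'), tensorDiff_tmul ha,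
          tensorDiff_tmul ha', hδ' _ _ _ hl, hd.leibniz _ _ _ ha, tmul_eq_mul _ _ a l,
          tmul_eq_mul _ _ a' l']
        have e1 : ∀ x y : A, ((x * y) ᵍ⊗ₜ[ℚ] (1 : L) : 𝒜 ᵍ⊗[ℚ] ℒ) =
            x ᵍ⊗ₜ[ℚ] (1 : L) * y ᵍ⊗ₜ[ℚ] (1 : L) :=
          fun x y => map_mul (GradedTensorProduct.includeLeft 𝒜 ℒ) x y
        have e2 : ((1 : A) ᵍ⊗ₜ[ℚ] (l * l') : 𝒜 ᵍ⊗[ℚ] ℒ) =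
            (1 : A) ᵍ⊗ₜ[ℚ] l * (1 : A) ᵍ⊗ₜ[ℚ] l' :=
          map_mul (GradedTensorProduct.includeRight 𝒜 ℒ) l l'
        have c1 := hT _ _ _ _ (inr_mem_tensorGr (𝒜 := 𝒜) hl) (inl_mem_tensorGr (ℒ := ℒ) ha')
        have c2 := hT _ _ _ _ (hδ _ _ hl) (inl_mem_tensorGr (ℒ := ℒ) ha')
        have c3 := hT _ _ _ _ (inr_mem_tensorGr (𝒜 := 𝒜) hl)
          (inl_mem_tensorGr (ℒ := ℒ) (hd.map_mem _ _ ha'))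
        rw [add_tmul, smul_tmul, e1, e1, e1, e2]
        generalize (a ᵍ⊗ₜ[ℚ] (1 : L) : 𝒜 ᵍ⊗[ℚ] ℒ) = X at *
        generalize (a' ᵍ⊗ₜ[ℚ] (1 : L) : 𝒜 ᵍ⊗[ℚ] ℒ) = X' at *
        generalize (dA a ᵍ⊗ₜ[ℚ] (1 : L) : 𝒜 ᵍ⊗[ℚ] ℒ) = DX at *
        generalize (dA a' ᵍ⊗ₜ[ℚ] (1 : L) : 𝒜 ᵍ⊗[ℚ] ℒ) = DX' at *
        generalize ((1 : A) ᵍ⊗ₜ[ℚ] l : 𝒜 ᵍ⊗[ℚ] ℒ) = Y at *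
        generalize ((1 : A) ᵍ⊗ₜ[ℚ] l' : 𝒜 ᵍ⊗[ℚ] ℒ) = Y' at *
        generalize δ l = DY at *
        generalize δ l' = DY' at *
        have c1' : ∀ Z, Y * (X' * Z) = (-1 : ℚ) ^ (j * i') • (X' * (Y * Z)) := fun Z => by
          rw [← mul_assoc, c1, smul_mul_assoc, mul_assoc]
        have c2' : ∀ Z, DY * (X' * Z) = (-1 : ℚ) ^ ((j + 1) * i') • (X' * (DY * Z)) := fun Z => by
          rw [← mul_assoc, c2, smul_mul_assoc, mul_assoc]
        have c3' : ∀ Z, Y * (DX' * Z) = (-1 : ℚ) ^ (j * (i' + 1)) • (DX' * (Y * Z)) := fun Z => by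
          rw [← mul_assoc, c3, smul_mul_assoc, mul_assoc]
        simp only [mul_add, add_mul, smul_add, mul_smul_comm, smul_mul_assoc, smul_smul, mul_assoc,
          c1', c2', c3']
        -- Moving `dA a'` past `l` contributes `(-1) ^ j` twice in one term; this square is the only
        -- sign identity that is not formal.
        have hq := neg_one_pow_mul_self j
        simp only [one_mul, mul_one, pow_add]
        generalize (-1 : ℚ) ^ i = p at *
        generalize (-1 : ℚ) ^ j = q at *
        generalize (-1 : ℚ) ^ i' = r at *
        generalize (-1 : ℚ) ^ (j * i') = s at *
        match_scalars <;> first | ring1 | linear_combination (-s * p) * hq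
      exact LinearMap.congr_fun key y
    | zero => simp
    | add x x' _ _ h1 h2 => rw [add_mul, map_add, h1, h2, map_add, add_mul, add_mul, smul_add]; abel
    | smul c x _ h1 =>
      rw [smul_mul_assoc, map_smul, h1, map_smul, smul_mul_assoc, smul_mul_assoc, smul_add,
        smul_comm]

end Tensor

/-! ## The free graded commutative algebra -/

section Free

variable {W : Type v} [AddCommGroup W] [Module ℚ W] (𝓦 : ℕ → Submodule ℚ W)

namespace FreeGCA

theorem ι_mul_list {i : ℕ} {x : W} (hx : x ∈ 𝓦 i) (l : List (Σ i, 𝓦 i)) :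
    ι 𝓦 x * (l.map fun p => ι 𝓦 (p.2 : W)).prod =
      (-1 : ℚ) ^ (i * (l.map Sigma.fst).sum) • ((l.map fun p => ι 𝓦 (p.2 : W)).prod * ι 𝓦 x) := by
  induction l with
  | nil => simp
  | cons p l ih =>
    simp only [List.map_cons, List.prod_cons, List.sum_cons]
    rw [← mul_assoc, ι_mul_ι 𝓦 hx p.2.2, smul_mul_assoc, mul_assoc, ih, mul_smul_comm, smul_smul,
      ← pow_add, mul_add, mul_assoc]

theorem gr_comm : IsGradedCommutative (gr 𝓦) := by
  refine IsGradedCommutative.of_span _ (fun n => rfl) ?_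
  rintro _ _ _ ⟨l, rfl, rfl⟩ _ ⟨l', rfl, rfl⟩
  induction l with
  | nil => simp
  | cons p l ih =>
    simp only [List.map_cons, List.prod_cons, List.sum_cons]
    rw [mul_assoc, ih, mul_smul_comm, ← mul_assoc, ι_mul_list 𝓦 p.2.2, smul_mul_assoc, smul_smul,
      mul_assoc, ← pow_add, ← add_mul, add_comm]

theorem aug_ι (x : W) : aug 𝓦 (ι 𝓦 x) = 0 := by
  rw [aug, lift_ι]; rfl

theorem aug_of_mem {j : ℕ} (hj : j ≠ 0) {l : FreeGCA 𝓦} (hl : l ∈ gr 𝓦 j) : aug 𝓦 l = 0 := by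
  have : gr 𝓦 j ≤ LinearMap.ker (aug 𝓦).toLinearMap := by
    refine Submodule.span_le.2 ?_
    rintro _ ⟨l, rfl, rfl⟩
    cases l with
    | nil => simp at hj
    | cons p l => simp [aug_ι]
  exact this hl

/-- With no generators in degree zero, only the empty word has degree zero. This is the source of
connectedness below. -/
theorem eq_aug_smul_one (h0 : 𝓦 0 = ⊥) {l : FreeGCA 𝓦} (hl : l ∈ gr 𝓦 0) :
    l = aug 𝓦 l • (1 : FreeGCA 𝓦) := by
  induction hl using Submodule.span_induction with
  | mem x h =>
    obtain ⟨l, h, rfl⟩ := h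
    cases l with
    | nil => simp
    | cons p l =>
      obtain ⟨i, x, hx⟩ := p
      obtain rfl : i = 0 := by simp at h; exact h.1
      obtain rfl : x = 0 := by rw [h0] at hx; simpa using hx
      simp
  | zero => simp
  | add x y _ _ hx hy => rw [map_add, add_smul, ← hx, ← hy]
  | smul c x _ hx => rw [map_smul, smul_assoc, ← hx]

variable [DirectSum.Decomposition 𝓦]

theorem mem_of_ι_mul {S : Submodule ℚ (FreeGCA 𝓦)} (h1 : 1 ∈ S)
    (h : ∀ i x, x ∈ 𝓦 i → ∀ l ∈ S, ι 𝓦 x * l ∈ S) (l : FreeGCA 𝓦) : l ∈ S := by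
  refine mem_of_decompose (gr 𝓦) S l fun n => ?_
  have : gr 𝓦 n ≤ S := by
    refine Submodule.span_le.2 ?_
    rintro _ ⟨l, -, rfl⟩
    induction l with
    | nil => simpa using h1
    | cons p l ih => simpa using h _ _ p.2.2 _ ih
  exact this (DirectSum.decompose (gr 𝓦) l n).2

variable {𝓦} in
theorem lift_mem {E : Type w} [Ring E] [Algebra ℚ E] {𝓔 : ℕ → Submodule ℚ E} [GradedAlgebra 𝓔]
    (f : FreeGCA 𝓦 →ₐ[ℚ] E) (hf : ∀ n x, x ∈ 𝓦 n → f (ι 𝓦 x) ∈ 𝓔 n) (n : ℕ) (l : FreeGCA 𝓦)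
    (hl : l ∈ gr 𝓦 n) : f l ∈ 𝓔 n := by
  have : gr 𝓦 n ≤ (𝓔 n).comap f.toLinearMap := by
    refine Submodule.span_le.2 ?_
    rintro _ ⟨l, rfl, rfl⟩
    clear hl
    induction l with
    | nil => simpa using SetLike.GradedOne.one_mem
    | cons p l ih => simpa using SetLike.GradedMul.mul_mem (hf _ _ p.2.2) ih
  exact this hl

/-- The algebra map `ΛW → E` extending a linear map of degree zero into a graded commutative
algebra. -/
def liftGr {E : Type w} [Ring E] [Algebra ℚ E] {𝓔 : ℕ → Submodule ℚ E}
    (hE : IsGradedCommutative 𝓔) (g : W →ₗ[ℚ] E) (hg : ∀ n x, x ∈ 𝓦 n → g x ∈ 𝓔 n) :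
    FreeGCA 𝓦 →ₐ[ℚ] E :=
  lift 𝓦 g fun i j _ _ hx hy => hE i j _ _ (hg _ _ hx) (hg _ _ hy)

@[simp]
theorem liftGr_ι {E : Type w} [Ring E] [Algebra ℚ E] {𝓔 : ℕ → Submodule ℚ E}
    (hE : IsGradedCommutative 𝓔) (g : W →ₗ[ℚ] E) (hg : ∀ n x, x ∈ 𝓦 n → g x ∈ 𝓔 n) (x : W) :
    liftGr 𝓦 hE g hg (ι 𝓦 x) = g x :=
  lift_ι 𝓦 _ _ x

end FreeGCA

end Free

/-! ## Maps out of `E ⊗ ΛW` -/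

section Contract

variable {A : Type u} [Ring A] [Algebra ℚ A] {𝒜 : ℕ → Submodule ℚ A} [GradedAlgebra 𝒜]
variable {L : Type v} [Ring L] [Algebra ℚ L] {ℒ : ℕ → Submodule ℚ L} [GradedAlgebra ℒ]
variable {R : Type w} [Ring R] [Algebra ℚ R]

/-- The algebra map `a ⊗ l ↦ ε(l) f a`, for an augmentation `ε` of degree zero. -/
def contractHom (ε : L →ₐ[ℚ] ℚ) (hε : ∀ j, j ≠ 0 → ∀ l ∈ ℒ j, ε l = 0) (f : A →ₐ[ℚ] R) :
    (𝒜 ᵍ⊗[ℚ] ℒ) →ₐ[ℚ] R :=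
  mulExtHom f ((Algebra.ofId ℚ R).comp ε) fun i j a l _ hl => by
    rcases eq_or_ne j 0 with rfl | hj
    · simp [Algebra.ofId_apply, Algebra.commutes]
    · simp [hε j hj l hl]

theorem contractHom_tmul (ε : L →ₐ[ℚ] ℚ) (hε : ∀ j, j ≠ 0 → ∀ l ∈ ℒ j, ε l = 0)
    (f : A →ₐ[ℚ] R) (a : A) (l : L) :
    contractHom (𝒜 := 𝒜) ε hε f (a ᵍ⊗ₜ[ℚ] l) = ε l • f a := by
  rw [contractHom, mulExtHom_tmul, Algebra.smul_def, Algebra.commutes]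
  rfl

theorem contractHom_toLinearMap (ε : L →ₐ[ℚ] ℚ) (hε : ∀ j, j ≠ 0 → ∀ l ∈ ℒ j, ε l = 0)
    (f : A →ₐ[ℚ] R) :
    (contractHom (𝒜 := 𝒜) ε hε f).toLinearMap = contract 𝒜 ℒ ε.toLinearMap f.toLinearMap :=
  tensor_hom_ext fun _ _ a l _ _ => contractHom_tmul (𝒜 := 𝒜) ε hε f a l

/-- The algebra map `a ⊗ l ↦ f a * g l`, for algebra maps `f` and `g` of degree zero with values
in a graded commutative algebra. -/
def grExtHom {ℛ : ℕ → Submodule ℚ R} (hR : IsGradedCommutative ℛ)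
    (f : A →ₐ[ℚ] R) (g : L →ₐ[ℚ] R) (hf : ∀ n x, x ∈ 𝒜 n → f x ∈ ℛ n)
    (hg : ∀ n x, x ∈ ℒ n → g x ∈ ℛ n) : (𝒜 ᵍ⊗[ℚ] ℒ) →ₐ[ℚ] R :=
  mulExtHom f g fun i j _ _ ha hl => hR i j _ _ (hf _ _ ha) (hg _ _ hl)

theorem grExtHom_tmul {ℛ : ℕ → Submodule ℚ R} (hR : IsGradedCommutative ℛ)
    (f : A →ₐ[ℚ] R) (g : L →ₐ[ℚ] R) (hf : ∀ n x, x ∈ 𝒜 n → f x ∈ ℛ n)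
    (hg : ∀ n x, x ∈ ℒ n → g x ∈ ℛ n) (a : A) (l : L) :
    grExtHom hR f g hf hg (a ᵍ⊗ₜ[ℚ] l) = f a * g l := rfl

theorem grExtHom_mem {ℛ : ℕ → Submodule ℚ R} [GradedAlgebra ℛ] (hR : IsGradedCommutative ℛ)
    (f : A →ₐ[ℚ] R) (g : L →ₐ[ℚ] R) (hf : ∀ n x, x ∈ 𝒜 n → f x ∈ ℛ n)
    (hg : ∀ n x, x ∈ ℒ n → g x ∈ ℛ n) (n : ℕ) (x : 𝒜 ᵍ⊗[ℚ] ℒ) (hx : x ∈ tensorGr 𝒜 ℒ n) :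
    grExtHom hR f g hf hg x ∈ ℛ n :=
  map_mem_of_tmul ℛ 0 (grExtHom hR f g hf hg).toLinearMap
    (fun i j a l ha hl => by
      have := SetLike.GradedMul.mul_mem (hf i a ha) (hg j l hl)
      exact this) n x hx

end Contract

section FreeExtHom

variable {A : Type u} [Ring A] [Algebra ℚ A] {𝒜 : ℕ → Submodule ℚ A} [GradedAlgebra 𝒜]
variable {W : Type v} [AddCommGroup W] [Module ℚ W] {𝓦 : ℕ → Submodule ℚ W}
  [DirectSum.Decomposition 𝓦]
variable {R : Type w} [Ring R] [Algebra ℚ R]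

theorem inl_apply (a : A) : inl 𝒜 𝓦 a = a ᵍ⊗ₜ[ℚ] (1 : FreeGCA 𝓦) := rfl

theorem inr_apply (l : FreeGCA 𝓦) : inr 𝒜 𝓦 l = (1 : A) ᵍ⊗ₜ[ℚ] l := rfl

theorem inl_mul_inr (a : A) (l : FreeGCA 𝓦) :
    inl 𝒜 𝓦 a * inr 𝒜 𝓦 l = a ᵍ⊗ₜ[ℚ] l := (tmul_eq_mul _ _ a l).symm

theorem inl_mul (a a' : A) : inl 𝒜 𝓦 (a * a') = inl 𝒜 𝓦 a * inl 𝒜 𝓦 a' :=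
  map_mul (GradedTensorProduct.includeLeft 𝒜 (FreeGCA.gr 𝓦)) a a'

theorem inr_mul (l l' : FreeGCA 𝓦) : inr 𝒜 𝓦 (l * l') = inr 𝒜 𝓦 l * inr 𝒜 𝓦 l' :=
  map_mul (GradedTensorProduct.includeRight 𝒜 (FreeGCA.gr 𝓦)) l l'

theorem inr_one : inr 𝒜 𝓦 1 = 1 := rfl

theorem inl_mem {n : ℕ} {a : A} (ha : a ∈ 𝒜 n) : inl 𝒜 𝓦 a ∈ freeExtGr 𝒜 𝓦 n :=
  inl_mem_tensorGr ha

theorem inr_mem {n : ℕ} {l : FreeGCA 𝓦} (hl : l ∈ FreeGCA.gr 𝓦 n) :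
    inr 𝒜 𝓦 l ∈ freeExtGr 𝒜 𝓦 n :=
  inr_mem_tensorGr hl

theorem gen_mem {n : ℕ} {x : W} (hx : x ∈ 𝓦 n) : gen 𝒜 𝓦 x ∈ freeExtGr 𝒜 𝓦 n :=
  inr_mem (FreeGCA.ι_mem_gr 𝓦 hx)

theorem freeExt_algHom_ext {f g : FreeExt 𝒜 𝓦 →ₐ[ℚ] R}
    (h₁ : ∀ a, f (inl 𝒜 𝓦 a) = g (inl 𝒜 𝓦 a)) (h₂ : ∀ x, f (gen 𝒜 𝓦 x) = g (gen 𝒜 𝓦 x)) :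
    f = g := by
  apply GradedTensorProduct.algHom_ext
  · ext a; exact h₁ a
  · exact FreeGCA.algHom_ext 𝓦 h₂

/-- A map of graded algebras out of `A ⊗ ΛW` commutes with derivations if it does so on `A` and on
the generators. -/
theorem freeExt_map_d {ℛ : ℕ → Submodule ℚ R} [GradedAlgebra ℛ]
    {d : FreeExt 𝒜 𝓦 →ₗ[ℚ] FreeExt 𝒜 𝓦} {d' : R →ₗ[ℚ] R}
    (hd : IsOddDerivation (freeExtGr 𝒜 𝓦) d) (hd' : IsOddDerivation ℛ d')
    (f : FreeExt 𝒜 𝓦 →ₐ[ℚ] R) (hf : ∀ n x, x ∈ freeExtGr 𝒜 𝓦 n → f x ∈ ℛ n)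
    (h₁ : ∀ a, f (d (inl 𝒜 𝓦 a)) = d' (f (inl 𝒜 𝓦 a)))
    (h₂ : ∀ n x, x ∈ 𝓦 n → f (d (gen 𝒜 𝓦 x)) = d' (f (gen 𝒜 𝓦 x))) (x : FreeExt 𝒜 𝓦) :
    f (d x) = d' (f x) := by
  have hmul : ∀ n x y, x ∈ freeExtGr 𝒜 𝓦 n → f (d x) = d' (f x) → f (d y) = d' (f y) →
      f (d (x * y)) = d' (f (x * y)) := fun n x y hx h h' => by
    rw [hd.leibniz _ _ _ hx, map_mul, hd'.leibniz _ _ _ (hf _ _ hx), map_add, map_smul, map_mul,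
      map_mul, h, h']
  have hr : ∀ l : FreeGCA 𝓦, f (d (inr 𝒜 𝓦 l)) = d' (f (inr 𝒜 𝓦 l)) := by
    intro l
    have := FreeGCA.mem_of_ι_mul 𝓦 (S := LinearMap.eqLocus
      (f.toLinearMap ∘ₗ d ∘ₗ inr 𝒜 𝓦) (d' ∘ₗ f.toLinearMap ∘ₗ inr 𝒜 𝓦)) (h₁ 1) ?_ l
    · exact this
    · intro i x hx l hl
      change f (d (inr 𝒜 𝓦 _)) = d' (f (inr 𝒜 𝓦 _))
      rw [inr_mul]
      exact hmul i _ _ (gen_mem hx) (h₂ i x hx) hl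
  have key : f.toLinearMap ∘ₗ d = d' ∘ₗ f.toLinearMap := tensor_hom_ext fun i j a l ha hl => by
    change f (d (a ᵍ⊗ₜ[ℚ] l)) = d' (f (a ᵍ⊗ₜ[ℚ] l))
    rw [← inl_mul_inr]
    exact hmul i _ _ (inl_mem ha) (h₁ a) (hr l)
  exact LinearMap.congr_fun key x

variable (𝓦) in
/-- The projection `A ⊗ ΛW → A → R` as an algebra map. -/
def projHom (p : A →ₐ[ℚ] R) : FreeExt 𝒜 𝓦 →ₐ[ℚ] R :=
  contractHom (FreeGCA.aug 𝓦) (fun _ hj _ hl => FreeGCA.aug_of_mem 𝓦 hj hl) p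

theorem projHom_toLinearMap (p : A →ₐ[ℚ] R) :
    (projHom 𝓦 p : FreeExt 𝒜 𝓦 →ₐ[ℚ] R).toLinearMap = projExt 𝒜 𝓦 p.toLinearMap :=
  contractHom_toLinearMap _ _ _

theorem projHom_tmul (p : A →ₐ[ℚ] R) (a : A) (l : FreeGCA 𝓦) :
    projHom 𝓦 p (a ᵍ⊗ₜ[ℚ] l : FreeExt 𝒜 𝓦) = FreeGCA.aug 𝓦 l • p a :=
  contractHom_tmul _ _ _ _ _

theorem projHom_inl (p : A →ₐ[ℚ] R) (a : A) : projHom 𝓦 p (inl 𝒜 𝓦 a) = p a := by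
  rw [inl_apply, projHom_tmul, map_one, one_smul]

theorem projHom_inr (p : A →ₐ[ℚ] R) (l : FreeGCA 𝓦) :
    projHom 𝓦 p (inr 𝒜 𝓦 l) = FreeGCA.aug 𝓦 l • 1 := by
  rw [inr_apply, projHom_tmul, map_one]

theorem projHom_gen (p : A →ₐ[ℚ] R) (x : W) : projHom 𝓦 p (gen 𝒜 𝓦 x) = 0 := by
  rw [gen, LinearMap.comp_apply, projHom_inr, FreeGCA.aug_ι, zero_smul]

end FreeExtHom

/-! ## DG algebras under and over `B` -/

section Over

variable {B : Type u} [Ring B] [Algebra ℚ B]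

/-- The structure of a connected graded commutative DG algebra under and over `(B, d_B)` on a
graded algebra. -/
structure DGOver (𝓑 : ℕ → Submodule ℚ B) (dB : B →ₗ[ℚ] B) {E : Type v} [Ring E] [Algebra ℚ E]
    (𝓔 : ℕ → Submodule ℚ E) [GradedAlgebra 𝓔] where
  /-- The differential. -/
  d : E →ₗ[ℚ] E
  /-- The structure map from `B`. -/
  base : B →ₐ[ℚ] E
  /-- The structure map to `B`. -/
  proj : E →ₐ[ℚ] B
  comm : IsGradedCommutative 𝓔
  -- Square zero is not required here: closedness of the elements that matter is supplied
  -- separately.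
  isOddDerivation : IsOddDerivation 𝓔 d
  base_mem : ∀ n b, b ∈ 𝓑 n → base b ∈ 𝓔 n
  proj_mem : ∀ n x, x ∈ 𝓔 n → proj x ∈ 𝓑 n
  proj_base : ∀ b, proj (base b) = b
  d_base : ∀ b, d (base b) = base (dB b)
  proj_d : ∀ x, proj (d x) = dB (proj x)
  -- Connectedness: the augmentation ideal lives in positive degrees, so its `k`-th power starts in
  -- degree `k`.
  conn : ∀ x ∈ 𝓔 0, proj x = 0 → x = 0

variable {𝓑 : ℕ → Submodule ℚ B} {dB : B →ₗ[ℚ] B}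
variable {E : Type v} [Ring E] [Algebra ℚ E] {𝓔 : ℕ → Submodule ℚ E} [GradedAlgebra 𝓔]
variable {E' : Type w} [Ring E'] [Algebra ℚ E'] {𝓔' : ℕ → Submodule ℚ E'} [GradedAlgebra 𝓔']
variable {E'' : Type*} [Ring E''] [Algebra ℚ E''] {𝓔'' : ℕ → Submodule ℚ E''} [GradedAlgebra 𝓔'']

/-- DG algebra maps under and over `B`. -/
structure DGHom (X : DGOver 𝓑 dB 𝓔) (Y : DGOver 𝓑 dB 𝓔') where
  /-- The underlying algebra map. -/
  hom : E →ₐ[ℚ] E'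
  map_mem : ∀ n x, x ∈ 𝓔 n → hom x ∈ 𝓔' n
  map_d : ∀ x, hom (X.d x) = Y.d (hom x)
  map_base : ∀ b, hom (X.base b) = Y.base b
  proj_map : ∀ x, Y.proj (hom x) = X.proj x

namespace DGHom

variable {X : DGOver 𝓑 dB 𝓔} {Y : DGOver 𝓑 dB 𝓔'} {Z : DGOver 𝓑 dB 𝓔''}

variable (X) in
/-- The identity map. -/
def id : DGHom X X := ⟨AlgHom.id ℚ E, fun _ _ h => h, fun _ => rfl, fun _ => rfl, fun _ => rfl⟩

/-- The composite of two maps. -/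
def comp (g : DGHom Y Z) (f : DGHom X Y) : DGHom X Z where
  hom := g.hom.comp f.hom
  map_mem n x hx := g.map_mem _ _ (f.map_mem _ _ hx)
  map_d x := by simp [f.map_d, g.map_d]
  map_base b := by simp [f.map_base, g.map_base]
  proj_map x := by simp [f.proj_map, g.proj_map]

theorem id_apply (x : E) : (id X).hom x = x := rfl

theorem comp_apply (g : DGHom Y Z) (f : DGHom X Y) (x : E) : (g.comp f).hom x = g.hom (f.hom x) :=
  rfl

theorem isDGMap (f : DGHom X Y) : IsDGMap 𝓔 X.d 𝓔' Y.d f.hom.toLinearMap :=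
  ⟨map_one f.hom, map_mul f.hom, f.map_mem, f.map_d⟩

/-- A DG map in the linear sense, compatible with the structure maps. -/
def ofIsDGMap (f : E →ₗ[ℚ] E') (hf : IsDGMap 𝓔 X.d 𝓔' Y.d f) (hb : ∀ b, f (X.base b) = Y.base b)
    (hp : ∀ x, Y.proj (f x) = X.proj x) : DGHom X Y :=
  ⟨AlgHom.ofLinearMap f hf.map_one hf.map_mul, hf.map_mem, hf.map_d, hb, hp⟩

end DGHom

end Over

/-! ### Free extensions `E ⊗ ΛW` of a DG algebra under and over `B`. -/

section FreeExtObject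

variable {A : Type u} [Ring A] [Algebra ℚ A] {𝒜 : ℕ → Submodule ℚ A} [GradedAlgebra 𝒜]
variable {L : Type v} [Ring L] [Algebra ℚ L] {ℒ : ℕ → Submodule ℚ L} [GradedAlgebra ℒ]

theorem tensorDiff_inl (dA : A →ₗ[ℚ] A) {δ : L →ₗ[ℚ] (𝒜 ᵍ⊗[ℚ] ℒ)} (hδ : δ 1 = 0) (a : A) :
    tensorDiff 𝒜 ℒ dA δ (a ᵍ⊗ₜ[ℚ] (1 : L)) = dA a ᵍ⊗ₜ[ℚ] (1 : L) := by
  rw [tensorDiff, LinearMap.add_apply, mapLeft_tmul, mulExt_tmul, hδ, mul_zero, add_zero]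

theorem tensorDiff_inr {dA : A →ₗ[ℚ] A} (hd : dA 1 = 0) (δ : L →ₗ[ℚ] (𝒜 ᵍ⊗[ℚ] ℒ)) (l : L) :
    tensorDiff 𝒜 ℒ dA δ ((1 : A) ᵍ⊗ₜ[ℚ] l) = δ l := by
  rw [tensorDiff_tmul SetLike.GradedOne.one_mem, hd, zero_tmul, zero_mul, zero_add, pow_zero,
    one_smul]
  exact one_mul _

variable {A' : Type w} [Ring A'] [Algebra ℚ A'] {𝒜' : ℕ → Submodule ℚ A'} [GradedAlgebra 𝒜']
variable {W : Type v} [AddCommGroup W] [Module ℚ W] {𝓦 : ℕ → Submodule ℚ W}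
  [DirectSum.Decomposition 𝓦]

variable (𝓦) in
/-- The algebra map `f ⊗ 1 : A ⊗ ΛW → A' ⊗ ΛW`. -/
def mapLeftHom (hA' : IsGradedCommutative 𝒜') (f : A →ₐ[ℚ] A')
    (hf : ∀ n x, x ∈ 𝒜 n → f x ∈ 𝒜' n) : FreeExt 𝒜 𝓦 →ₐ[ℚ] FreeExt 𝒜' 𝓦 :=
  grExtHom (hA'.tensor (FreeGCA.gr_comm 𝓦))
    ((GradedTensorProduct.includeLeft 𝒜' (FreeGCA.gr 𝓦)).comp f)
    (GradedTensorProduct.includeRight 𝒜' (FreeGCA.gr 𝓦))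
    (fun _ _ hx => inl_mem (hf _ _ hx)) (fun _ _ hx => inr_mem hx)

theorem mapLeftHom_tmul (hA' : IsGradedCommutative 𝒜') (f : A →ₐ[ℚ] A')
    (hf : ∀ n x, x ∈ 𝒜 n → f x ∈ 𝒜' n) (a : A) (l : FreeGCA 𝓦) :
    mapLeftHom 𝓦 hA' f hf (a ᵍ⊗ₜ[ℚ] l : FreeExt 𝒜 𝓦) = f a ᵍ⊗ₜ[ℚ] l :=
  (tmul_eq_mul _ _ _ _).symm

theorem mapLeftHom_apply (hA' : IsGradedCommutative 𝒜') (f : A →ₐ[ℚ] A')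
    (hf : ∀ n x, x ∈ 𝒜 n → f x ∈ 𝒜' n) (x : FreeExt 𝒜 𝓦) :
    mapLeftHom 𝓦 hA' f hf x = mapLeft 𝒜 𝒜' (FreeGCA.gr 𝓦) f.toLinearMap x :=
  LinearMap.congr_fun (f := (mapLeftHom 𝓦 hA' f hf).toLinearMap)
    (g := mapLeft 𝒜 𝒜' (FreeGCA.gr 𝓦) f.toLinearMap)
    (tensor_hom_ext fun _ _ a l _ _ => mapLeftHom_tmul hA' f hf a l) x

theorem mapLeftHom_mem (hA' : IsGradedCommutative 𝒜') (f : A →ₐ[ℚ] A')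
    (hf : ∀ n x, x ∈ 𝒜 n → f x ∈ 𝒜' n) (n : ℕ) (x : FreeExt 𝒜 𝓦) (hx : x ∈ freeExtGr 𝒜 𝓦 n) :
    mapLeftHom 𝓦 hA' f hf x ∈ freeExtGr 𝒜' 𝓦 n :=
  grExtHom_mem _ _ _ _ _ n x hx

theorem isOddDerivation_freeExt (hA : IsGradedCommutative 𝒜) {dA : A →ₗ[ℚ] A}
    (hd : IsOddDerivation 𝒜 dA) {d' : A' →ₗ[ℚ] A'} (hd' : IsOddDerivation 𝒜' d')
    (i : FreeGCA 𝓦 →ₐ[ℚ] A') (hi : ∀ n l, l ∈ FreeGCA.gr 𝓦 n → i l ∈ 𝒜' n)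
    (f : A' →ₐ[ℚ] FreeExt 𝒜 𝓦) (hf : ∀ n x, x ∈ 𝒜' n → f x ∈ freeExtGr 𝒜 𝓦 n)
    (hfi : ∀ l, f (i l) = inr 𝒜 𝓦 l) :
    IsOddDerivation (freeExtGr 𝒜 𝓦)
      (tensorDiff 𝒜 (FreeGCA.gr 𝓦) dA (f.toLinearMap ∘ₗ d' ∘ₗ i.toLinearMap)) := by
  refine isOddDerivation_tensorDiff hA (FreeGCA.gr_comm 𝓦) hd (fun j l hl => ?_)
    (fun j l l' hl => ?_)
  · exact hf _ _ (hd'.map_mem _ _ (hi _ _ hl))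
  · change f (d' (i (l * l'))) = f (d' (i l)) * inr 𝒜 𝓦 l' +
      (-1 : ℚ) ^ j • (inr 𝒜 𝓦 l * f (d' (i l')))
    rw [map_mul, hd'.leibniz _ _ _ (hi _ _ hl), map_add, map_smul, map_mul, map_mul, hfi, hfi]

end FreeExtObject

namespace DGOver

variable {B : Type u} [Ring B] [Algebra ℚ B] {𝓑 : ℕ → Submodule ℚ B} {dB : B →ₗ[ℚ] B}
variable {E : Type v} [Ring E] [Algebra ℚ E] {𝓔 : ℕ → Submodule ℚ E} [GradedAlgebra 𝓔]
variable {W : Type w} [AddCommGroup W] [Module ℚ W] {𝓦 : ℕ → Submodule ℚ W}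
  [DirectSum.Decomposition 𝓦]

/-- `B` as a DG algebra under and over itself. -/
def self [GradedAlgebra 𝓑] (hB : IsGradedCommutative 𝓑) (hd : IsOddDerivation 𝓑 dB) :
    DGOver 𝓑 dB 𝓑 where
  d := dB
  base := AlgHom.id ℚ B
  proj := AlgHom.id ℚ B
  comm := hB
  isOddDerivation := hd
  base_mem _ _ h := h
  proj_mem _ _ h := h
  proj_base _ := rfl
  d_base _ := rfl
  proj_d _ := rfl
  conn _ _ h := h

/-- The DG algebra `E ⊗ ΛW` under and over `B`, for a differential extending that of `E` and
compatible with the projection. -/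
def freeExt (X : DGOver 𝓑 dB 𝓔) [GradedAlgebra 𝓑] (h0 : 𝓦 0 = ⊥)
    (d : FreeExt 𝓔 𝓦 →ₗ[ℚ] FreeExt 𝓔 𝓦)
    (hd : IsOddDerivation (freeExtGr 𝓔 𝓦) d) (hinl : ∀ x, d (inl 𝓔 𝓦 x) = inl 𝓔 𝓦 (X.d x))
    (hproj : ∀ x, projHom 𝓦 X.proj (d x) = dB (projHom 𝓦 X.proj x)) :
    DGOver 𝓑 dB (freeExtGr 𝓔 𝓦) where
  d := d
  base := (GradedTensorProduct.includeLeft 𝓔 (FreeGCA.gr 𝓦)).comp X.base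
  proj := projHom 𝓦 X.proj
  comm := X.comm.tensor (FreeGCA.gr_comm 𝓦)
  isOddDerivation := hd
  base_mem n b hb := inl_mem (X.base_mem n b hb)
  proj_mem n x hx := map_mem_of_tmul 𝓑 0 (projHom 𝓦 X.proj : FreeExt 𝓔 𝓦 →ₐ[ℚ] B).toLinearMap (fun i j a l ha hl => by
    rw [AlgHom.toLinearMap_apply, projHom_tmul]
    rcases eq_or_ne j 0 with rfl | hj
    · exact Submodule.smul_mem _ _ (X.proj_mem _ _ ha)
    · rw [FreeGCA.aug_of_mem 𝓦 hj hl, zero_smul]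
      exact Submodule.zero_mem _) n x hx
  proj_base b := (projHom_inl _ _).trans (X.proj_base b)
  d_base b := (hinl _).trans (congrArg (inl 𝓔 𝓦) (X.d_base b))
  proj_d := hproj
  conn := by
    -- In total degree zero both tensor factors have degree zero, and `ΛW` is `ℚ` there.
    have key : freeExtGr 𝓔 𝓦 0 ≤ (𝓔 0).map (inl 𝓔 𝓦) := by
      refine Submodule.span_le.2 ?_
      rintro _ ⟨i, j, a, l, hij, ha, hl, rfl⟩
      obtain ⟨rfl, rfl⟩ : i = 0 ∧ j = 0 := by omega
      refine ⟨FreeGCA.aug 𝓦 l • a, Submodule.smul_mem _ _ ha, ?_⟩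
      conv_rhs => rw [FreeGCA.eq_aug_smul_one 𝓦 h0 hl, tmul_smul]
      rw [map_smul]; rfl
    intro x hx hp
    obtain ⟨a, ha, rfl⟩ := key hx
    rw [projHom_inl] at hp
    rw [X.conn a ha hp, map_zero]

theorem freeExt_proj_d (X : DGOver 𝓑 dB 𝓔) (d : FreeExt 𝓔 𝓦 →ₗ[ℚ] FreeExt 𝓔 𝓦)
    (hd : IsOddDerivation (freeExtGr 𝓔 𝓦) d) (hinl : ∀ x, d (inl 𝓔 𝓦 x) = inl 𝓔 𝓦 (X.d x))
    (hinr : ∀ l, projHom 𝓦 X.proj (d (inr 𝓔 𝓦 l)) = 0) (x : FreeExt 𝓔 𝓦) :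
    projHom 𝓦 X.proj (d x) = dB (projHom 𝓦 X.proj x) := by
  have key : (projHom 𝓦 X.proj : FreeExt 𝓔 𝓦 →ₐ[ℚ] B).toLinearMap ∘ₗ d =
      dB ∘ₗ (projHom 𝓦 X.proj : FreeExt 𝓔 𝓦 →ₐ[ℚ] B).toLinearMap := by
    refine tensor_hom_ext fun i j a l ha hl => ?_
    change (projHom 𝓦 X.proj : FreeExt 𝓔 𝓦 →ₐ[ℚ] B) (d (a ᵍ⊗ₜ[ℚ] l)) =
      dB ((projHom 𝓦 X.proj : FreeExt 𝓔 𝓦 →ₐ[ℚ] B) (a ᵍ⊗ₜ[ℚ] l))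
    rw [projHom_tmul, ← inl_mul_inr, hd.leibniz _ _ _ (inl_mem ha), map_add, map_smul, map_mul,
      map_mul, hinr, mul_zero, smul_zero, add_zero, hinl, projHom_inl, projHom_inr, X.proj_d,
      mul_smul_comm, mul_one, map_smul]
  exact LinearMap.congr_fun key x

end DGOver

/-! ## The DG algebras `B ⊗ ΛW`, `B ⊗ ΛW ⊗ ΛW`, `B ⊗ ΛW ⊗ ΛW ⊗ ΛW` under and over `B` -/

section Models

variable {B : Type u} [Ring B] [Algebra ℚ B] (𝓑 : ℕ → Submodule ℚ B) [GradedAlgebra 𝓑]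
variable {W : Type v} [AddCommGroup W] [Module ℚ W] (𝓦 : ℕ → Submodule ℚ W)
  [DirectSum.Decomposition 𝓦]

/-- `D` is a derivation of `B ⊗ ΛW` extending `d_B` and compatible with the projection. -/
structure IsModelDiff (dB : B →ₗ[ℚ] B) (D : Model₁ 𝓑 𝓦 →ₗ[ℚ] Model₁ 𝓑 𝓦) : Prop where
  comm : IsGradedCommutative 𝓑
  pos : 𝓦 0 = ⊥
  isOddDerivation_base : IsOddDerivation 𝓑 dB
  isOddDerivation : IsOddDerivation (gr₁ 𝓑 𝓦) D
  d_base : ∀ b, D (base₁ 𝓑 𝓦 b) = base₁ 𝓑 𝓦 (dB b)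
  proj_d : ∀ x, proj₁ 𝓑 𝓦 (D x) = dB (proj₁ 𝓑 𝓦 x)

variable {𝓑 𝓦} {dB : B →ₗ[ℚ] B} {D : Model₁ 𝓑 𝓦 →ₗ[ℚ] Model₁ 𝓑 𝓦}

variable {E : Type w} [Ring E] [Algebra ℚ E] {𝓔 : ℕ → Submodule ℚ E} [GradedAlgebra 𝓔]

theorem proj₁_eq (x : Model₁ 𝓑 𝓦) : proj₁ 𝓑 𝓦 x = projHom 𝓦 (AlgHom.id ℚ B) x :=
  (LinearMap.congr_fun (projHom_toLinearMap (𝒜 := 𝓑) (𝓦 := 𝓦) (AlgHom.id ℚ B)) x).symm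

theorem proj₂_eq (x : Model₂ 𝓑 𝓦) :
    proj₂ 𝓑 𝓦 x = projHom 𝓦 (projHom 𝓦 (AlgHom.id ℚ B) : Model₁ 𝓑 𝓦 →ₐ[ℚ] B) x := by
  have : proj₁ 𝓑 𝓦 = (projHom 𝓦 (AlgHom.id ℚ B) : Model₁ 𝓑 𝓦 →ₐ[ℚ] B).toLinearMap :=
    LinearMap.ext proj₁_eq
  rw [proj₂, this, ← projHom_toLinearMap]; rfl

namespace IsModelDiff

variable (h : IsModelDiff 𝓑 𝓦 dB D)
include h

/-- `(B ⊗ ΛW, D)` under and over `B`. -/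
def m₁ : DGOver 𝓑 dB (gr₁ 𝓑 𝓦) :=
  (DGOver.self h.comm h.isOddDerivation_base).freeExt h.pos D h.isOddDerivation h.d_base
    fun x => by
      have := h.proj_d x
      rwa [proj₁_eq, proj₁_eq] at this

/-- The inclusion of the second factor as an algebra map. -/
def sndHom : Model₁ 𝓑 𝓦 →ₐ[ℚ] Model₂ 𝓑 𝓦 :=
  mapLeftHom 𝓦 h.m₁.comm h.m₁.base h.m₁.base_mem

theorem sndHom_apply (x : Model₁ 𝓑 𝓦) : h.sndHom x = snd₂ 𝓑 𝓦 x :=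
  mapLeftHom_apply _ _ _ x

theorem diff₂_eq : diff₂ 𝓑 𝓦 D = tensorDiff (gr₁ 𝓑 𝓦) (FreeGCA.gr 𝓦) D
    (h.sndHom.toLinearMap ∘ₗ D ∘ₗ
      (GradedTensorProduct.includeRight 𝓑 (FreeGCA.gr 𝓦)).toLinearMap) := by
  have : h.sndHom.toLinearMap = snd₂ 𝓑 𝓦 := LinearMap.ext h.sndHom_apply
  rw [this]; rfl

theorem isOddDerivation_diff₂ : IsOddDerivation (gr₂ 𝓑 𝓦) (diff₂ 𝓑 𝓦 D) := by
  rw [h.diff₂_eq]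
  exact isOddDerivation_freeExt h.m₁.comm h.isOddDerivation h.isOddDerivation _
    (fun _ _ hl => inr_mem hl) _ (mapLeftHom_mem _ _ _) fun l => mapLeftHom_tmul _ _ _ _ _

theorem diff₂_inl (x : Model₁ 𝓑 𝓦) :
    diff₂ 𝓑 𝓦 D (inl (gr₁ 𝓑 𝓦) 𝓦 x) = inl (gr₁ 𝓑 𝓦) 𝓦 (D x) := by
  rw [h.diff₂_eq]
  exact tensorDiff_inl _ (by
    change h.sndHom (D 1) = 0
    rw [h.isOddDerivation.map_one, map_zero]) x

theorem diff₂_inr (l : FreeGCA 𝓦) :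
    diff₂ 𝓑 𝓦 D (inr (gr₁ 𝓑 𝓦) 𝓦 l) = h.sndHom (D (inr 𝓑 𝓦 l)) := by
  rw [h.diff₂_eq]
  exact tensorDiff_inr h.isOddDerivation.map_one _ l

theorem proj_sndHom (x : Model₁ 𝓑 𝓦) : projHom 𝓦 h.m₁.proj (h.sndHom x) = h.m₁.proj x := by
  have : (projHom 𝓦 h.m₁.proj).comp h.sndHom = h.m₁.proj := by
    refine freeExt_algHom_ext (fun b => ?_) (fun x => ?_)
    · change projHom 𝓦 h.m₁.proj (mapLeftHom 𝓦 h.m₁.comm h.m₁.base h.m₁.base_mem (b ᵍ⊗ₜ[ℚ] 1)) = _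
      rw [mapLeftHom_tmul, projHom_tmul, map_one, one_smul]; rfl
    · change projHom 𝓦 h.m₁.proj (mapLeftHom 𝓦 h.m₁.comm h.m₁.base h.m₁.base_mem
        (1 ᵍ⊗ₜ[ℚ] FreeGCA.ι 𝓦 x)) = _
      rw [mapLeftHom_tmul, projHom_tmul, FreeGCA.aug_ι, zero_smul]
      exact (projHom_gen _ x).symm
  exact DFunLike.congr_fun this x

theorem proj_inr (l : FreeGCA 𝓦) : h.m₁.proj (inr 𝓑 𝓦 l) = FreeGCA.aug 𝓦 l • 1 :=
  projHom_inr _ _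

/-- `(B ⊗ ΛW ⊗ ΛW, D)` under and over `B`. -/
def m₂ : DGOver 𝓑 dB (gr₂ 𝓑 𝓦) :=
  h.m₁.freeExt h.pos (diff₂ 𝓑 𝓦 D) h.isOddDerivation_diff₂ h.diff₂_inl <|
    h.m₁.freeExt_proj_d _ h.isOddDerivation_diff₂ h.diff₂_inl
      fun l => by
        rw [h.diff₂_inr, h.proj_sndHom]
        refine (h.m₁.proj_d _).trans ?_
        rw [h.proj_inr, map_smul, h.isOddDerivation_base.map_one, smul_zero]

/-- The inclusion of the first factor. -/
def fst : DGHom h.m₁ h.m₂ where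
  hom := GradedTensorProduct.includeLeft (gr₁ 𝓑 𝓦) (FreeGCA.gr 𝓦)
  map_mem _ _ hx := inl_mem hx
  map_d x := (h.diff₂_inl x).symm
  map_base _ := rfl
  proj_map x := projHom_inl _ x

/-- The inclusion of the second factor. -/
def snd : DGHom h.m₁ h.m₂ where
  hom := h.sndHom
  map_mem := mapLeftHom_mem _ _ _
  map_d := freeExt_map_d h.isOddDerivation h.isOddDerivation_diff₂ _ (mapLeftHom_mem _ _ _)
    (fun b => by
      have e : ∀ b, h.sndHom (inl 𝓑 𝓦 b) = inl (gr₁ 𝓑 𝓦) 𝓦 (h.m₁.base b) :=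
        fun b => mapLeftHom_tmul _ _ _ _ _
      rw [e, h.diff₂_inl]
      change h.sndHom (D (base₁ 𝓑 𝓦 b)) = inl (gr₁ 𝓑 𝓦) 𝓦 (D (base₁ 𝓑 𝓦 b))
      rw [h.d_base]
      exact e _)
    (fun n x _ => by
      have e : h.sndHom (gen 𝓑 𝓦 x) = inr (gr₁ 𝓑 𝓦) 𝓦 (FreeGCA.ι 𝓦 x) :=
        mapLeftHom_tmul _ _ _ _ _
      rw [e, h.diff₂_inr]; rfl)
  map_base b := mapLeftHom_tmul _ _ _ _ _
  proj_map := h.proj_sndHom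

theorem fst_hom (x : Model₁ 𝓑 𝓦) : h.fst.hom x = fst₂ 𝓑 𝓦 x := rfl

theorem snd_hom (x : Model₁ 𝓑 𝓦) : h.snd.hom x = snd₂ 𝓑 𝓦 x := h.sndHom_apply x

theorem snd_inr (l : FreeGCA 𝓦) : h.snd.hom (inr 𝓑 𝓦 l) = inr (gr₁ 𝓑 𝓦) 𝓦 l :=
  mapLeftHom_tmul h.m₁.comm h.m₁.base h.m₁.base_mem _ _

/-- The inclusion of the last two factors as an algebra map. -/
def in₂₃Hom : Model₂ 𝓑 𝓦 →ₐ[ℚ] Model₃ 𝓑 𝓦 :=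
  mapLeftHom 𝓦 h.m₂.comm h.snd.hom h.snd.map_mem

theorem in₂₃Hom_apply (x : Model₂ 𝓑 𝓦) : h.in₂₃Hom x = incl₂₃ 𝓑 𝓦 x := by
  have : h.snd.hom.toLinearMap = snd₂ 𝓑 𝓦 := LinearMap.ext h.sndHom_apply
  rw [in₂₃Hom, mapLeftHom_apply, this]; rfl

theorem diff₃_eq : diff₃ 𝓑 𝓦 D = tensorDiff (gr₂ 𝓑 𝓦) (FreeGCA.gr 𝓦) (diff₂ 𝓑 𝓦 D)
    ((h.in₂₃Hom.comp h.snd.hom).toLinearMap ∘ₗ D ∘ₗ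
      (GradedTensorProduct.includeRight 𝓑 (FreeGCA.gr 𝓦)).toLinearMap) := by
  have : (h.in₂₃Hom.comp h.snd.hom).toLinearMap = incl₂₃ 𝓑 𝓦 ∘ₗ snd₂ 𝓑 𝓦 :=
    LinearMap.ext fun x => by
      rw [AlgHom.toLinearMap_apply, AlgHom.comp_apply, h.in₂₃Hom_apply, h.snd_hom]; rfl
  rw [this]; rfl

theorem in₂₃Hom_inl (x : Model₁ 𝓑 𝓦) :
    h.in₂₃Hom (inl (gr₁ 𝓑 𝓦) 𝓦 x) = inl (gr₂ 𝓑 𝓦) 𝓦 (h.snd.hom x) :=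
  mapLeftHom_tmul _ _ _ _ _

theorem in₂₃Hom_inr (l : FreeGCA 𝓦) :
    h.in₂₃Hom (inr (gr₁ 𝓑 𝓦) 𝓦 l) = inr (gr₂ 𝓑 𝓦) 𝓦 l := by
  refine (mapLeftHom_tmul _ _ _ _ _).trans ?_
  rw [map_one]; rfl

theorem isOddDerivation_diff₃ : IsOddDerivation (gr₃ 𝓑 𝓦) (diff₃ 𝓑 𝓦 D) := by
  rw [h.diff₃_eq]
  have hmem : ∀ n x, x ∈ gr₁ 𝓑 𝓦 n → (h.in₂₃Hom.comp h.snd.hom) x ∈ gr₃ 𝓑 𝓦 n := fun n x hx =>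
    mapLeftHom_mem h.m₂.comm h.snd.hom h.snd.map_mem n _ (h.snd.map_mem _ _ hx)
  refine isOddDerivation_freeExt h.m₂.comm h.isOddDerivation_diff₂ h.isOddDerivation _
    (fun _ _ hl => inr_mem hl) _ hmem fun l => ?_
  exact (congrArg h.in₂₃Hom (h.snd_inr l)).trans (h.in₂₃Hom_inr l)

theorem diff₃_inl (x : Model₂ 𝓑 𝓦) :
    diff₃ 𝓑 𝓦 D (inl (gr₂ 𝓑 𝓦) 𝓦 x) = inl (gr₂ 𝓑 𝓦) 𝓦 (diff₂ 𝓑 𝓦 D x) := by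
  rw [h.diff₃_eq]
  exact tensorDiff_inl _ (by
    change h.in₂₃Hom (h.snd.hom (D 1)) = 0
    rw [h.isOddDerivation.map_one, map_zero, map_zero]) x

theorem diff₃_inr (l : FreeGCA 𝓦) :
    diff₃ 𝓑 𝓦 D (inr (gr₂ 𝓑 𝓦) 𝓦 l) = h.in₂₃Hom (h.snd.hom (D (inr 𝓑 𝓦 l))) := by
  rw [h.diff₃_eq]
  exact tensorDiff_inr h.isOddDerivation_diff₂.map_one _ l

theorem proj_in₂₃Hom (x : Model₂ 𝓑 𝓦) : projHom 𝓦 h.m₂.proj (h.in₂₃Hom x) = h.m₂.proj x := by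
  have : (projHom 𝓦 h.m₂.proj).comp h.in₂₃Hom = h.m₂.proj := by
    refine freeExt_algHom_ext (fun b => ?_) (fun x => ?_)
    · rw [AlgHom.comp_apply, h.in₂₃Hom_inl, projHom_inl, h.snd.proj_map]
      exact (projHom_inl _ _).symm
    · rw [AlgHom.comp_apply, gen, LinearMap.comp_apply, h.in₂₃Hom_inr]
      refine (projHom_inr _ _).trans ?_
      exact (projHom_inr _ _).symm
  exact DFunLike.congr_fun this x

/-- `(B ⊗ ΛW ⊗ ΛW ⊗ ΛW, D)` under and over `B`. -/
def m₃ : DGOver 𝓑 dB (gr₃ 𝓑 𝓦) :=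
  h.m₂.freeExt h.pos (diff₃ 𝓑 𝓦 D) h.isOddDerivation_diff₃ h.diff₃_inl <|
    h.m₂.freeExt_proj_d _ h.isOddDerivation_diff₃ h.diff₃_inl
      fun l => by
        rw [h.diff₃_inr, h.proj_in₂₃Hom, h.snd.proj_map]
        refine (h.m₁.proj_d _).trans ?_
        rw [h.proj_inr, map_smul, h.isOddDerivation_base.map_one, smul_zero]

/-- The inclusion of the first two factors. -/
def in₁₂ : DGHom h.m₂ h.m₃ where
  hom := GradedTensorProduct.includeLeft (gr₂ 𝓑 𝓦) (FreeGCA.gr 𝓦)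
  map_mem _ _ hx := inl_mem hx
  map_d x := (h.diff₃_inl x).symm
  map_base _ := rfl
  proj_map x := projHom_inl _ x

/-- The inclusion of the last two factors. -/
def in₂₃ : DGHom h.m₂ h.m₃ where
  hom := h.in₂₃Hom
  map_mem := mapLeftHom_mem _ _ _
  map_d := freeExt_map_d h.isOddDerivation_diff₂ h.isOddDerivation_diff₃ _ (mapLeftHom_mem _ _ _)
    (fun x => by
      rw [h.diff₂_inl, h.in₂₃Hom_inl, h.in₂₃Hom_inl, h.diff₃_inl]
      exact congrArg (inl (gr₂ 𝓑 𝓦) 𝓦) (h.snd.map_d x))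
    (fun n x _ => by
      rw [gen, LinearMap.comp_apply, h.in₂₃Hom_inr, h.diff₃_inr, h.diff₂_inr]; rfl)
  map_base b := (h.in₂₃Hom_inl _).trans (congrArg (inl (gr₂ 𝓑 𝓦) 𝓦) (h.snd.map_base b))
  proj_map := h.proj_in₂₃Hom

variable {h} {Y : DGOver 𝓑 dB 𝓔}

end IsModelDiff

end Models

/-! ### Maps out of two and three factors over `B`. -/

section Pairings

variable {B : Type u} [Ring B] [Algebra ℚ B] {𝓑 : ℕ → Submodule ℚ B} [GradedAlgebra 𝓑]
variable {W : Type v} [AddCommGroup W] [Module ℚ W] {𝓦 : ℕ → Submodule ℚ W}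
  [DirectSum.Decomposition 𝓦]
variable {dB : B →ₗ[ℚ] B} {D D' : Model₁ 𝓑 𝓦 →ₗ[ℚ] Model₁ 𝓑 𝓦}
variable {E : Type w} [Ring E] [Algebra ℚ E] {𝓔 : ℕ → Submodule ℚ E} [GradedAlgebra 𝓔]
variable {E' : Type*} [Ring E'] [Algebra ℚ E'] {𝓔' : ℕ → Submodule ℚ E'} [GradedAlgebra 𝓔']

namespace IsModelDiff

variable (h : IsModelDiff 𝓑 𝓦 dB D) {Y : DGOver 𝓑 dB 𝓔} {Z : DGOver 𝓑 dB 𝓔'}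

/-- The algebra map `B ⊗ ΛW ⊗ ΛW → E` given by two maps `B ⊗ ΛW → E`. -/
def pairHom (a b : DGHom h.m₁ Y) : Model₂ 𝓑 𝓦 →ₐ[ℚ] E :=
  grExtHom Y.comm a.hom (b.hom.comp (GradedTensorProduct.includeRight 𝓑 (FreeGCA.gr 𝓦)))
    a.map_mem (fun _ _ hl => b.map_mem _ _ (inr_mem hl))

theorem pairHom_tmul (a b : DGHom h.m₁ Y) (x : Model₁ 𝓑 𝓦) (l : FreeGCA 𝓦) :
    h.pairHom a b (x ᵍ⊗ₜ[ℚ] l : Model₂ 𝓑 𝓦) = a.hom x * b.hom (inr 𝓑 𝓦 l) := rfl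

theorem pairHom_mem (a b : DGHom h.m₁ Y) (n : ℕ) (x : Model₂ 𝓑 𝓦) (hx : x ∈ gr₂ 𝓑 𝓦 n) :
    h.pairHom a b x ∈ 𝓔 n :=
  grExtHom_mem _ _ _ _ _ n x hx

theorem pairHom_inl (a b : DGHom h.m₁ Y) (x : Model₁ 𝓑 𝓦) :
    h.pairHom a b (inl (gr₁ 𝓑 𝓦) 𝓦 x) = a.hom x := by
  rw [inl_apply, pairHom_tmul, inr_one, map_one, mul_one]

theorem pairHom_inr (a b : DGHom h.m₁ Y) (l : FreeGCA 𝓦) :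
    h.pairHom a b (inr (gr₁ 𝓑 𝓦) 𝓦 l) = b.hom (inr 𝓑 𝓦 l) := by
  rw [inr_apply, pairHom_tmul, map_one, one_mul]

theorem tmul_eq_base_mul (b : B) (l : FreeGCA 𝓦) :
    (b ᵍ⊗ₜ[ℚ] l : Model₁ 𝓑 𝓦) = h.m₁.base b * inr 𝓑 𝓦 l := (inl_mul_inr b l).symm

theorem pairHom_snd (a b : DGHom h.m₁ Y) (x : Model₁ 𝓑 𝓦) :
    h.pairHom a b (h.snd.hom x) = b.hom x := by
  have : (h.pairHom a b).comp h.snd.hom = b.hom := by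
    refine freeExt_algHom_ext (fun c => ?_) (fun y => ?_)
    · change h.pairHom a b (h.snd.hom (h.m₁.base c)) = b.hom (h.m₁.base c)
      rw [h.snd.map_base, b.map_base]
      exact (h.pairHom_inl a b (h.m₁.base c)).trans (a.map_base c)
    · change h.pairHom a b (h.snd.hom (inr 𝓑 𝓦 _)) = b.hom (inr 𝓑 𝓦 _)
      rw [h.snd_inr, pairHom_inr]
  exact DFunLike.congr_fun this x

/-- The map `B ⊗ ΛW ⊗ ΛW → E` given by two maps `B ⊗ ΛW → E`. -/
def pair (a b : DGHom h.m₁ Y) : DGHom h.m₂ Y where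
  hom := h.pairHom a b
  map_mem := h.pairHom_mem a b
  map_d := freeExt_map_d h.isOddDerivation_diff₂ Y.isOddDerivation _ (h.pairHom_mem a b)
    (fun x => by
      rw [h.diff₂_inl, pairHom_inl, pairHom_inl]
      exact a.map_d x)
    (fun n x _ => by
      change h.pairHom a b (diff₂ 𝓑 𝓦 D (inr _ 𝓦 _)) = Y.d (h.pairHom a b (inr _ 𝓦 _))
      rw [h.diff₂_inr, pairHom_inr]
      exact (h.pairHom_snd a b _).trans (b.map_d _))
  map_base c := (h.pairHom_inl a b _).trans (a.map_base c)
  proj_map x := by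
    have : Y.proj.comp (h.pairHom a b) = h.m₂.proj := by
      refine freeExt_algHom_ext (fun x => ?_) (fun y => ?_)
      · rw [AlgHom.comp_apply, pairHom_inl, a.proj_map]
        exact (projHom_inl _ _).symm
      · change Y.proj (h.pairHom a b (inr _ 𝓦 _)) = h.m₂.proj (inr _ 𝓦 _)
        rw [pairHom_inr, b.proj_map, h.proj_inr]
        exact (projHom_inr _ _).symm
    exact DFunLike.congr_fun this x

theorem pair_fst (a b : DGHom h.m₁ Y) (x : Model₁ 𝓑 𝓦) :
    (h.pair a b).hom (h.fst.hom x) = a.hom x := h.pairHom_inl a b x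

theorem pair_snd (a b : DGHom h.m₁ Y) (x : Model₁ 𝓑 𝓦) :
    (h.pair a b).hom (h.snd.hom x) = b.hom x := h.pairHom_snd a b x

theorem hom_ext₂ {f g : DGHom h.m₂ Y} (h₁ : ∀ x, f.hom (h.fst.hom x) = g.hom (h.fst.hom x))
    (h₂ : ∀ x, f.hom (h.snd.hom x) = g.hom (h.snd.hom x)) (x : Model₂ 𝓑 𝓦) :
    f.hom x = g.hom x := by
  have : f.hom = g.hom := freeExt_algHom_ext h₁ fun y => by
    have := h₂ (inr 𝓑 𝓦 (FreeGCA.ι 𝓦 y))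
    rwa [h.snd_inr] at this
  rw [this]

theorem comp_pair (f : DGHom Y Z) (a b : DGHom h.m₁ Y) (x : Model₂ 𝓑 𝓦) :
    f.hom ((h.pair a b).hom x) = (h.pair (f.comp a) (f.comp b)).hom x :=
  h.hom_ext₂ (f := f.comp (h.pair a b)) (g := h.pair (f.comp a) (f.comp b))
    (fun x => by rw [DGHom.comp_apply, pair_fst, pair_fst, DGHom.comp_apply])
    (fun x => by rw [DGHom.comp_apply, pair_snd, pair_snd, DGHom.comp_apply]) x

theorem in₁₂_snd (x : Model₁ 𝓑 𝓦) : h.in₁₂.hom (h.snd.hom x) = h.in₂₃.hom (h.fst.hom x) :=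
  (h.in₂₃Hom_inl x).symm

/-- The algebra map `B ⊗ ΛW ⊗ ΛW ⊗ ΛW → E` given by three maps `B ⊗ ΛW → E`. -/
def tripleHom (a b c : DGHom h.m₁ Y) : Model₃ 𝓑 𝓦 →ₐ[ℚ] E :=
  grExtHom Y.comm (h.pair a b).hom
    (c.hom.comp (GradedTensorProduct.includeRight 𝓑 (FreeGCA.gr 𝓦)))
    (h.pair a b).map_mem (fun _ _ hl => c.map_mem _ _ (inr_mem hl))

theorem tripleHom_tmul (a b c : DGHom h.m₁ Y) (x : Model₂ 𝓑 𝓦) (l : FreeGCA 𝓦) :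
    h.tripleHom a b c (x ᵍ⊗ₜ[ℚ] l : Model₃ 𝓑 𝓦) = (h.pair a b).hom x * c.hom (inr 𝓑 𝓦 l) := rfl

theorem tripleHom_mem (a b c : DGHom h.m₁ Y) (n : ℕ) (x : Model₃ 𝓑 𝓦) (hx : x ∈ gr₃ 𝓑 𝓦 n) :
    h.tripleHom a b c x ∈ 𝓔 n :=
  grExtHom_mem _ _ _ _ _ n x hx

theorem tripleHom_inl (a b c : DGHom h.m₁ Y) (x : Model₂ 𝓑 𝓦) :
    h.tripleHom a b c (inl (gr₂ 𝓑 𝓦) 𝓦 x) = (h.pair a b).hom x := by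
  rw [inl_apply, tripleHom_tmul, inr_one, map_one, mul_one]

theorem tripleHom_inr (a b c : DGHom h.m₁ Y) (l : FreeGCA 𝓦) :
    h.tripleHom a b c (inr (gr₂ 𝓑 𝓦) 𝓦 l) = c.hom (inr 𝓑 𝓦 l) := by
  rw [inr_apply, tripleHom_tmul, map_one, one_mul]

theorem tripleHom_in₂₃ (a b c : DGHom h.m₁ Y) (x : Model₂ 𝓑 𝓦) :
    h.tripleHom a b c (h.in₂₃.hom x) = (h.pair b c).hom x := by
  have : (h.tripleHom a b c).comp h.in₂₃.hom = (h.pair b c).hom := by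
    refine freeExt_algHom_ext (fun x => ?_) (fun y => ?_)
    · change h.tripleHom a b c (h.in₂₃.hom (h.fst.hom x)) = (h.pair b c).hom (h.fst.hom x)
      rw [← in₁₂_snd, pair_fst]
      exact (h.tripleHom_inl a b c _).trans (h.pair_snd a b x)
    · change h.tripleHom a b c (h.in₂₃Hom (inr _ 𝓦 _)) = h.pairHom b c (inr _ 𝓦 _)
      rw [in₂₃Hom_inr, tripleHom_inr, pairHom_inr]
  exact DFunLike.congr_fun this x

/-- The map `B ⊗ ΛW ⊗ ΛW ⊗ ΛW → E` given by three maps `B ⊗ ΛW → E`. -/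
def triple (a b c : DGHom h.m₁ Y) : DGHom h.m₃ Y where
  hom := h.tripleHom a b c
  map_mem := h.tripleHom_mem a b c
  map_d := freeExt_map_d h.isOddDerivation_diff₃ Y.isOddDerivation _ (h.tripleHom_mem a b c)
    (fun x => by
      rw [h.diff₃_inl, tripleHom_inl, tripleHom_inl]
      exact (h.pair a b).map_d x)
    (fun n x _ => by
      change h.tripleHom a b c (diff₃ 𝓑 𝓦 D (inr _ 𝓦 _)) = Y.d (h.tripleHom a b c (inr _ 𝓦 _))
      rw [h.diff₃_inr, tripleHom_inr]
      exact ((h.tripleHom_in₂₃ a b c _).trans (h.pair_snd b c _)).trans (c.map_d _))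
  map_base d := (h.tripleHom_inl a b c _).trans ((h.pair a b).map_base d)
  proj_map x := by
    have : Y.proj.comp (h.tripleHom a b c) = h.m₃.proj := by
      refine freeExt_algHom_ext (fun x => ?_) (fun y => ?_)
      · rw [AlgHom.comp_apply, tripleHom_inl, (h.pair a b).proj_map]
        exact (projHom_inl _ _).symm
      · change Y.proj (h.tripleHom a b c (inr _ 𝓦 _)) = h.m₃.proj (inr _ 𝓦 _)
        rw [tripleHom_inr, c.proj_map, h.proj_inr]
        exact (projHom_inr _ _).symm
    exact DFunLike.congr_fun this x

theorem triple_in₁₂ (a b c : DGHom h.m₁ Y) (x : Model₂ 𝓑 𝓦) :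
    (h.triple a b c).hom (h.in₁₂.hom x) = (h.pair a b).hom x := h.tripleHom_inl a b c x

theorem triple_in₂₃ (a b c : DGHom h.m₁ Y) (x : Model₂ 𝓑 𝓦) :
    (h.triple a b c).hom (h.in₂₃.hom x) = (h.pair b c).hom x := h.tripleHom_in₂₃ a b c x

/-- `C ⊗_B 1`. -/
def left (C : DGHom h.m₁ h.m₂) : DGHom h.m₂ h.m₃ :=
  h.pair (h.in₁₂.comp C) (h.in₂₃.comp h.snd)

/-- `1 ⊗_B C`. -/
def right (C : DGHom h.m₁ h.m₂) : DGHom h.m₂ h.m₃ :=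
  h.pair (h.in₁₂.comp h.fst) (h.in₂₃.comp C)

/-- If `a · b` denotes `(h.pair a b).comp C`, this and `triple_right` say that evaluating `C ⊗ 1`
and `1 ⊗ C` at `(a, b, c)` gives the evaluations at `(a · b, c)` and `(a, b · c)`. They turn the
associativity equation into the cocycle equation. -/
theorem triple_left (C : DGHom h.m₁ h.m₂) (a b c : DGHom h.m₁ Y) (x : Model₂ 𝓑 𝓦) :
    (h.triple a b c).hom ((h.left C).hom x) = (h.pair ((h.pair a b).comp C) c).hom x := by
  rw [left, comp_pair]
  refine h.hom_ext₂ (fun x => ?_) (fun x => ?_) x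
  · simp only [pair_fst, DGHom.comp_apply, triple_in₁₂]
  · simp only [pair_snd, DGHom.comp_apply, triple_in₂₃]

theorem triple_right (C : DGHom h.m₁ h.m₂) (a b c : DGHom h.m₁ Y) (x : Model₂ 𝓑 𝓦) :
    (h.triple a b c).hom ((h.right C).hom x) = (h.pair a ((h.pair b c).comp C)).hom x := by
  rw [right, comp_pair]
  refine h.hom_ext₂ (fun x => ?_) (fun x => ?_) x
  · simp only [pair_fst, DGHom.comp_apply, triple_in₁₂]
  · simp only [pair_snd, DGHom.comp_apply, triple_in₂₃]

theorem left_fst (C : DGHom h.m₁ h.m₂) (x : Model₁ 𝓑 𝓦) :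
    (h.left C).hom (h.fst.hom x) = h.in₁₂.hom (C.hom x) := h.pair_fst _ _ x

theorem left_snd (C : DGHom h.m₁ h.m₂) (x : Model₁ 𝓑 𝓦) :
    (h.left C).hom (h.snd.hom x) = h.in₂₃.hom (h.snd.hom x) := h.pair_snd _ _ x

theorem right_fst (C : DGHom h.m₁ h.m₂) (x : Model₁ 𝓑 𝓦) :
    (h.right C).hom (h.fst.hom x) = h.in₁₂.hom (h.fst.hom x) := h.pair_fst _ _ x

theorem right_snd (C : DGHom h.m₁ h.m₂) (x : Model₁ 𝓑 𝓦) :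
    (h.right C).hom (h.snd.hom x) = h.in₂₃.hom (C.hom x) := h.pair_snd _ _ x

theorem linearMap_ext₂ {M : Type*} [AddCommGroup M] [Module ℚ M]
    {f g : Model₂ 𝓑 𝓦 →ₗ[ℚ] M} (hfg : ∀ x l, f (x ᵍ⊗ₜ[ℚ] l) = g (x ᵍ⊗ₜ[ℚ] l)) : f = g :=
  tensor_hom_ext fun _ _ x l _ _ => hfg x l

theorem left_apply (C : DGHom h.m₁ h.m₂) (x : Model₂ 𝓑 𝓦) :
    (h.left C).hom x = comulLeft 𝓑 𝓦 C.hom.toLinearMap x := by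
  have : (h.left C).hom.toLinearMap = comulLeft 𝓑 𝓦 C.hom.toLinearMap := by
    refine linearMap_ext₂ fun x l => ?_
    change h.in₁₂.hom (C.hom x) * h.in₂₃Hom (h.snd.hom (inr 𝓑 𝓦 l)) = C.hom x ᵍ⊗ₜ[ℚ] l
    rw [h.snd_inr, in₂₃Hom_inr]
    exact inl_mul_inr _ _
  exact LinearMap.congr_fun this x

theorem right_apply (C : DGHom h.m₁ h.m₂) (x : Model₂ 𝓑 𝓦) :
    (h.right C).hom x = comulRight 𝓑 𝓦 C.hom.toLinearMap x := by
  have : (h.right C).hom.toLinearMap = comulRight 𝓑 𝓦 C.hom.toLinearMap := by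
    refine linearMap_ext₂ fun x l => ?_
    change h.in₁₂.hom (h.fst.hom x) * h.in₂₃Hom (C.hom (inr 𝓑 𝓦 l)) =
      incl₁₂ 𝓑 𝓦 (fst₂ 𝓑 𝓦 x) * incl₂₃ 𝓑 𝓦 (C.hom (inr 𝓑 𝓦 l))
    rw [in₂₃Hom_apply]; rfl
  exact LinearMap.congr_fun this x

theorem pair_comp_apply (h' : IsModelDiff 𝓑 𝓦 dB D') (φ : DGHom h.m₁ h'.m₁) (x : Model₂ 𝓑 𝓦) :
    (h.pair (h'.fst.comp φ) (h'.snd.comp φ)).hom x = tensorSq 𝓑 𝓦 φ.hom.toLinearMap x := by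
  have : (h.pair (h'.fst.comp φ) (h'.snd.comp φ)).hom.toLinearMap =
      tensorSq 𝓑 𝓦 φ.hom.toLinearMap := by
    refine linearMap_ext₂ fun x l => ?_
    change h'.fst.hom (φ.hom x) * h'.snd.hom (φ.hom (inr 𝓑 𝓦 l)) =
      fst₂ 𝓑 𝓦 (φ.hom x) * snd₂ 𝓑 𝓦 (φ.hom (inr 𝓑 𝓦 l))
    rw [snd_hom]; rfl
  exact LinearMap.congr_fun this x

end IsModelDiff

end Pairings

/-! ## The filtration by powers of the augmentation ideal -/

section Filtration

/-- The elements all of whose components have degree at least `k`. -/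
def geDeg {E : Type v} [Ring E] [Algebra ℚ E] (𝓔 : ℕ → Submodule ℚ E) (k : ℕ) : Submodule ℚ E :=
  Submodule.span ℚ {x | ∃ n, k ≤ n ∧ x ∈ 𝓔 n}

variable {B : Type u} [Ring B] [Algebra ℚ B] {𝓑 : ℕ → Submodule ℚ B} {dB : B →ₗ[ℚ] B}
variable {E : Type v} [Ring E] [Algebra ℚ E] {𝓔 : ℕ → Submodule ℚ E} [GradedAlgebra 𝓔]
variable {E' : Type w} [Ring E'] [Algebra ℚ E'] {𝓔' : ℕ → Submodule ℚ E'} [GradedAlgebra 𝓔']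

theorem geDeg_pow_le (k : ℕ) : geDeg 𝓔 1 ^ k ≤ geDeg 𝓔 k := by
  induction k with
  | zero =>
    rw [pow_zero, Submodule.one_eq_span, Submodule.span_le, Set.singleton_subset_iff]
    exact Submodule.subset_span ⟨0, le_rfl, SetLike.GradedOne.one_mem⟩
  | succ k ih =>
    rw [pow_succ]
    refine (mul_le_mul_left ih _).trans ?_
    rw [geDeg, geDeg, Submodule.span_mul_span]
    refine Submodule.span_mono ?_
    rintro _ ⟨x, ⟨m, hm, hx⟩, y, ⟨n, hn, hy⟩, rfl⟩
    exact ⟨m + n, by omega, SetLike.GradedMul.mul_mem hx hy⟩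

theorem decompose_eq_zero_of_geDeg {k : ℕ} {x : E} (hx : x ∈ geDeg 𝓔 k) {n : ℕ} (hn : n < k) :
    (DirectSum.decompose 𝓔 x n : E) = 0 := by
  induction hx using Submodule.span_induction with
  | mem x hx =>
    obtain ⟨m, hm, hx⟩ := hx
    exact DirectSum.decompose_of_mem_ne _ hx (by omega)
  | zero => simp
  | add x y _ _ hx hy => simp [DirectSum.decompose_add, hx, hy]
  | smul c x _ hx =>
    rw [DirectSum.decompose_smul]
    exact (congrArg (c • ·) hx).trans (smul_zero c)

namespace DGOver

variable (X : DGOver 𝓑 dB 𝓔)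

/-- The augmentation ideal, the kernel of the projection to `B`. -/
def ideal : Submodule ℚ E := LinearMap.ker X.proj.toLinearMap

theorem mem_ideal {x : E} : x ∈ X.ideal ↔ X.proj x = 0 := Iff.rfl

theorem sub_base_proj_mem (x : E) : x - X.base (X.proj x) ∈ X.ideal := by
  rw [mem_ideal, map_sub, X.proj_base, sub_self]

variable {X}

/-- The exponent is a successor because powers are taken of `ℚ`-submodules: the zeroth power is `ℚ ·
1`, which is not an ideal. -/
theorem mul_mem_ideal_pow (a : E) {r : ℕ} {x : E} (hx : x ∈ X.ideal ^ (r + 1)) :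
    a * x ∈ X.ideal ^ (r + 1) := by
  rw [pow_succ'] at hx ⊢
  induction hx using Submodule.mul_induction_on' with
  | mem_mul_mem m hm n hn =>
    rw [← mul_assoc]
    refine Submodule.mul_mem_mul ?_ hn
    rw [mem_ideal] at hm ⊢
    rw [map_mul, hm, mul_zero]
  | add x _ y _ hx hy => rw [mul_add]; exact Submodule.add_mem _ hx hy

theorem mem_ideal_pow_mul {r : ℕ} {x : E} (hx : x ∈ X.ideal ^ (r + 1)) (a : E) :
    x * a ∈ X.ideal ^ (r + 1) := by
  rw [pow_succ] at hx ⊢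
  induction hx using Submodule.mul_induction_on' with
  | mem_mul_mem m hm n hn =>
    rw [mul_assoc]
    refine Submodule.mul_mem_mul hm ?_
    rw [mem_ideal] at hn ⊢
    rw [map_mul, hn, zero_mul]
  | add x _ y _ hx hy => rw [add_mul]; exact Submodule.add_mem _ hx hy

theorem mul_mem_pow {r s : ℕ} {x y : E} (hx : x ∈ X.ideal ^ r) (hy : y ∈ X.ideal ^ s) :
    x * y ∈ X.ideal ^ (r + s) := by
  rw [pow_add]; exact Submodule.mul_mem_mul hx hy

theorem ideal_pow_succ_le (r : ℕ) : X.ideal ^ (r + 2) ≤ X.ideal ^ (r + 1) := by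
  intro x hx
  rw [pow_succ' _ (r + 1)] at hx
  induction hx using Submodule.mul_induction_on' with
  | mem_mul_mem m _ n hn => exact mul_mem_ideal_pow m hn
  | add x _ y _ hx hy => exact Submodule.add_mem _ hx hy

theorem ideal_pow_le {r s : ℕ} (h : r + 1 ≤ s) : X.ideal ^ s ≤ X.ideal ^ (r + 1) := by
  obtain ⟨k, rfl⟩ := Nat.exists_eq_add_of_le h
  induction k with
  | zero => exact le_rfl
  | succ k ih =>
    refine le_trans ?_ (ih (by omega))
    have := ideal_pow_succ_le (X := X) (r + k)
    rwa [show r + k + 2 = r + 1 + (k + 1) by omega, show r + k + 1 = r + 1 + k by omega] at this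

theorem ideal_sq_le : X.ideal ^ 2 ≤ X.ideal := by
  simpa using ideal_pow_succ_le (X := X) 0

theorem ideal_le_geDeg [GradedAlgebra 𝓑] : X.ideal ≤ geDeg 𝓔 1 := by
  intro x hx
  refine mem_of_decompose 𝓔 _ x fun n => ?_
  rcases Nat.eq_zero_or_pos n with rfl | hn
  · have h2 : (DirectSum.decompose 𝓔 x 0 : E) = 0 := by
      refine X.conn _ (SetLike.coe_mem _) ?_
      have := decompose_map_zero 𝓔 𝓑 X.proj.toLinearMap X.proj_mem x 0
      rw [AlgHom.toLinearMap_apply, X.mem_ideal.1 hx] at this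
      simpa using this.symm
    rw [h2]; exact Submodule.zero_mem _
  · exact Submodule.subset_span ⟨n, hn, SetLike.coe_mem _⟩

/-- Completeness of the filtration: in a fixed degree, all but finitely many powers of the ideal
vanish. Every successive approximation in the proof ends here. -/
theorem decompose_eq_zero_of_mem_pow [GradedAlgebra 𝓑] {k : ℕ} {x : E} (hx : x ∈ X.ideal ^ k)
    {n : ℕ} (hn : n < k) : (DirectSum.decompose 𝓔 x n : E) = 0 :=
  decompose_eq_zero_of_geDeg (geDeg_pow_le k (pow_le_pow_left' ideal_le_geDeg k hx)) hn

theorem eq_zero_of_mem_pow [GradedAlgebra 𝓑] {n : ℕ} {x : E} (hn : x ∈ 𝓔 n)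
    (hx : x ∈ X.ideal ^ (n + 1)) : x = 0 := by
  rw [← DirectSum.decompose_of_mem_same 𝓔 hn]
  exact decompose_eq_zero_of_mem_pow hx n.lt_succ_self

theorem eq_zero_of_forall_mem_pow [GradedAlgebra 𝓑] {x : E} (hx : ∀ k, 2 ≤ k → x ∈ X.ideal ^ k) :
    x = 0 :=
  eq_zero_of_decompose 𝓔 x fun n => decompose_eq_zero_of_mem_pow (hx (n + 2) (by omega)) (by omega)

/-- The scalar `b` may be inhomogeneous, so moving it across `x` changes signs component by
component and yields a different scalar. -/
theorem exists_mul_base [GradedAlgebra 𝓑] {n : ℕ} {x : E} (hx : x ∈ 𝓔 n) (b : B) :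
    ∃ b', x * X.base b = X.base b' * x := by
  induction b using DirectSum.Decomposition.inductionOn 𝓑 with
  | zero => exact ⟨0, by simp⟩
  | @homogeneous i b =>
    refine ⟨(-1 : ℚ) ^ (n * i) • (b : B), ?_⟩
    rw [X.comm _ _ _ _ hx (X.base_mem _ _ b.2), map_smul, smul_mul_assoc]
  | add b c hb hc =>
    obtain ⟨b', hb⟩ := hb
    obtain ⟨c', hc⟩ := hc
    exact ⟨b' + c', by rw [map_add, map_add, mul_add, add_mul, hb, hc]⟩

variable (X) in
/-- The `B`-submodule spanned by a set. -/
def baseSpan (s : Set E) : Submodule ℚ E :=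
  Submodule.span ℚ {z | ∃ b, ∃ y ∈ s, z = X.base b * y}

theorem base_mul_mem_baseSpan {s : Set E} (b : B) {z : E} (hz : z ∈ X.baseSpan s) :
    X.base b * z ∈ X.baseSpan s := by
  induction hz using Submodule.span_induction with
  | mem x hx =>
    obtain ⟨c, y, hy, rfl⟩ := hx
    exact Submodule.subset_span ⟨b * c, y, hy, by rw [map_mul, mul_assoc]⟩
  | zero => rw [mul_zero]; exact Submodule.zero_mem _
  | add x y _ _ hx hy => rw [mul_add]; exact Submodule.add_mem _ hx hy
  | smul c x _ hx => rw [mul_smul_comm]; exact Submodule.smul_mem _ _ hx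

theorem subset_baseSpan {s : Set E} {y : E} (hy : y ∈ s) : y ∈ X.baseSpan s :=
  Submodule.subset_span ⟨1, y, hy, by rw [map_one, one_mul]⟩

theorem baseSpan_le {s : Set E} {S : Submodule ℚ E} (hs : ∀ y ∈ s, y ∈ S)
    (hS : ∀ b, ∀ z ∈ S, X.base b * z ∈ S) : X.baseSpan s ≤ S := by
  refine Submodule.span_le.2 ?_
  rintro _ ⟨b, y, hy, rfl⟩
  exact hS b y (hs y hy)

theorem baseSpan_mono {s t : Set E} (hst : s ⊆ t) : X.baseSpan s ≤ X.baseSpan t :=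
  baseSpan_le (fun _ hy => subset_baseSpan (hst hy)) fun b _ hz => base_mul_mem_baseSpan b hz

theorem mul_base_mem_baseSpan [GradedAlgebra 𝓑] {s : Set E} (hs : ∀ y ∈ s, ∃ n, y ∈ 𝓔 n) {z : E}
    (hz : z ∈ X.baseSpan s) (b : B) : z * X.base b ∈ X.baseSpan s := by
  induction hz using Submodule.span_induction with
  | mem x hx =>
    obtain ⟨c, y, hy, rfl⟩ := hx
    obtain ⟨n, hn⟩ := hs y hy
    obtain ⟨b', hb⟩ := exists_mul_base (X := X) hn b
    rw [mul_assoc, hb]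
    exact base_mul_mem_baseSpan _ (base_mul_mem_baseSpan _ (subset_baseSpan hy))
  | zero => rw [zero_mul]; exact Submodule.zero_mem _
  | add x y _ _ hx hy => rw [add_mul]; exact Submodule.add_mem _ hx hy
  | smul c x _ hx => rw [smul_mul_assoc]; exact Submodule.smul_mem _ _ hx

/-- An element of the algebra generated by `B` and elements `y ∈ s` of the augmentation ideal is,
modulo `B` and the square of the ideal, a `B`-linear combination of elements of `s`. -/
theorem sub_base_mem_of_mem_adjoin [GradedAlgebra 𝓑] {s : Set E} (hs : ∀ y ∈ s, ∃ n, y ∈ 𝓔 n)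
    (hs' : ∀ y ∈ s, y ∈ X.ideal) {z : E}
    (hz : z ∈ Algebra.adjoin ℚ (Set.range X.base ∪ s)) :
    z - X.base (X.proj z) ∈ X.baseSpan s ⊔ X.ideal ^ 2 := by
  have hI : X.baseSpan s ⊔ X.ideal ^ 2 ≤ X.ideal := by
    refine sup_le (baseSpan_le hs' fun b z hz => ?_) ideal_sq_le
    rw [mem_ideal] at hz ⊢
    rw [map_mul, hz, mul_zero]
  have hl : ∀ b, ∀ z ∈ X.baseSpan s ⊔ X.ideal ^ 2, X.base b * z ∈ X.baseSpan s ⊔ X.ideal ^ 2 := by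
    intro b z hz
    obtain ⟨p, hp, q, hq, rfl⟩ := Submodule.mem_sup.1 hz
    rw [mul_add]
    exact Submodule.add_mem_sup (base_mul_mem_baseSpan _ hp) (mul_mem_ideal_pow _ hq)
  have hr : ∀ b, ∀ z ∈ X.baseSpan s ⊔ X.ideal ^ 2, z * X.base b ∈ X.baseSpan s ⊔ X.ideal ^ 2 := by
    intro b z hz
    obtain ⟨p, hp, q, hq, rfl⟩ := Submodule.mem_sup.1 hz
    rw [add_mul]
    exact Submodule.add_mem_sup (mul_base_mem_baseSpan hs hp _) (mem_ideal_pow_mul hq _)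
  induction hz using Algebra.adjoin_induction with
  | mem x hx =>
    rcases hx with ⟨b, rfl⟩ | hx
    · rw [X.proj_base, sub_self]; exact Submodule.zero_mem _
    · rw [X.mem_ideal.1 (hs' x hx), map_zero, sub_zero]
      exact Submodule.mem_sup_left (subset_baseSpan hx)
  | algebraMap r => simp
  | add x y _ _ hx hy =>
    have := Submodule.add_mem _ hx hy
    rwa [map_add, map_add, add_sub_add_comm]
  | mul x y _ _ hx hy =>
    -- With `x₀`, `y₀` the base parts, `xy - x₀y₀ = x₀(y - y₀) + (x - x₀)y₀ + (x - x₀)(y - y₀)`: two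
    -- linear terms and one in the square.
    have e : x * y - X.base (X.proj (x * y)) = X.base (X.proj x) * (y - X.base (X.proj y)) +
        (x - X.base (X.proj x)) * X.base (X.proj y) +
        (x - X.base (X.proj x)) * (y - X.base (X.proj y)) := by
      rw [map_mul, map_mul]; noncomm_ring
    rw [e]
    refine Submodule.add_mem _ (Submodule.add_mem _ (hl _ _ hy) (hr _ _ hx)) ?_
    refine Submodule.mem_sup_right ?_
    rw [pow_two]
    exact Submodule.mul_mem_mul (hI hx) (hI hy)

theorem ideal_le_of_adjoin [GradedAlgebra 𝓑] {s : Set E} (hs : ∀ y ∈ s, ∃ n, y ∈ 𝓔 n)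
    (hs' : ∀ y ∈ s, y ∈ X.ideal) (htop : Algebra.adjoin ℚ (Set.range X.base ∪ s) = ⊤) :
    X.ideal ≤ X.baseSpan s ⊔ X.ideal ^ 2 := by
  intro z hz
  have := sub_base_mem_of_mem_adjoin (z := z) hs hs' (by rw [htop]; trivial)
  rwa [X.mem_ideal.1 hz, map_zero, sub_zero] at this

end DGOver

namespace DGHom

variable {X : DGOver 𝓑 dB 𝓔} {Y : DGOver 𝓑 dB 𝓔'}

theorem mem_ideal (f : DGHom X Y) {x : E} (hx : x ∈ X.ideal) : f.hom x ∈ Y.ideal := by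
  rw [DGOver.mem_ideal] at hx ⊢
  rw [f.proj_map, hx]

theorem mem_ideal_pow (f : DGHom X Y) {r : ℕ} {x : E} (hx : x ∈ X.ideal ^ r) :
    f.hom x ∈ Y.ideal ^ r := by
  have h1 : f.hom x ∈ (X.ideal ^ r).map f.hom.toLinearMap := ⟨x, hx, rfl⟩
  rw [Submodule.map_pow] at h1
  have h2 : X.ideal.map f.hom.toLinearMap ≤ Y.ideal := by
    rintro _ ⟨y, hy, rfl⟩
    exact f.mem_ideal hy
  have h3 := pow_le_pow_left' h2 r
  exact h3 h1

theorem mul_sub_base_mem (f g : DGHom X Y) (x y : E) :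
    f.hom x * g.hom y - Y.base (Y.proj (f.hom x * g.hom y)) ∈
      X.ideal.map f.hom.toLinearMap ⊔ X.ideal.map g.hom.toLinearMap ⊔ Y.ideal ^ 2 := by
  have e : f.hom x * g.hom y - Y.base (Y.proj (f.hom x * g.hom y)) =
      f.hom ((x - X.base (X.proj x)) * X.base (X.proj y)) +
      g.hom (X.base (X.proj x) * (y - X.base (X.proj y))) +
      f.hom (x - X.base (X.proj x)) * g.hom (y - X.base (X.proj y)) := by
    simp only [map_mul, map_sub, DGHom.map_base, DGHom.proj_map]
    noncomm_ring
  have hx := X.sub_base_proj_mem x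
  have hy := X.sub_base_proj_mem y
  rw [e]
  refine Submodule.add_mem _ (Submodule.mem_sup_left (Submodule.add_mem_sup ⟨_, ?_, rfl⟩
    ⟨_, ?_, rfl⟩)) (Submodule.mem_sup_right ?_)
  · rw [SetLike.mem_coe, DGOver.mem_ideal, map_mul, X.mem_ideal.1 hx, zero_mul]
  · rw [SetLike.mem_coe, DGOver.mem_ideal, map_mul, X.mem_ideal.1 hy, mul_zero]
  · rw [pow_two]
    exact Submodule.mul_mem_mul (f.mem_ideal hx) (g.mem_ideal hy)

/-- `f` induces `c` times the map induced by `g` on the indecomposables. -/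
def Cong (c : ℚ) (f g : DGHom X Y) : Prop :=
  ∀ x ∈ X.ideal, f.hom x - c • g.hom x ∈ Y.ideal ^ 2

/-- On the associated graded algebra `f` and `c • g` agree in filtration one, and `f`, `g` are
multiplicative. Used with `c = 2`, with `c = -1`, and with natural numbers. -/
theorem Cong.pow {c : ℚ} {f g : DGHom X Y} (h : Cong c f g) (r : ℕ) :
    ∀ x ∈ X.ideal ^ r, f.hom x - c ^ r • g.hom x ∈ Y.ideal ^ (r + 1) := by
  induction r with
  | zero =>
    intro x hx
    rw [pow_zero, Submodule.mem_one] at hx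
    obtain ⟨q, rfl⟩ := hx
    simp
  | succ r ih =>
    intro x hx
    rw [pow_succ'] at hx
    induction hx using Submodule.mul_induction_on' with
    | mem_mul_mem a ha y hy =>
      have e : f.hom (a * y) - c ^ (r + 1) • g.hom (a * y) =
          (f.hom a - c • g.hom a) * f.hom y + (c • g.hom a) * (f.hom y - c ^ r • g.hom y) := by
        rw [map_mul, map_mul, sub_mul, mul_sub, smul_mul_smul_comm, pow_succ']; abel
      rw [e]
      refine Submodule.add_mem _ ?_ ?_
      · have := DGOver.mul_mem_pow (h a ha) (f.mem_ideal_pow hy)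
        rwa [show 2 + r = r + 1 + 1 by omega] at this
      · have := DGOver.mul_mem_pow (r := 1)
          (by rw [pow_one]; exact Submodule.smul_mem _ c (g.mem_ideal ha)) (ih y hy)
        rwa [show 1 + (r + 1) = r + 1 + 1 by omega] at this
    | add x _ y _ hx hy =>
      have := Submodule.add_mem _ hx hy
      rwa [map_add, map_add, smul_add, add_sub_add_comm]

end DGHom

end Filtration

/-! ### Indecomposables of `B ⊗ ΛW` and `B ⊗ ΛW ⊗ ΛW`. -/

section Generation

variable {B : Type u} [Ring B] [Algebra ℚ B] {𝓑 : ℕ → Submodule ℚ B} [GradedAlgebra 𝓑]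
variable {W : Type v} [AddCommGroup W] [Module ℚ W] {𝓦 : ℕ → Submodule ℚ W}
  [DirectSum.Decomposition 𝓦]
variable {dB : B →ₗ[ℚ] B} {D : Model₁ 𝓑 𝓦 →ₗ[ℚ] Model₁ 𝓑 𝓦}
variable {E : Type w} [Ring E] [Algebra ℚ E] {𝓔 : ℕ → Submodule ℚ E} [GradedAlgebra 𝓔]

namespace IsModelDiff

variable (h : IsModelDiff 𝓑 𝓦 dB D) {Y : DGOver 𝓑 dB 𝓔}

theorem gen_mem_ideal (x : W) : gen 𝓑 𝓦 x ∈ h.m₁.ideal :=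
  projHom_gen (𝒜 := 𝓑) (AlgHom.id ℚ B) x

theorem adjoin_eq_top {s : Set W} (hs : Submodule.span ℚ s = ⊤) :
    Algebra.adjoin ℚ (Set.range h.m₁.base ∪ gen 𝓑 𝓦 '' s) = ⊤ := by
  set S := Algebra.adjoin ℚ (Set.range h.m₁.base ∪ gen 𝓑 𝓦 '' s) with hS
  have hgen : ∀ x, gen 𝓑 𝓦 x ∈ S := by
    have : (⊤ : Submodule ℚ W) ≤ (Subalgebra.toSubmodule S).comap (gen 𝓑 𝓦) := by
      rw [← hs, Submodule.span_le]
      intro x hx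
      exact Algebra.subset_adjoin (Or.inr ⟨x, hx, rfl⟩)
    exact fun x => this (Submodule.mem_top (x := x))
  have hinr : ∀ l, inr 𝓑 𝓦 l ∈ S :=
    FreeGCA.mem_of_ι_mul 𝓦 (S := (Subalgebra.toSubmodule S).comap (inr 𝓑 𝓦)) (one_mem S)
      fun i x _ l hl => by
        change inr 𝓑 𝓦 _ ∈ S
        rw [inr_mul]
        exact mul_mem (hgen x) hl
  rw [eq_top_iff]
  intro z _
  refine tensor_mem_of_tmul (S := Subalgebra.toSubmodule S) (fun b l => ?_) z
  rw [h.tmul_eq_base_mul]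
  exact S.mul_mem (Algebra.subset_adjoin (Or.inl ⟨b, rfl⟩)) (hinr l)

theorem ideal_le {s : Set W} (hs : Submodule.span ℚ s = ⊤) (hs' : ∀ x ∈ s, ∃ n, x ∈ 𝓦 n) :
    h.m₁.ideal ≤ h.m₁.baseSpan (gen 𝓑 𝓦 '' s) ⊔ h.m₁.ideal ^ 2 := by
  refine DGOver.ideal_le_of_adjoin ?_ ?_ (h.adjoin_eq_top hs)
  · rintro _ ⟨x, hx, rfl⟩
    obtain ⟨n, hn⟩ := hs' x hx
    exact ⟨n, gen_mem hn⟩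
  · rintro _ ⟨x, hx, rfl⟩
    exact h.gen_mem_ideal x

theorem span_homogeneous : Submodule.span ℚ {x : W | ∃ n, x ∈ 𝓦 n} = ⊤ := by
  rw [eq_top_iff]
  intro x _
  exact mem_of_decompose 𝓦 _ x fun n => Submodule.subset_span ⟨n, SetLike.coe_mem _⟩

/-- A `B`-linear map preserving squares of augmentation ideals and sending the generators to the
square of the ideal sends the whole ideal there. -/
theorem map_mem_of_gen (f : Model₁ 𝓑 𝓦 →ₗ[ℚ] E)
    (hf : ∀ b z, f (h.m₁.base b * z) = Y.base b * f z)
    (hsq : ∀ z ∈ h.m₁.ideal ^ 2, f z ∈ Y.ideal ^ 2) (hgen : ∀ x, f (gen 𝓑 𝓦 x) ∈ Y.ideal ^ 2)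
    {z : Model₁ 𝓑 𝓦} (hz : z ∈ h.m₁.ideal) : f z ∈ Y.ideal ^ 2 := by
  have key : h.m₁.ideal ≤ (Y.ideal ^ 2).comap f := by
    refine (h.ideal_le span_homogeneous fun x hx => hx).trans (sup_le ?_ hsq)
    refine DGOver.baseSpan_le ?_ fun b z hz => ?_
    · rintro _ ⟨x, -, rfl⟩
      exact hgen x
    · rw [Submodule.mem_comap, hf]
      exact DGOver.mul_mem_ideal_pow _ hz
  exact key hz

theorem tmul_eq_fst_mul_snd (x : Model₁ 𝓑 𝓦) (l : FreeGCA 𝓦) :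
    (x ᵍ⊗ₜ[ℚ] l : Model₂ 𝓑 𝓦) = h.fst.hom x * h.snd.hom (inr 𝓑 𝓦 l) := by
  rw [h.snd_inr]; exact (inl_mul_inr _ _).symm

/-- The indecomposables of the tensor product over `B` are the sum of those of the factors, so
congruences modulo squares can be tested on each factor. -/
theorem ideal₂_le : h.m₂.ideal ≤
    h.m₁.ideal.map h.fst.hom.toLinearMap ⊔ h.m₁.ideal.map h.snd.hom.toLinearMap ⊔
      h.m₂.ideal ^ 2 := by
  intro z hz
  have key : z - h.m₂.base (h.m₂.proj z) ∈ h.m₁.ideal.map h.fst.hom.toLinearMap ⊔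
      h.m₁.ideal.map h.snd.hom.toLinearMap ⊔ h.m₂.ideal ^ 2 := by
    refine tensor_mem_of_tmul (S := (h.m₁.ideal.map h.fst.hom.toLinearMap ⊔
      h.m₁.ideal.map h.snd.hom.toLinearMap ⊔ h.m₂.ideal ^ 2).comap
        (LinearMap.id - h.m₂.base.toLinearMap ∘ₗ h.m₂.proj.toLinearMap)) (fun x l => ?_) z
    rw [h.tmul_eq_fst_mul_snd]
    exact h.fst.mul_sub_base_mem h.snd x _
  rwa [h.m₂.mem_ideal.1 hz, map_zero, sub_zero] at key

theorem cong_pair {c : ℚ} {a b a' b' : DGHom h.m₁ Y} (ha : DGHom.Cong c a a')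
    (hb : DGHom.Cong c b b') : DGHom.Cong c (h.pair a b) (h.pair a' b') := by
  have key : h.m₂.ideal ≤ (Y.ideal ^ 2).comap
      ((h.pair a b).hom.toLinearMap - c • (h.pair a' b').hom.toLinearMap) := by
    refine h.ideal₂_le.trans (sup_le (sup_le ?_ ?_) ?_)
    · rintro _ ⟨x, hx, rfl⟩
      change (h.pair a b).hom (h.fst.hom x) - c • (h.pair a' b').hom (h.fst.hom x) ∈ Y.ideal ^ 2
      rw [pair_fst, pair_fst]
      exact ha x hx
    · rintro _ ⟨x, hx, rfl⟩
      change (h.pair a b).hom (h.snd.hom x) - c • (h.pair a' b').hom (h.snd.hom x) ∈ Y.ideal ^ 2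
      rw [pair_snd, pair_snd]
      exact hb x hx
    · intro z hz
      exact Submodule.sub_mem _ ((h.pair a b).mem_ideal_pow hz)
        (Submodule.smul_mem _ _ ((h.pair a' b').mem_ideal_pow hz))
  exact fun x hx => key hx

/-- `C` is unital on indecomposables: `C(x) ≡ x + x'`. -/
def IsUnital (C : DGHom h.m₁ h.m₂) : Prop :=
  ∀ x ∈ h.m₁.ideal, C.hom x - (h.fst.hom x + h.snd.hom x) ∈ h.m₂.ideal ^ 2

variable {h} in
theorem isUnital_of_gen {C : DGHom h.m₁ h.m₂}
    (hC : ∀ x, C.hom (gen 𝓑 𝓦 x) - (h.fst.hom (gen 𝓑 𝓦 x) + h.snd.hom (gen 𝓑 𝓦 x)) ∈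
      h.m₂.ideal ^ 2) : h.IsUnital C := by
  intro x hx
  refine h.map_mem_of_gen (Y := h.m₂)
    (C.hom.toLinearMap - (h.fst.hom.toLinearMap + h.snd.hom.toLinearMap)) (fun b z => ?_)
    (fun z hz => ?_) hC hx
  · change C.hom _ - (h.fst.hom _ + h.snd.hom _) = _ * (C.hom z - (h.fst.hom z + h.snd.hom z))
    simp only [map_mul, DGHom.map_base]
    noncomm_ring
  · exact Submodule.sub_mem _ (C.mem_ideal_pow hz)
      (Submodule.add_mem _ (h.fst.mem_ideal_pow hz) (h.snd.mem_ideal_pow hz))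

/-- The composite of `C` with the multiplication of `B ⊗ ΛW`. -/
def sq (C : DGHom h.m₁ h.m₂) : DGHom h.m₁ h.m₁ := (h.pair (DGHom.id _) (DGHom.id _)).comp C

/-- `(h.pair a b).comp C` is the product of `a` and `b` in the sense of `C`; unitality makes it the
sum on indecomposables. -/
theorem pair_comp_unital {C : DGHom h.m₁ h.m₂} (hC : h.IsUnital C) (a b : DGHom h.m₁ Y)
    {x : Model₁ 𝓑 𝓦} (hx : x ∈ h.m₁.ideal) :
    (h.pair a b).hom (C.hom x) - (a.hom x + b.hom x) ∈ Y.ideal ^ 2 := by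
  have := (h.pair a b).mem_ideal_pow (hC x hx)
  rwa [map_sub, map_add, pair_fst, pair_snd] at this

/-- Setting `x' = x` in `C x ≡ x + x'` gives `2 x`: the squaring map of a group doubles the tangent
space at the unit. -/
theorem cong_sq {C : DGHom h.m₁ h.m₂} (hC : h.IsUnital C) :
    DGHom.Cong 2 (h.sq C) (DGHom.id _) := by
  intro x hx
  have := h.pair_comp_unital hC (DGHom.id _) (DGHom.id _) hx
  rwa [← two_smul ℚ] at this

end IsModelDiff

end Generation

/-! ## Eigenvectors of an endomorphism acting as multiplication by `2` on indecomposables -/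

section Eigen

variable {B : Type u} [Ring B] [Algebra ℚ B] {𝓑 : ℕ → Submodule ℚ B} [GradedAlgebra 𝓑]
variable {dB : B →ₗ[ℚ] B}
variable {E : Type w} [Ring E] [Algebra ℚ E] {𝓔 : ℕ → Submodule ℚ E} [GradedAlgebra 𝓔]
variable {X : DGOver 𝓑 dB 𝓔} {P : DGHom X X}

theorem two_pow_sub_ne_zero {r s : ℕ} (h : r ≠ s) : (2 : ℚ) ^ r - 2 ^ s ≠ 0 := fun h' =>
  h (Nat.pow_right_injective le_rfl (by exact_mod_cast sub_eq_zero.1 h'))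

/-- On `I ^ k / I ^ (k + 1)` the map `P` is the scalar `2 ^ k`. For `k ≥ s > r` this differs from `2
^ r`, so `y` moves down the filtration indefinitely and vanishes. -/
theorem DGHom.Cong.eq_zero_of_eigen (hP : DGHom.Cong 2 P (DGHom.id X)) {s r : ℕ} (hr : r < s)
    {y : E} (hy : y ∈ X.ideal ^ s) (hPy : P.hom y = (2 : ℚ) ^ r • y) (hs : 1 ≤ s) : y = 0 := by
  have key : ∀ k, y ∈ X.ideal ^ (s + k) := by
    intro k
    induction k with
    | zero => exact hy
    | succ k ih =>
      have := hP.pow (s + k) y ih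
      rw [hPy, DGHom.id_apply, ← sub_smul] at this
      exact (Submodule.smul_mem_iff _ (two_pow_sub_ne_zero (by omega))).1 this
  obtain ⟨s, rfl⟩ := Nat.exists_eq_add_of_le' hs
  refine DGOver.eq_zero_of_forall_mem_pow (X := X) fun k hk => ?_
  obtain ⟨k, rfl⟩ := Nat.exists_eq_add_of_le' (show 1 ≤ k by omega)
  exact DGOver.ideal_pow_le (by omega) (key k)

/-- Polynomials in `P` remove from `x` the components of eigenvalue 4, 8, 16 and so on; finitely
many suffice in a given degree. Being polynomials in `P`, they preserve the degree. -/
theorem DGHom.Cong.exists_eigen (hP : DGHom.Cong 2 P (DGHom.id X)) {n : ℕ} {x : E}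
    (hx : x ∈ 𝓔 n) (hxI : x ∈ X.ideal) :
    ∃ y ∈ 𝓔 n, y - x ∈ X.ideal ^ 2 ∧ P.hom y = (2 : ℚ) • y := by
  have key : ∀ k, ∃ y ∈ 𝓔 n, y - x ∈ X.ideal ^ 2 ∧ P.hom y - (2 : ℚ) • y ∈ X.ideal ^ (k + 2) := by
    intro k
    induction k with
    | zero => exact ⟨x, hx, by simp, hP x hxI⟩
    | succ k ih =>
      obtain ⟨y, hy, hyx, hPy⟩ := ih
      -- `c • (P - 2 ^ (k + 2))` fixes 2-eigenvectors and kills the error, on which `P` is `2 ^ (k +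
      -- 2)` modulo `I ^ (k + 3)`.
      set c : ℚ := (2 - 2 ^ (k + 2))⁻¹ with hc
      have hc0 : (2 : ℚ) - 2 ^ (k + 2) ≠ 0 := by
        simpa using two_pow_sub_ne_zero (r := 1) (s := k + 2) (by omega)
      have hcc : c * (2 - 2 ^ (k + 2)) = 1 := inv_mul_cancel₀ hc0
      have e : c • (P.hom y - (2 : ℚ) ^ (k + 2) • y) = y + c • (P.hom y - (2 : ℚ) • y) := by
        have h2 : c * 2 = 1 + c * 2 ^ (k + 2) := by linear_combination hcc
        rw [smul_sub, smul_sub, smul_smul, smul_smul, h2, add_smul, one_smul]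
        abel
      refine ⟨c • (P.hom y - (2 : ℚ) ^ (k + 2) • y), ?_, ?_, ?_⟩
      · exact Submodule.smul_mem _ _ (Submodule.sub_mem _ (P.map_mem _ _ hy)
          (Submodule.smul_mem _ _ hy))
      · rw [e, add_sub_right_comm]
        exact Submodule.add_mem _ hyx (Submodule.smul_mem _ _ (DGOver.ideal_pow_le (by omega) hPy))
      · have e2 : P.hom (c • (P.hom y - (2 : ℚ) ^ (k + 2) • y)) -
            (2 : ℚ) • (c • (P.hom y - (2 : ℚ) ^ (k + 2) • y)) =
            c • (P.hom (P.hom y - (2 : ℚ) • y) - (2 : ℚ) ^ (k + 2) • (P.hom y - (2 : ℚ) • y)) := by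
          simp only [map_smul, map_sub]
          module
        rw [e2]
        exact Submodule.smul_mem _ _ (hP.pow (k + 2) _ hPy)
  -- At stage `n` the error lies in `I ^ (n + 2)` and in degree `n`, hence is zero.
  obtain ⟨y, hy, hyx, hPy⟩ := key n
  refine ⟨y, hy, hyx, sub_eq_zero.1 (DGOver.eq_zero_of_mem_pow (X := X) (n := n) ?_ ?_)⟩
  · exact Submodule.sub_mem _ (P.map_mem _ _ hy) (Submodule.smul_mem _ _ hy)
  · exact DGOver.ideal_pow_le (by omega) hPy

end Eigen

/-! ## Two-cocycles -/

section Cocycle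

/-- A symmetric two-cocycle in characteristic zero which is homogeneous of degree at least three
under doubling and vanishes on the diagonal is zero; symmetry is automatic. -/
theorem cocycle_eq_zero {M V : Type*} [AddCommMonoid M] [AddCommGroup V] [Module ℚ V]
    (f : M → M → V) {r : ℕ} (hr : 3 ≤ r)
    (hc : ∀ p q s, f p q + f (p + q) s = f p (q + s) + f q s)
    (h2 : ∀ p q, f (p + p) (q + q) = (2 : ℚ) ^ r • f p q) (h0 : ∀ p, f p p = 0) (p q : M) :
    f p q = 0 := by
  have add_left : ∀ u v w, f (u + v) w - f w (u + v) = (f u w - f w u) + (f v w - f w v) := by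
    intro u v w
    have e1 := hc u v w
    have e2 := hc w u v
    have e3 := hc u w v
    rw [add_comm w u] at e2
    rw [add_comm w v] at e3
    grind
  have hsymm : ∀ u v, f u v = f v u := by
    intro u v
    have e1 := add_left u u (v + v)
    have e2 := add_left v v u
    rw [h2, h2, ← smul_sub] at e1
    -- Doubling both arguments scales the biadditive antisymmetrisation by 4 and, by homogeneity, by
    -- `2 ^ r`; here `r ≥ 3` is needed.
    have e3 : (2 : ℚ) ^ r • (f u v - f v u) = (2 : ℚ) ^ 2 • (f u v - f v u) := by
      rw [e1]
      have : f u (v + v) - f (v + v) u = (2 : ℚ) • (f u v - f v u) := by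
        rw [← neg_sub, e2]; module
      rw [this]; module
    rw [← sub_eq_zero, ← sub_smul] at e3
    exact sub_eq_zero.1 ((smul_eq_zero.1 e3).resolve_left (two_pow_sub_ne_zero (by omega)))
  -- In the abelian extension defined by the symmetric cocycle `f`, vanishing on the diagonal says
  -- that the section `s` satisfies `2 s(p) = s(2p)`. Doubling `s(p) + s(q) = s(p + q) + f p q` then
  -- gives `f (2p) (2q) = 2 f p q`.
  have key : (2 : ℚ) ^ r • f p q = (2 : ℚ) ^ 1 • f p q := by
    have e1 := hc p p (q + q)
    have e2 := hc p q q
    have e3 := hc p (p + q) q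
    have e4 := hc (p + q) p q
    have e5 := hsymm p (p + q)
    have e6 := h0 p
    have e7 := h0 q
    have e8 := h0 (p + q)
    rw [add_assoc p q q, add_comm p (p + q)] at e3
    have e9 : f (p + p) (q + q) = f p q + f p q := by
      grind
    rw [← h2, e9]; module
  rw [← sub_eq_zero, ← sub_smul] at key
  exact (smul_eq_zero.1 key).resolve_left (two_pow_sub_ne_zero (by omega))

end Cocycle

namespace DGOver

variable {B : Type u} [Ring B] [Algebra ℚ B] {𝓑 : ℕ → Submodule ℚ B} {dB : B →ₗ[ℚ] B}
variable {E : Type v} [Ring E] [Algebra ℚ E] {𝓔 : ℕ → Submodule ℚ E} [GradedAlgebra 𝓔]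
variable {E' : Type w} [Ring E'] [Algebra ℚ E'] {𝓔' : ℕ → Submodule ℚ E'} [GradedAlgebra 𝓔']

/-- The coboundaries modulo the `r`-th power of the augmentation ideal. -/
def bdry (X : DGOver 𝓑 dB 𝓔) (r : ℕ) : Submodule ℚ E := LinearMap.range X.d ⊔ X.ideal ^ r

theorem _root_.FibrewiseModels.DGHom.mem_bdry {X : DGOver 𝓑 dB 𝓔} {Y : DGOver 𝓑 dB 𝓔'}
    (f : DGHom X Y) {r : ℕ} {x : E} (hx : x ∈ X.bdry r) : f.hom x ∈ Y.bdry r := by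
  obtain ⟨_, ⟨y, rfl⟩, z, hz, rfl⟩ := Submodule.mem_sup.1 hx
  rw [map_add]
  exact Submodule.add_mem_sup ⟨f.hom y, (f.map_d y).symm⟩ (f.mem_ideal_pow hz)

/-- The trivial map `X → B → Y`. -/
def trivialHom (X : DGOver 𝓑 dB 𝓔) (Y : DGOver 𝓑 dB 𝓔') : DGHom X Y where
  hom := Y.base.comp X.proj
  map_mem n x hx := Y.base_mem _ _ (X.proj_mem _ _ hx)
  map_d x := by
    rw [AlgHom.comp_apply, AlgHom.comp_apply, X.proj_d, Y.d_base]
  map_base b := by rw [AlgHom.comp_apply, X.proj_base]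
  proj_map x := by rw [AlgHom.comp_apply, Y.proj_base]

end DGOver

/-! ### From the associativity equation to a 2-cocycle on `ℕ × ℕ`. -/

section GroupLaw

variable {B : Type u} [Ring B] [Algebra ℚ B] {𝓑 : ℕ → Submodule ℚ B} [GradedAlgebra 𝓑]
variable {W : Type v} [AddCommGroup W] [Module ℚ W] {𝓦 : ℕ → Submodule ℚ W}
  [DirectSum.Decomposition 𝓦]
variable {dB : B →ₗ[ℚ] B} {D : Model₁ 𝓑 𝓦 →ₗ[ℚ] Model₁ 𝓑 𝓦}

namespace IsModelDiff

variable (h : IsModelDiff 𝓑 𝓦 dB D)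

/-- The map `a` is `p₁ w + p₂ w'` on indecomposables. -/
def HasLinearPart (p : ℕ × ℕ) (a : DGHom h.m₁ h.m₂) : Prop :=
  ∀ x ∈ h.m₁.ideal,
    a.hom x - ((p.1 : ℚ) • h.fst.hom x + (p.2 : ℚ) • h.snd.hom x) ∈ h.m₂.ideal ^ 2

variable {h}

/-- The multiplication on maps induced by `C` realises addition of linear parts; it need not be
associative for this. -/
theorem HasLinearPart.add {C : DGHom h.m₁ h.m₂} (hC : h.IsUnital C) {p q : ℕ × ℕ}
    {a b : DGHom h.m₁ h.m₂} (ha : h.HasLinearPart p a) (hb : h.HasLinearPart q b) :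
    h.HasLinearPart (p + q) ((h.pair a b).comp C) := by
  intro x hx
  have := Submodule.add_mem _ (Submodule.add_mem _ (h.pair_comp_unital hC a b hx) (ha x hx))
    (hb x hx)
  convert this using 1
  rw [DGHom.comp_apply, Prod.fst_add, Prod.snd_add]
  push_cast
  module

theorem hasLinearPart_fst : h.HasLinearPart (1, 0) h.fst := fun x _ => by simp

theorem hasLinearPart_snd : h.HasLinearPart (0, 1) h.snd := fun x _ => by simp

/-- Natural multiples are iterated products of the two inclusions, starting from the trivial map.
Restricting to `ℕ` avoids any construction of inverses, and the cocycle lemma only needs a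
commutative monoid. -/
theorem exists_hasLinearPart {C : DGHom h.m₁ h.m₂} (hC : h.IsUnital C) (p : ℕ × ℕ) :
    ∃ a, h.HasLinearPart p a := by
  have h0 : ∃ a, h.HasLinearPart 0 a := ⟨DGOver.trivialHom _ _, fun x hx => by
    have : (h.m₁.trivialHom h.m₂).hom x = 0 := by
      change h.m₂.base (h.m₁.proj x) = 0
      rw [h.m₁.mem_ideal.1 hx, map_zero]
    rw [this]; simp⟩
  have hsum : ∀ {p q}, (∃ a, h.HasLinearPart p a) → (∃ a, h.HasLinearPart q a) →
      ∃ a, h.HasLinearPart (p + q) a := fun ⟨_, ha⟩ ⟨_, hb⟩ => ⟨_, ha.add hC hb⟩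
  have h1 : ∀ m : ℕ, ∃ a, h.HasLinearPart (m, 0) a := by
    intro m
    induction m with
    | zero => exact h0
    | succ m ih => simpa using hsum ih ⟨_, hasLinearPart_fst⟩
  have h2 : ∀ m : ℕ, ∃ a, h.HasLinearPart (0, m) a := by
    intro m
    induction m with
    | zero => exact h0
    | succ m ih => simpa using hsum ih ⟨_, hasLinearPart_snd⟩
  simpa using hsum (h1 p.1) (h2 p.2)

theorem HasLinearPart.cong {c : ℕ} {p : ℕ × ℕ} {a b : DGHom h.m₁ h.m₂}
    (hb : h.HasLinearPart p b) (ha : h.HasLinearPart (c • p) a) : DGHom.Cong c a b := by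
  intro x hx
  have := Submodule.sub_mem _ (ha x hx) (Submodule.smul_mem _ (c : ℚ) (hb x hx))
  convert this using 1
  simp only [Prod.smul_fst, Prod.smul_snd, smul_eq_mul]
  push_cast
  module

variable (h) in
theorem pair_fst_snd (x : Model₂ 𝓑 𝓦) : (h.pair h.fst h.snd).hom x = x :=
  h.hom_ext₂ (f := h.pair h.fst h.snd) (g := DGHom.id _) (fun x => h.pair_fst _ _ x)
    (fun x => h.pair_snd _ _ x) x

/-- The associativity equation in word length `r ≥ 3` modulo coboundaries has only trivial
solutions killed by the multiplication. -/
theorem mem_bdry_of_cocycle {C : DGHom h.m₁ h.m₂} (hC : h.IsUnital C) {r : ℕ} (hr : 3 ≤ r)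
    {ρ : Model₂ 𝓑 𝓦} (hρ : ρ ∈ h.m₂.ideal ^ r)
    (hcoc : h.in₁₂.hom ρ + (h.left C).hom ρ - ((h.right C).hom ρ + h.in₂₃.hom ρ) ∈
      h.m₃.bdry (r + 1))
    (hm : (h.pair (DGHom.id _) (DGHom.id _)).hom ρ ∈ h.m₁.bdry (r + 1)) :
    ρ ∈ h.m₂.bdry (r + 1) := by
  -- One representative `a p` for each linear part `p`; only its class modulo squares will matter.
  choose a ha using fun p => exists_hasLinearPart hC p
  set N := h.m₂.bdry (r + 1)
  -- Since `ρ` lies in `I ^ r`, its value modulo `I ^ (r + 1)` depends only on the linear parts and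
  -- is homogeneous of degree `r` in them.
  have hcong : ∀ {c : ℕ} {b b' : DGHom h.m₁ h.m₂} {p q : ℕ × ℕ}, h.HasLinearPart (c • p) b →
      h.HasLinearPart (c • q) b' → N.mkQ ((h.pair b b').hom ρ) =
        (c : ℚ) ^ r • N.mkQ ((h.pair (a p) (a q)).hom ρ) := by
    intro c b b' p q hb hb'
    rw [← map_smul, ← sub_eq_zero, ← map_sub, Submodule.mkQ_apply, Submodule.Quotient.mk_eq_zero]
    exact Submodule.mem_sup_right (((h.cong_pair ((ha p).cong hb) ((ha q).cong hb')).pow r) ρ hρ)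
  have hcong1 : ∀ {b b' : DGHom h.m₁ h.m₂} {p q : ℕ × ℕ}, h.HasLinearPart p b →
      h.HasLinearPart q b' → N.mkQ ((h.pair b b').hom ρ) =
        N.mkQ ((h.pair (a p) (a q)).hom ρ) := by
    intro b b' p q hb hb'
    have := hcong (c := 1) (p := p) (q := q) (by rwa [one_smul]) (by rwa [one_smul])
    simpa using this
  have key := cocycle_eq_zero (fun p q => N.mkQ ((h.pair (a p) (a q)).hom ρ)) hr
    (fun p q s => by
      have e := (h.triple (a p) (a q) (a s)).mem_bdry hcoc
      rw [map_sub, map_add, map_add, triple_in₁₂, triple_left, triple_right, triple_in₂₃] at e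
      have e' := (Submodule.Quotient.mk_eq_zero N).2 e
      rw [← Submodule.mkQ_apply, map_sub, sub_eq_zero, map_add, map_add,
        hcong1 ((ha p).add hC (ha q)) (ha s), hcong1 (ha p) ((ha q).add hC (ha s))] at e'
      exact e')
    (fun p q => hcong (c := 2) (by rw [two_smul]; exact ha _) (by rw [two_smul]; exact ha _))
    -- Evaluating at `(a p, a p)` factors through the multiplication, where `ρ` is a coboundary by
    -- `hm`.
    (fun p => by
      have e := (a p).mem_bdry hm
      rw [comp_pair] at e
      exact (Submodule.Quotient.mk_eq_zero N).2 e) (1, 0) (0, 1)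
  -- At `(1, 0)` and `(0, 1)` the representatives may be replaced by the two inclusions, whose
  -- pairing is the identity; the value of the cocycle is then the class of `ρ` itself.
  rw [← hcong1 hasLinearPart_fst hasLinearPart_snd, pair_fst_snd, Submodule.mkQ_apply,
    Submodule.Quotient.mk_eq_zero] at key
  exact key

end IsModelDiff

end GroupLaw

/-! ## Coordinates of the linear part -/

section Coordinates

variable {B : Type u} [Ring B] [Algebra ℚ B] {𝓑 : ℕ → Submodule ℚ B} [GradedAlgebra 𝓑]
variable {W : Type v} [AddCommGroup W] [Module ℚ W] {𝓦 : ℕ → Submodule ℚ W}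

variable (𝓦) in
/-- The algebra map `ΛW → ℚ ⊕ ℚε` given by a linear form on `W`. -/
def FreeGCA.toDual (f : W →ₗ[ℚ] ℚ) : FreeGCA 𝓦 →ₐ[ℚ] TrivSqZeroExt ℚ ℚ :=
  FreeGCA.lift 𝓦 (TrivSqZeroExt.inrHom ℚ ℚ ∘ₗ f) fun i j x y _ _ => by
    simp

theorem FreeGCA.fst_toDual (f : W →ₗ[ℚ] ℚ) (l : FreeGCA 𝓦) :
    (FreeGCA.toDual 𝓦 f l).fst = FreeGCA.aug 𝓦 l := by
  have : (TrivSqZeroExt.fstHom ℚ ℚ ℚ).comp (FreeGCA.toDual 𝓦 f) = FreeGCA.aug 𝓦 :=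
    FreeGCA.algHom_ext 𝓦 fun x => by
      rw [AlgHom.comp_apply, FreeGCA.toDual, FreeGCA.lift_ι, FreeGCA.aug_ι]; simp
  exact DFunLike.congr_fun this l

variable [DirectSum.Decomposition 𝓦]

variable (𝓑 𝓦) in
/-- The `B`-linear form on `B ⊗ ΛW` given by a linear form on `W`, extended by zero to the other
word lengths. -/
def linForm (f : W →ₗ[ℚ] ℚ) : Model₁ 𝓑 𝓦 →ₗ[ℚ] B :=
  contract 𝓑 (FreeGCA.gr 𝓦) (TrivSqZeroExt.sndHom ℚ ℚ ∘ₗ (FreeGCA.toDual 𝓦 f).toLinearMap)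
    LinearMap.id

theorem linForm_tmul (f : W →ₗ[ℚ] ℚ) (b : B) (l : FreeGCA 𝓦) :
    linForm 𝓑 𝓦 f (b ᵍ⊗ₜ[ℚ] l) = (FreeGCA.toDual 𝓦 f l).snd • b := rfl

theorem linForm_gen (f : W →ₗ[ℚ] ℚ) (x : W) : linForm 𝓑 𝓦 f (gen 𝓑 𝓦 x) = f x • 1 := by
  change linForm 𝓑 𝓦 f ((1 : B) ᵍ⊗ₜ[ℚ] FreeGCA.ι 𝓦 x) = _
  rw [linForm_tmul, FreeGCA.toDual, FreeGCA.lift_ι]; simp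

variable {dB : B →ₗ[ℚ] B} {D : Model₁ 𝓑 𝓦 →ₗ[ℚ] Model₁ 𝓑 𝓦}

namespace IsModelDiff

variable (h : IsModelDiff 𝓑 𝓦 dB D)

theorem linForm_base_mul (f : W →ₗ[ℚ] ℚ) (b : B) (z : Model₁ 𝓑 𝓦) :
    linForm 𝓑 𝓦 f (h.m₁.base b * z) = b * linForm 𝓑 𝓦 f z := by
  have : linForm 𝓑 𝓦 f ∘ₗ LinearMap.mulLeft ℚ (h.m₁.base b) =
      LinearMap.mulLeft ℚ b ∘ₗ linForm 𝓑 𝓦 f := by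
    refine tensor_hom_ext fun i j c l _ _ => ?_
    change linForm 𝓑 𝓦 f (inl 𝓑 𝓦 b * (c ᵍ⊗ₜ[ℚ] l)) = b * linForm 𝓑 𝓦 f (c ᵍ⊗ₜ[ℚ] l)
    rw [← inl_mul_inr, ← mul_assoc, ← inl_mul, inl_mul_inr, linForm_tmul, inl_mul_inr,
      linForm_tmul, mul_smul_comm]
  exact LinearMap.congr_fun this z

theorem ideal_le_span : h.m₁.ideal ≤ Submodule.span ℚ {z | ∃ (i j : ℕ) (b : B) (l : FreeGCA 𝓦),
    b ∈ 𝓑 i ∧ l ∈ FreeGCA.gr 𝓦 j ∧ FreeGCA.aug 𝓦 l = 0 ∧ z = (b ᵍ⊗ₜ[ℚ] l : Model₁ 𝓑 𝓦)} := by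
  intro z hz
  set S := Submodule.span ℚ {z | ∃ (i j : ℕ) (b : B) (l : FreeGCA 𝓦),
    b ∈ 𝓑 i ∧ l ∈ FreeGCA.gr 𝓦 j ∧ FreeGCA.aug 𝓦 l = 0 ∧ z = (b ᵍ⊗ₜ[ℚ] l : Model₁ 𝓑 𝓦)}
  have key : z - h.m₁.base (h.m₁.proj z) ∈ S := by
    refine tensor_mem (S := S.comap
        (LinearMap.id - h.m₁.base.toLinearMap ∘ₗ h.m₁.proj.toLinearMap))
      (fun i j b l hb hl => ?_) z
    -- Subtracting the projection of `b ⊗ l` replaces `l` by `l - ε(l)`, which stays homogeneous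
    -- because the augmentation `ε` vanishes outside degree zero.
    have e : (b ᵍ⊗ₜ[ℚ] l : Model₁ 𝓑 𝓦) - h.m₁.base (h.m₁.proj (b ᵍ⊗ₜ[ℚ] l)) =
        b ᵍ⊗ₜ[ℚ] (l - FreeGCA.aug 𝓦 l • 1) := by
      have e1 : h.m₁.proj (b ᵍ⊗ₜ[ℚ] l : Model₁ 𝓑 𝓦) = FreeGCA.aug 𝓦 l • b :=
        projHom_tmul (AlgHom.id ℚ B) b l
      rw [e1, map_smul]
      change _ = tmk 𝓑 (FreeGCA.gr 𝓦) b _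
      rw [map_sub, map_smul]
      rfl
    change (b ᵍ⊗ₜ[ℚ] l : Model₁ 𝓑 𝓦) - h.m₁.base (h.m₁.proj (b ᵍ⊗ₜ[ℚ] l)) ∈ S
    rw [e]
    refine Submodule.subset_span ⟨i, j, b, _, hb, ?_, by rw [map_sub, map_smul, map_one]; simp, rfl⟩
    refine Submodule.sub_mem _ hl ?_
    rcases eq_or_ne j 0 with rfl | hj
    · exact Submodule.smul_mem _ _ SetLike.GradedOne.one_mem
    · rw [FreeGCA.aug_of_mem 𝓦 hj hl, zero_smul]; exact Submodule.zero_mem _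
  rwa [h.m₁.mem_ideal.1 hz, map_zero, sub_zero] at key

/-- Two elements of augmentation zero go to multiples of `ε` in the dual numbers, and `ε² = 0`. So
the form reads off the coefficient of one generator modulo decomposables. -/
theorem linForm_sq (f : W →ₗ[ℚ] ℚ) {z : Model₁ 𝓑 𝓦} (hz : z ∈ h.m₁.ideal ^ 2) :
    linForm 𝓑 𝓦 f z = 0 := by
  have key : h.m₁.ideal ^ 2 ≤ LinearMap.ker (linForm 𝓑 𝓦 f) := by
    rw [pow_two]
    refine (mul_le_mul' h.ideal_le_span h.ideal_le_span).trans ?_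
    rw [Submodule.span_mul_span, Submodule.span_le]
    rintro _ ⟨_, ⟨i, j, b, l, hb, hl, hl0, rfl⟩, _, ⟨i', j', b', l', hb', hl', hl0', rfl⟩, rfl⟩
    change linForm 𝓑 𝓦 f (_ * _) = 0
    rw [tmul_mul_tmul hl hb', map_smul, linForm_tmul, map_mul, TrivSqZeroExt.snd_mul,
      FreeGCA.fst_toDual, FreeGCA.fst_toDual, hl0, hl0']
    simp
  exact key hz

end IsModelDiff

end Coordinates

/-! ## Homogeneous combinations and squares of the ideal -/

namespace DGOver

variable {B : Type u} [Ring B] [Algebra ℚ B] {𝓑 : ℕ → Submodule ℚ B} [GradedAlgebra 𝓑]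
variable {dB : B →ₗ[ℚ] B}
variable {E : Type v} [Ring E] [Algebra ℚ E] {𝓔 : ℕ → Submodule ℚ E} [GradedAlgebra 𝓔]
variable {X : DGOver 𝓑 dB 𝓔}

theorem d_mem_ideal {x : E} (hx : x ∈ X.ideal) : X.d x ∈ X.ideal := by
  rw [mem_ideal] at hx ⊢
  rw [X.proj_d, hx, map_zero]

theorem signInv_mem_ideal {x : E} (hx : x ∈ X.ideal) : signInv 𝓔 x ∈ X.ideal := by
  have key : ∀ x, X.proj (signInv 𝓔 x) = signInv 𝓑 (X.proj x) := by
    intro x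
    induction x using DirectSum.Decomposition.inductionOn 𝓔 with
    | zero => simp
    | homogeneous x =>
      rw [signInv_of_mem 𝓔 x.2, signInv_of_mem 𝓑 (X.proj_mem _ _ x.2), map_smul]
    | add x y hx hy => simp only [map_add, hx, hy]
  rw [mem_ideal, key, X.mem_ideal.1 hx, map_zero]

theorem d_mem_ideal_sq {x : E} (hx : x ∈ X.ideal ^ 2) : X.d x ∈ X.ideal ^ 2 := by
  rw [pow_two] at hx ⊢
  induction hx using Submodule.mul_induction_on' with
  | mem_mul_mem m hm n hn =>
    rw [X.isOddDerivation.leibniz_signInv]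
    exact Submodule.add_mem _ (Submodule.mul_mem_mul (d_mem_ideal hm) hn)
      (Submodule.mul_mem_mul (signInv_mem_ideal hm) (d_mem_ideal hn))
  | add x _ y _ hx hy => rw [map_add]; exact Submodule.add_mem _ hx hy

theorem d_base_mul {x : E} (hx : X.d x = 0) (b : B) :
    X.d (X.base b * x) = X.base (dB b) * x := by
  rw [X.isOddDerivation.leibniz_signInv, hx, mul_zero, add_zero, X.d_base]

/-- A homogeneous element of a `B`-span has homogeneous coefficients. The degrees of the
coefficients decide later whether they can be made exact. -/
theorem exists_sum_of_mem_baseSpan {I : Type*} (x : I → E) (n : I → ℕ) {S : Set I}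
    (hx : ∀ j ∈ S, x j ∈ 𝓔 (n j)) {z : E} (hz : z ∈ X.baseSpan (x '' S)) {N : ℕ}
    (hzN : z ∈ 𝓔 N) : ∃ (s : Finset I) (b : I → B), ↑s ⊆ S ∧
      (∀ j, (n j ≤ N ∧ b j ∈ 𝓑 (N - n j)) ∨ b j = 0) ∧ z = ∑ j ∈ s, X.base (b j) * x j := by
  classical
  set F : (I →₀ B) →ₗ[ℚ] E :=
    Finsupp.lsum ℚ fun j => LinearMap.mulRight ℚ (x j) ∘ₗ X.base.toLinearMap
  have h1 : X.baseSpan (x '' S) ≤ (Finsupp.supported B ℚ S).map F := by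
    refine Submodule.span_le.2 ?_
    rintro _ ⟨b, _, ⟨j, hj, rfl⟩, rfl⟩
    exact ⟨Finsupp.single j b, Finsupp.single_mem_supported ℚ b hj, by simp [F]⟩
  obtain ⟨b, hb, rfl⟩ := h1 hz
  -- The case distinction guards against truncated subtraction: for `n j > N` the coefficient must
  -- be zero, not the degree-zero component.
  refine ⟨b.support, fun j => if n j ≤ N then DirectSum.decompose 𝓑 (b j) (N - n j) else 0, hb,
    fun j => ?_, ?_⟩
  · by_cases hj : n j ≤ N
    · exact Or.inl ⟨hj, by dsimp only; rw [if_pos hj]; exact SetLike.coe_mem _⟩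
    · exact Or.inr (if_neg hj)
  · conv_lhs => rw [← DirectSum.decompose_of_mem_same 𝓔 hzN]
    have e : F b = ∑ j ∈ b.support, X.base (b j) * x j := by
      simp [F, Finsupp.sum]
    rw [e, DirectSum.decompose_sum, DFinsupp.finsetSum_apply, AddSubmonoidClass.coe_finsetSum]
    refine Finset.sum_congr rfl fun j hj => ?_
    by_cases hjN : n j ≤ N
    · dsimp only
      rw [if_pos hjN, DirectSum.coe_decompose_mul_of_right_mem_of_le 𝓔 (hx j (hb hj)) hjN]
      congr 1
      exact decompose_map_zero 𝓑 𝓔 X.base.toLinearMap X.base_mem (b j) (N - n j)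
    · dsimp only
      rw [if_neg hjN, DirectSum.coe_decompose_mul_of_right_mem_of_not_le 𝓔 (hx j (hb hj)) hjN,
        map_zero, zero_mul]

theorem eigen_of_mem_baseSpan {P : DGHom X X} {c : ℚ} {s : Set E}
    (hs : ∀ y ∈ s, P.hom y = c • y) {z : E} (hz : z ∈ X.baseSpan s) : P.hom z = c • z := by
  have : X.baseSpan s ≤ LinearMap.ker (P.hom.toLinearMap - c • LinearMap.id) :=
    baseSpan_le (fun y hy => by simp [hs y hy]) fun b z hz => by
      have hz : P.hom z - c • z = 0 := hz
      change P.hom (X.base b * z) - c • (X.base b * z) = 0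
      rw [map_mul, P.map_base, ← mul_smul_comm, ← mul_sub, hz, mul_zero]
  exact sub_eq_zero.1 (this hz)

end DGOver

/-! ## Closed coordinates -/

section ClosedCoordinates

variable {B : Type u} [Ring B] [Algebra ℚ B] {𝓑 : ℕ → Submodule ℚ B} [GradedAlgebra 𝓑]
variable {W : Type v} [AddCommGroup W] [Module ℚ W] {𝓦 : ℕ → Submodule ℚ W}
  [DirectSum.Decomposition 𝓦]
variable {dB : B →ₗ[ℚ] B} {D : Model₁ 𝓑 𝓦 →ₗ[ℚ] Model₁ 𝓑 𝓦}

namespace DGOver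

variable {E : Type w} [Ring E] [Algebra ℚ E] {𝓔 : ℕ → Submodule ℚ E} [GradedAlgebra 𝓔]
variable {X : DGOver 𝓑 dB 𝓔} {I : Type*} [LinearOrder I] [WellFoundedLT I] {τ x : I → E}

/-- A unitriangular change of coordinates over a well-order is invertible, by solving for `τ j`
recursively. -/
theorem mem_baseSpan_of_unitriangular {i : I}
    (hx : ∀ j < i, x j - τ j ∈ X.baseSpan (τ '' Set.Iio j)) :
    ∀ j < i, τ j ∈ X.baseSpan (x '' Set.Iio i) := by
  intro j
  induction j using WellFoundedLT.induction with
  | ind j ih =>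
    intro hj
    have h1 : X.baseSpan (τ '' Set.Iio j) ≤ X.baseSpan (x '' Set.Iio i) := by
      refine baseSpan_le ?_ fun b z hz => base_mul_mem_baseSpan b hz
      rintro _ ⟨k, hk, rfl⟩
      exact ih k hk (lt_trans hk hj)
    have := Submodule.sub_mem _ 
      (subset_baseSpan (X := X) (Set.mem_image_of_mem x (Set.mem_Iio.2 hj))) (h1 (hx j hj))
    rwa [sub_sub_cancel] at this

end DGOver

/-- In a DG algebra without odd cohomology, closed elements of odd degree are coboundaries of
homogeneous elements. -/
theorem HasZeroOddCohomology.exists_homogeneous {d : B →ₗ[ℚ] B} (hH : HasZeroOddCohomology 𝓑 d)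
    (hd : ∀ n b, b ∈ 𝓑 n → d b ∈ 𝓑 (n + 1)) {n : ℕ} (hn : Even n) {b : B} (hb : b ∈ 𝓑 (n + 1))
    (hdb : d b = 0) : ∃ c ∈ 𝓑 n, d c = b := by
  obtain ⟨y, rfl⟩ := hH (n + 1) hn.add_one b hb hdb
  refine ⟨DirectSum.decompose 𝓑 y n, SetLike.coe_mem _, ?_⟩
  rw [← decompose_map 𝓑 𝓑 1 d hd, DirectSum.decompose_of_mem_same 𝓑 hb]

namespace IsModelDiff

variable (h : IsModelDiff 𝓑 𝓦 dB D)
variable {I : Type*} [LinearOrder I] (e : Module.Basis I ℚ W) {τ x : I → Model₁ 𝓑 𝓦}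

theorem linForm_coord (hτ : ∀ i, τ i - gen 𝓑 𝓦 (e i) ∈ h.m₁.ideal ^ 2) (a i : I) :
    linForm 𝓑 𝓦 (e.coord a) (τ i) = if i = a then 1 else 0 := by
  have h1 := h.linForm_sq (e.coord a) (hτ i)
  rw [map_sub, sub_eq_zero] at h1
  rw [h1, linForm_gen, Module.Basis.coord_apply, Module.Basis.repr_self, Finsupp.single_apply]
  split_ifs <;> simp

theorem linForm_coord_triangular (hτ : ∀ i, τ i - gen 𝓑 𝓦 (e i) ∈ h.m₁.ideal ^ 2) {a j : I}
    (hja : j ≤ a) (hx : x j - τ j ∈ h.m₁.baseSpan (τ '' Set.Iio j)) :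
    linForm 𝓑 𝓦 (e.coord a) (x j) = if j = a then 1 else 0 := by
  rw [← h.linForm_coord e hτ a j, ← sub_eq_zero, ← map_sub]
  have : h.m₁.baseSpan (τ '' Set.Iio j) ≤ LinearMap.ker (linForm 𝓑 𝓦 (e.coord a)) := by
    refine DGOver.baseSpan_le ?_ fun b z hz => ?_
    · rintro _ ⟨k, hk, rfl⟩
      rw [LinearMap.mem_ker, h.linForm_coord e hτ, if_neg (hk.trans_le hja).ne]
    · rw [LinearMap.mem_ker] at hz ⊢
      rw [h.linForm_base_mul, hz, mul_zero]
  exact this hx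

/-- The `x j` are linearly independent over `B`, because their linear parts are unitriangular in the
basis `e`. -/
theorem coeff_eq_zero (hτ : ∀ i, τ i - gen 𝓑 𝓦 (e i) ∈ h.m₁.ideal ^ 2) (s : Finset I)
    (hx : ∀ j ∈ s, x j - τ j ∈ h.m₁.baseSpan (τ '' Set.Iio j)) (b : I → B)
    (h0 : ∑ j ∈ s, h.m₁.base (b j) * x j = 0) : ∀ j ∈ s, b j = 0 := by
  -- The coordinate of the largest index `a` vanishes on all smaller `x j` and is 1 on `x a`, so it
  -- isolates `b a`.
  induction s using Finset.induction_on_max with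
  | empty => simp
  | insert a s hs ih =>
    have has : a ∉ s := fun ha => lt_irrefl a (hs a ha)
    have ha : b a = 0 := by
      have := congrArg (linForm 𝓑 𝓦 (e.coord a)) h0
      rw [map_zero, map_sum, Finset.sum_insert has, h.linForm_base_mul,
        h.linForm_coord_triangular e hτ le_rfl (hx a (Finset.mem_insert_self _ _)), if_pos rfl,
        mul_one, Finset.sum_eq_zero, add_zero] at this
      · exact this
      · intro j hj
        rw [h.linForm_base_mul, h.linForm_coord_triangular e hτ (hs j hj).le
          (hx j (Finset.mem_insert_of_mem hj)), if_neg (hs j hj).ne, mul_zero]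
    rw [Finset.sum_insert has, ha, map_zero, zero_mul, zero_add] at h0
    intro j hj
    rcases Finset.mem_insert.1 hj with rfl | hj
    · exact ha
    · exact ih (fun j hj => hx j (Finset.mem_insert_of_mem hj)) h0 j hj

variable {e}

/-- The differential of an eigenvector lifting a generator is a combination of the preceding
eigenvectors. -/
theorem d_mem_baseSpan_of_eigen {P : DGHom h.m₁ h.m₁} (hP : DGHom.Cong 2 P (DGHom.id _))
    {n : I → ℕ} (he : ∀ i, e i ∈ 𝓦 (n i)) {i : I}
    (hks : D (gen 𝓑 𝓦 (e i)) ∈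
      Algebra.adjoin ℚ (Set.range (base₁ 𝓑 𝓦) ∪ (fun j => gen 𝓑 𝓦 (e j)) '' Set.Iio i))
    (hτ : ∀ i, τ i - gen 𝓑 𝓦 (e i) ∈ h.m₁.ideal ^ 2) (hPτ : ∀ i, P.hom (τ i) = (2 : ℚ) • τ i) :
    D (τ i) ∈ h.m₁.baseSpan (τ '' Set.Iio i) := by
  have h1 : D (gen 𝓑 𝓦 (e i)) ∈
      h.m₁.baseSpan ((fun j => gen 𝓑 𝓦 (e j)) '' Set.Iio i) ⊔ h.m₁.ideal ^ 2 := by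
    have := DGOver.sub_base_mem_of_mem_adjoin (X := h.m₁) ?_ ?_ hks
    · have e0 : h.m₁.proj (D (gen 𝓑 𝓦 (e i))) = 0 := by
        refine (h.m₁.proj_d _).trans ?_
        rw [h.m₁.mem_ideal.1 (h.gen_mem_ideal _), map_zero]
      rwa [e0, map_zero, sub_zero] at this
    · rintro _ ⟨j, -, rfl⟩
      exact ⟨_, gen_mem (he j)⟩
    · rintro _ ⟨j, -, rfl⟩
      exact h.gen_mem_ideal _
  have h2 : h.m₁.baseSpan ((fun j => gen 𝓑 𝓦 (e j)) '' Set.Iio i) ⊔ h.m₁.ideal ^ 2 ≤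
      h.m₁.baseSpan (τ '' Set.Iio i) ⊔ h.m₁.ideal ^ 2 := by
    refine sup_le (DGOver.baseSpan_le ?_ fun b z hz => ?_) le_sup_right
    · rintro _ ⟨j, hj, rfl⟩
      have := Submodule.sub_mem _ (Submodule.mem_sup_left (T := h.m₁.ideal ^ 2)
        (DGOver.subset_baseSpan (X := h.m₁) (Set.mem_image_of_mem τ hj)))
        (Submodule.mem_sup_right (hτ j))
      rwa [sub_sub_cancel] at this
    · obtain ⟨p, hp, q, hq, rfl⟩ := Submodule.mem_sup.1 hz
      rw [mul_add]
      exact Submodule.add_mem_sup (DGOver.base_mul_mem_baseSpan _ hp)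
        (DGOver.mul_mem_ideal_pow _ hq)
  have h3 : D (τ i) ∈ h.m₁.baseSpan (τ '' Set.Iio i) ⊔ h.m₁.ideal ^ 2 := by
    have := Submodule.add_mem _ (h2 h1)
      (Submodule.mem_sup_right (DGOver.d_mem_ideal_sq (hτ i)))
    change D _ + D _ ∈ _ at this
    rwa [← map_add, add_sub_cancel] at this
  obtain ⟨p, hp, q, hq, hpq⟩ := Submodule.mem_sup.1 h3
  have hPp : P.hom p = (2 : ℚ) • p :=
    DGOver.eigen_of_mem_baseSpan (by rintro _ ⟨j, -, rfl⟩; exact hPτ j) hp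
  have hPD : P.hom (D (τ i)) = (2 : ℚ) • D (τ i) := by
    refine (P.map_d (τ i)).trans ?_
    rw [hPτ, map_smul]; rfl
  -- `D (τ i)` and its linear part `p` have eigenvalue 2, so the remainder `q` in `I²` has it too,
  -- whereas `P` acts on `I ^ k / I ^ (k + 1)` by `2 ^ k ≥ 4` for `k ≥ 2`.
  have hPq : P.hom q = (2 : ℚ) ^ 1 • q := by
    rw [← hpq, map_add, hPp, smul_add] at hPD
    rw [pow_one]
    exact add_left_cancel hPD
  have hq0 : q = 0 := hP.eq_zero_of_eigen (by norm_num) hq hPq (by norm_num)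
  rwa [← hpq, hq0, add_zero]

/-- On eigenvectors the differential is linear with coefficients of odd degree in `B`. Well-founded
induction makes each new eigenvector closed by subtracting a `B`-combination of earlier closed ones;
the result stays an eigenvector because `P` is `B`-linear. -/
theorem exists_closed_coordinates [WellFoundedLT I] {P : DGHom h.m₁ h.m₁}
    (hP : DGHom.Cong 2 P (DGHom.id _)) (hDD : ∀ x, D (D x) = 0)
    (hH : HasZeroOddCohomology 𝓑 dB) {n : I → ℕ} (he : ∀ i, e i ∈ 𝓦 (n i))
    (hn : ∀ i, Odd (n i))
    (hks : ∀ i, D (gen 𝓑 𝓦 (e i)) ∈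
      Algebra.adjoin ℚ (Set.range (base₁ 𝓑 𝓦) ∪ (fun j => gen 𝓑 𝓦 (e j)) '' Set.Iio i)) :
    ∃ x : I → Model₁ 𝓑 𝓦, ∀ i, x i ∈ gr₁ 𝓑 𝓦 (n i) ∧ D (x i) = 0 ∧
      P.hom (x i) = (2 : ℚ) • x i ∧ x i ∈ h.m₁.ideal ∧
      gen 𝓑 𝓦 (e i) - x i ∈ h.m₁.baseSpan (x '' Set.Iio i) ⊔ h.m₁.ideal ^ 2 := by
  choose τ hτgr hτ hPτ using fun i =>
    hP.exists_eigen (gen_mem (𝒜 := 𝓑) (he i)) (h.gen_mem_ideal (e i))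
  have hDτ := fun i => h.d_mem_baseSpan_of_eigen hP he (hks i) hτ hPτ
  have hτI : ∀ i, τ i ∈ h.m₁.ideal := fun i => by
    have := Submodule.add_mem _ (DGOver.ideal_sq_le (hτ i)) (h.gen_mem_ideal (e i))
    rwa [sub_add_cancel] at this
  have key : ∀ i, ∃ x, x ∈ gr₁ 𝓑 𝓦 (n i) ∧ D x = 0 ∧
      x - τ i ∈ h.m₁.baseSpan (τ '' Set.Iio i) := by
    intro i
    induction i using WellFoundedLT.induction with
    | ind i ih =>
      choose! x hx using ih
      have hτx := DGOver.mem_baseSpan_of_unitriangular (X := h.m₁) fun j hj => (hx j hj).2.2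
      have h1 : D (τ i) ∈ h.m₁.baseSpan (x '' Set.Iio i) := by
        refine DGOver.baseSpan_le ?_ (fun b z hz => DGOver.base_mul_mem_baseSpan b hz) (hDτ i)
        rintro _ ⟨j, hj, rfl⟩
        exact hτx j hj
      obtain ⟨s, b, hs, hb, hsum⟩ := DGOver.exists_sum_of_mem_baseSpan x n
        (fun j hj => (hx j hj).1) h1 (h.isOddDerivation.map_mem _ _ (hτgr i))
      have hd : ∀ (c : I → B), D (∑ j ∈ s, h.m₁.base (c j) * x j) =
          ∑ j ∈ s, h.m₁.base (dB (c j)) * x j := fun c => by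
        rw [map_sum]
        exact Finset.sum_congr rfl fun j hj => DGOver.d_base_mul (X := h.m₁) (hx j (hs hj)).2.1 _
      -- Applying `D` to `D (τ i) = ∑ b j x j` with closed `x j` gives `∑ dB (b j) x j = 0`;
      -- independence makes every `b j` closed. This is where `D² = 0` enters.
      have hdb : ∀ j ∈ s, dB (b j) = 0 := by
        refine h.coeff_eq_zero e hτ s (fun j hj => (hx j (hs hj)).2.2) _ ?_
        rw [← hd, ← hsum, hDD]
      have hc : ∀ j, ∃ c, ((n j ≤ n i ∧ c ∈ 𝓑 (n i - n j)) ∨ c = 0) ∧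
          (j ∈ s → dB c = b j) := by
        intro j
        by_cases hj : j ∈ s
        · rcases hb j with ⟨hle, hbj⟩ | hbj
          · obtain ⟨p, hp⟩ := hn i
            obtain ⟨q, hq⟩ := hn j
            -- The bound known so far is `n j ≤ n i + 1`; equality is excluded since both degrees
            -- are odd. Thus `b j` has the odd degree `n i - n j + 1` and is exact.
            have hle' : n j ≤ n i := by omega
            obtain ⟨c, hc, hdc⟩ := hH.exists_homogeneous h.isOddDerivation_base.map_mem
              (n := n i - n j) ⟨p - q, by omega⟩
              (by rwa [show n i + 1 - n j = n i - n j + 1 by omega] at hbj) (hdb j hj)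
            exact ⟨c, Or.inl ⟨hle', hc⟩, fun _ => hdc⟩
          · exact ⟨0, Or.inr rfl, fun _ => by rw [map_zero, hbj]⟩
        · exact ⟨0, Or.inr rfl, fun h => absurd h hj⟩
      choose c hc hdc using hc
      refine ⟨τ i - ∑ j ∈ s, h.m₁.base (c j) * x j, ?_, ?_, ?_⟩
      · refine Submodule.sub_mem _ (hτgr i) (Submodule.sum_mem _ fun j hj => ?_)
        rcases hc j with ⟨hle, hcj⟩ | hcj
        · have := SetLike.GradedMul.mul_mem (h.m₁.base_mem _ _ hcj) (hx j (hs hj)).1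
          rwa [Nat.sub_add_cancel hle] at this
        · rw [hcj, map_zero, zero_mul]
          exact Submodule.zero_mem _
      · rw [map_sub, hd, hsum, sub_eq_zero]
        exact Finset.sum_congr rfl fun j hj => by rw [hdc j hj]
      · rw [sub_sub_cancel_left]
        refine Submodule.neg_mem _ (Submodule.sum_mem _ fun j hj =>
          DGOver.base_mul_mem_baseSpan _ ?_)
        have := Submodule.add_mem _
          (DGOver.baseSpan_mono (Set.image_mono (Set.Iio_subset_Iio (le_of_lt (hs hj))))
            (hx j (hs hj)).2.2)
          (DGOver.subset_baseSpan (X := h.m₁) (Set.mem_image_of_mem τ (hs hj)))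
        rwa [sub_add_cancel] at this
  choose x hx using key
  have hP2 : ∀ i, ∀ z ∈ h.m₁.baseSpan (τ '' Set.Iio i), P.hom z = (2 : ℚ) • z := fun i z hz =>
    DGOver.eigen_of_mem_baseSpan (by rintro _ ⟨j, -, rfl⟩; exact hPτ j) hz
  have hI : ∀ i, h.m₁.baseSpan (τ '' Set.Iio i) ≤ h.m₁.ideal := fun i =>
    DGOver.baseSpan_le (by rintro _ ⟨j, -, rfl⟩; exact hτI j) fun b z hz => by
      rw [DGOver.mem_ideal] at hz ⊢
      rw [map_mul, hz, mul_zero]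
  refine ⟨x, fun i => ⟨(hx i).1, (hx i).2.1, ?_, ?_, ?_⟩⟩
  · have := hP2 i _ (hx i).2.2
    rw [map_sub, hPτ, smul_sub] at this
    exact sub_left_injective this
  · have := Submodule.add_mem _ (hI i (hx i).2.2) (hτI i)
    rwa [sub_add_cancel] at this
  · have h1 : h.m₁.baseSpan (τ '' Set.Iio i) ≤ h.m₁.baseSpan (x '' Set.Iio i) := by
      refine DGOver.baseSpan_le ?_ fun b z hz => DGOver.base_mul_mem_baseSpan b hz
      rintro _ ⟨j, hj, rfl⟩
      exact DGOver.mem_baseSpan_of_unitriangular (fun j _ => (hx j).2.2) j hj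
    have := Submodule.add_mem_sup (Submodule.neg_mem _ (h1 (hx i).2.2))
      (Submodule.neg_mem _ (hτ i))
    convert this using 1
    abel

end IsModelDiff

end ClosedCoordinates

/-! ## Maps out of `B ⊗ ΛW` given on generators -/

section FreeHom

variable {B : Type u} [Ring B] [Algebra ℚ B] {𝓑 : ℕ → Submodule ℚ B} [GradedAlgebra 𝓑]
variable {W : Type v} [AddCommGroup W] [Module ℚ W] {𝓦 : ℕ → Submodule ℚ W}
  [DirectSum.Decomposition 𝓦]
variable {dB : B →ₗ[ℚ] B} {D : Model₁ 𝓑 𝓦 →ₗ[ℚ] Model₁ 𝓑 𝓦}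
variable {E : Type w} [Ring E] [Algebra ℚ E] {𝓔 : ℕ → Submodule ℚ E} [GradedAlgebra 𝓔]

theorem constr_mem {I : Type*} (e : Module.Basis I ℚ W) {n : I → ℕ} (he : ∀ i, e i ∈ 𝓦 (n i))
    {x : I → E} (hx : ∀ i, x i ∈ 𝓔 (n i)) (m : ℕ) (y : W) (hy : y ∈ 𝓦 m) :
    e.constr ℚ x y ∈ 𝓔 m := by
  -- The span induction cannot keep `y` homogeneous, so the claim is proved for the degree-`m`
  -- component of an arbitrary `y`.
  have key : ∀ y, e.constr ℚ x (DirectSum.decompose 𝓦 y m) ∈ 𝓔 m := by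
    intro y
    induction e.mem_span y using Submodule.span_induction with
    | mem y hy =>
      obtain ⟨i, rfl⟩ := hy
      by_cases hi : n i = m
      · subst hi
        rw [DirectSum.decompose_of_mem_same 𝓦 (he i), Module.Basis.constr_basis]
        exact hx i
      · rw [DirectSum.decompose_of_mem_ne 𝓦 (he i) hi, map_zero]
        exact Submodule.zero_mem _
    | zero => simp
    | add y z _ _ hy hz =>
      rw [DirectSum.decompose_add, DirectSum.add_apply, Submodule.coe_add, map_add]
      exact Submodule.add_mem _ hy hz
    | smul c y _ hy =>
      rw [DirectSum.decompose_smul, DirectSum.smul_apply, Submodule.coe_smul, map_smul]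
      exact Submodule.smul_mem _ _ hy
  have := key y
  rwa [DirectSum.decompose_of_mem_same 𝓦 hy] at this

/-- The algebra map `B ⊗ ΛW → E` given on `B` and on the generators. -/
def baseGenHom (hE : IsGradedCommutative 𝓔) (f : B →ₐ[ℚ] E) (hf : ∀ n b, b ∈ 𝓑 n → f b ∈ 𝓔 n)
    (g : W →ₗ[ℚ] E) (hg : ∀ n x, x ∈ 𝓦 n → g x ∈ 𝓔 n) : Model₁ 𝓑 𝓦 →ₐ[ℚ] E :=
  grExtHom hE f (FreeGCA.liftGr 𝓦 hE g hg) hf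
    (FreeGCA.lift_mem _ fun n x hx => by rw [FreeGCA.liftGr_ι]; exact hg n x hx)

section

variable (hE : IsGradedCommutative 𝓔) (f : B →ₐ[ℚ] E) (hf : ∀ n b, b ∈ 𝓑 n → f b ∈ 𝓔 n)
  (g : W →ₗ[ℚ] E) (hg : ∀ n x, x ∈ 𝓦 n → g x ∈ 𝓔 n)

theorem baseGenHom_mem (n : ℕ) (x : Model₁ 𝓑 𝓦) (hx : x ∈ gr₁ 𝓑 𝓦 n) :
    baseGenHom hE f hf g hg x ∈ 𝓔 n :=
  grExtHom_mem _ _ _ _ _ n x hx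

theorem baseGenHom_inl (b : B) : baseGenHom hE f hf g hg (inl 𝓑 𝓦 b) = f b := by
  rw [inl_apply, baseGenHom, grExtHom_tmul, map_one, mul_one]

theorem baseGenHom_gen (x : W) : baseGenHom hE f hf g hg (gen 𝓑 𝓦 x) = g x := by
  change baseGenHom hE f hf g hg ((1 : B) ᵍ⊗ₜ[ℚ] FreeGCA.ι 𝓦 x) = g x
  rw [baseGenHom, grExtHom_tmul, map_one, one_mul, FreeGCA.liftGr_ι]

end

namespace DGOver

variable (Y : DGOver 𝓑 dB 𝓔)

/-- The algebra map `B ⊗ ΛW → E` under `B` given on the generators. -/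
def freeHom (g : W →ₗ[ℚ] E) (hg : ∀ n x, x ∈ 𝓦 n → g x ∈ 𝓔 n) : Model₁ 𝓑 𝓦 →ₐ[ℚ] E :=
  baseGenHom Y.comm Y.base Y.base_mem g hg

variable (g : W →ₗ[ℚ] E) (hg : ∀ n x, x ∈ 𝓦 n → g x ∈ 𝓔 n)

theorem freeHom_mem (n : ℕ) (x : Model₁ 𝓑 𝓦) (hx : x ∈ gr₁ 𝓑 𝓦 n) : Y.freeHom g hg x ∈ 𝓔 n :=
  baseGenHom_mem _ _ _ _ _ n x hx

theorem freeHom_inl (b : B) : Y.freeHom g hg (inl 𝓑 𝓦 b) = Y.base b :=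
  baseGenHom_inl _ _ _ _ _ b

theorem freeHom_gen (x : W) : Y.freeHom g hg (gen 𝓑 𝓦 x) = g x :=
  baseGenHom_gen _ _ _ _ _ x

end DGOver

namespace IsModelDiff

variable (h : IsModelDiff 𝓑 𝓦 dB D) {Y : DGOver 𝓑 dB 𝓔}

/-- The DG map out of `B ⊗ ΛW` given on the generators. -/
def homOfGen (g : W →ₗ[ℚ] E) (hg : ∀ n x, x ∈ 𝓦 n → g x ∈ 𝓔 n) (hp : ∀ x, Y.proj (g x) = 0)
    (hd : ∀ x, Y.freeHom g hg (D (gen 𝓑 𝓦 x)) = Y.d (g x)) : DGHom h.m₁ Y where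
  hom := Y.freeHom g hg
  map_mem := Y.freeHom_mem g hg
  map_d := freeExt_map_d h.isOddDerivation Y.isOddDerivation _ (Y.freeHom_mem g hg)
    (fun b => by
      rw [Y.freeHom_inl, Y.d_base]
      exact (congrArg _ (h.d_base b)).trans (Y.freeHom_inl g hg _))
    (fun _ x _ => by rw [Y.freeHom_gen]; exact hd x)
  map_base := Y.freeHom_inl g hg
  proj_map x := by
    have : Y.proj.comp (Y.freeHom g hg) = h.m₁.proj := by
      refine freeExt_algHom_ext (fun b => ?_) (fun y => ?_)
      · rw [AlgHom.comp_apply, Y.freeHom_inl, Y.proj_base]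
        exact (h.m₁.proj_base b).symm
      · rw [AlgHom.comp_apply, Y.freeHom_gen, hp]
        exact (h.m₁.mem_ideal.1 (h.gen_mem_ideal y)).symm
    exact DFunLike.congr_fun this x

theorem homOfGen_gen (g : W →ₗ[ℚ] E) (hg : ∀ n x, x ∈ 𝓦 n → g x ∈ 𝓔 n)
    (hp : ∀ x, Y.proj (g x) = 0) (hd : ∀ x, Y.freeHom g hg (D (gen 𝓑 𝓦 x)) = Y.d (g x)) (x : W) :
    (h.homOfGen g hg hp hd).hom (gen 𝓑 𝓦 x) = g x := Y.freeHom_gen g hg x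

end IsModelDiff

theorem trivialDiff_eq_tensorDiff :
    trivialDiff 𝓑 𝓦 dB = tensorDiff 𝓑 (FreeGCA.gr 𝓦) dB 0 := by
  rw [tensorDiff, trivialDiff, left_eq_add]
  exact tensor_hom_ext fun i j b l _ _ => by rw [mulExt_tmul]; simp

theorem isModelDiff_trivialDiff (hB : IsGradedCommutative 𝓑) (h0 : 𝓦 0 = ⊥)
    (hd : IsOddDerivation 𝓑 dB) : IsModelDiff 𝓑 𝓦 dB (trivialDiff 𝓑 𝓦 dB) where
  comm := hB
  pos := h0
  isOddDerivation_base := hd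
  isOddDerivation := by
    rw [trivialDiff_eq_tensorDiff]
    exact isOddDerivation_tensorDiff hB (FreeGCA.gr_comm 𝓦) hd
      (fun _ _ _ => Submodule.zero_mem _) (fun _ _ _ _ => by simp)
  d_base b := rfl
  proj_d x := by
    have : proj₁ 𝓑 𝓦 ∘ₗ trivialDiff 𝓑 𝓦 dB = dB ∘ₗ proj₁ 𝓑 𝓦 :=
      tensor_hom_ext fun i j b l _ _ => (map_smul dB (FreeGCA.aug 𝓦 l) b).symm
    exact LinearMap.congr_fun this x

theorem trivialDiff_gen (hd : dB 1 = 0) (x : W) : trivialDiff 𝓑 𝓦 dB (gen 𝓑 𝓦 x) = 0 := by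
  change dB 1 ᵍ⊗ₜ[ℚ] FreeGCA.ι 𝓦 x = _
  rw [hd, zero_tmul]

end FreeHom

/-! ## Isomorphisms -/

section Iso

variable {B : Type u} [Ring B] [Algebra ℚ B] {𝓑 : ℕ → Submodule ℚ B} [GradedAlgebra 𝓑]
variable {dB : B →ₗ[ℚ] B}
variable {E : Type v} [Ring E] [Algebra ℚ E] {𝓔 : ℕ → Submodule ℚ E} [GradedAlgebra 𝓔]
variable {E' : Type w} [Ring E'] [Algebra ℚ E'] {𝓔' : ℕ → Submodule ℚ E'} [GradedAlgebra 𝓔']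

namespace DGHom

variable {X : DGOver 𝓑 dB 𝓔} {Y : DGOver 𝓑 dB 𝓔'} (f : DGHom X Y)

theorem decompose_hom (x : E) (n : ℕ) :
    (DirectSum.decompose 𝓔' (f.hom x) n : E') = f.hom (DirectSum.decompose 𝓔 x n) :=
  decompose_map_zero 𝓔 𝓔' f.hom.toLinearMap f.map_mem x n

/-- A map which is surjective on indecomposables is surjective. -/
theorem surjective_of_ideal_le (hf : Y.ideal ≤ X.ideal.map f.hom.toLinearMap ⊔ Y.ideal ^ 2) :
    Function.Surjective f.hom := by
  have hXY : X.ideal.map f.hom.toLinearMap ≤ Y.ideal := by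
    rintro _ ⟨x, hx, rfl⟩
    exact f.mem_ideal hx
  -- Surjectivity on indecomposables implies surjectivity on every quotient of successive powers,
  -- since these are generated by products.
  have h1 : ∀ k, Y.ideal ^ (k + 1) ≤
      X.ideal.map f.hom.toLinearMap ^ (k + 1) ⊔ Y.ideal ^ (k + 2) := by
    intro k
    induction k with
    | zero => simpa using hf
    | succ k ih =>
      rw [pow_succ]
      refine (mul_le_mul' ih hf).trans ?_
      rw [Submodule.sup_mul, Submodule.mul_sup, Submodule.mul_sup, ← pow_succ, ← pow_add]
      refine sup_le (sup_le le_sup_left (le_sup_of_le_right ?_)) (sup_le (le_sup_of_le_right ?_)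
        (le_sup_of_le_right ?_))
      · refine (mul_le_mul' (pow_le_pow_left' hXY _) le_rfl).trans ?_
        rw [← pow_add]
      · refine (mul_le_mul' le_rfl hXY).trans ?_
        rw [← pow_succ]
      · exact DGOver.ideal_pow_le (by omega)
  -- Climbing the filtration, the cokernel of `f` on the ideal is represented in arbitrarily high
  -- powers.
  have h2 : ∀ k, Y.ideal ≤ LinearMap.range f.hom.toLinearMap ⊔ Y.ideal ^ (k + 1) := by
    intro k
    induction k with
    | zero => rw [zero_add, pow_one]; exact le_sup_right
    | succ k ih =>
      refine ih.trans (sup_le le_sup_left ((h1 k).trans (sup_le_sup_right ?_ _)))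
      rw [← Submodule.map_pow]
      exact LinearMap.map_le_range
  -- In degree `n` the remainder in `I ^ (n + 1)` disappears after taking the degree-`n` component.
  have h3 : ∀ n, ∀ z ∈ 𝓔' n, z ∈ Y.ideal → z ∈ LinearMap.range f.hom.toLinearMap := by
    intro n z hz hzI
    obtain ⟨_, ⟨y, rfl⟩, q, hq, rfl⟩ := Submodule.mem_sup.1 (h2 n hzI)
    refine ⟨DirectSum.decompose 𝓔 y n, ?_⟩
    rw [← DirectSum.decompose_of_mem_same 𝓔' hz, DirectSum.decompose_add, DirectSum.add_apply,
      Submodule.coe_add, DGOver.decompose_eq_zero_of_mem_pow hq n.lt_succ_self, add_zero]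
    exact (f.decompose_hom y n).symm
  intro z
  refine mem_of_decompose 𝓔' (LinearMap.range f.hom.toLinearMap) z fun n => ?_
  obtain ⟨y, hy⟩ := DirectSum.decompose 𝓔' z n
  have := h3 n (y - Y.base (Y.proj y))
    (Submodule.sub_mem _ hy (Y.base_mem _ _ (Y.proj_mem _ _ hy))) (Y.sub_base_proj_mem y)
  have h4 : Y.base (Y.proj y) ∈ LinearMap.range f.hom.toLinearMap := ⟨_, f.map_base _⟩
  have h5 := Submodule.add_mem _ this h4
  rwa [sub_add_cancel] at h5

/-- A surjective endomorphism of an algebra of finite type is injective. -/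
theorem injective_of_surjective {X X' : DGOver 𝓑 dB 𝓔} (f : DGHom X X')
    (hfin : IsFiniteType 𝓔) (hf : Function.Surjective f.hom) : Function.Injective f.hom := by
  have key : ∀ n, Function.Injective (f.hom.toLinearMap.restrict (q := 𝓔 n) fun x hx => f.map_mem n x hx) := by
    intro n
    have := hfin n
    refine LinearMap.injective_iff_surjective.2 fun y => ?_
    obtain ⟨x, hx⟩ := hf y
    refine ⟨DirectSum.decompose 𝓔 x n, Subtype.ext ?_⟩
    refine (f.decompose_hom x n).symm.trans ?_
    rw [hx, DirectSum.decompose_of_mem_same 𝓔 y.2]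
  rw [injective_iff_map_eq_zero]
  intro x hx
  refine eq_zero_of_decompose 𝓔 x fun n => ?_
  have h1 : f.hom (DirectSum.decompose 𝓔 x n) = 0 := by
    rw [← f.decompose_hom, hx, DirectSum.decompose_zero]; rfl
  have h2 := @key n (DirectSum.decompose 𝓔 x n) 0 (Subtype.ext (h1.trans (map_zero f.hom).symm))
  rw [h2]; rfl

/-- The inverse of a bijective map. -/
def symm (hf : Function.Bijective f.hom) : DGHom Y X where
  hom := (AlgEquiv.ofBijective f.hom hf).symm
  map_mem n y hy := by
    have : (AlgEquiv.ofBijective f.hom hf).symm y =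
        DirectSum.decompose 𝓔 ((AlgEquiv.ofBijective f.hom hf).symm y) n := by
      refine hf.1 ?_
      rw [← f.decompose_hom]
      have e : f.hom ((AlgEquiv.ofBijective f.hom hf).symm y) = y :=
        (AlgEquiv.ofBijective f.hom hf).apply_symm_apply y
      rw [e, DirectSum.decompose_of_mem_same 𝓔' hy]
    change (AlgEquiv.ofBijective f.hom hf).symm y ∈ _
    rw [this]
    exact SetLike.coe_mem _
  map_d y := by
    refine hf.1 ?_
    rw [f.map_d]
    have e : ∀ y, f.hom ((AlgEquiv.ofBijective f.hom hf).symm y) = y :=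
      (AlgEquiv.ofBijective f.hom hf).apply_symm_apply
    exact (e _).trans (congrArg Y.d (e y).symm)
  map_base b := by
    refine hf.1 ?_
    rw [f.map_base]
    exact (AlgEquiv.ofBijective f.hom hf).apply_symm_apply _
  proj_map y := by
    rw [← f.proj_map]
    exact congrArg Y.proj ((AlgEquiv.ofBijective f.hom hf).apply_symm_apply y)

theorem hom_symm (hf : Function.Bijective f.hom) (y : E') : f.hom ((f.symm hf).hom y) = y :=
  (AlgEquiv.ofBijective f.hom hf).apply_symm_apply y

end DGHom

end Iso

/-! ## Finite type -/

section FiniteType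

variable {B : Type u} [Ring B] [Algebra ℚ B] {𝓑 : ℕ → Submodule ℚ B} [GradedAlgebra 𝓑]
variable {W : Type v} [AddCommGroup W] [Module ℚ W] {𝓦 : ℕ → Submodule ℚ W}

/-- Stripping the first letter of a word leaves a word of strictly smaller degree, as letters have
positive degree. The summand spanned by 1 accounts for the empty word. -/
theorem FreeGCA.isFiniteType_gr (h0 : 𝓦 0 = ⊥) (hW : IsFiniteType 𝓦) :
    IsFiniteType (FreeGCA.gr 𝓦) := by
  intro n
  induction n using Nat.strong_induction_on with
  | _ n ih =>
    have hle : FreeGCA.gr 𝓦 n ≤ Submodule.span ℚ {1} ⊔ ⨆ i : Fin n,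
        (𝓦 (i + 1)).map (FreeGCA.ι 𝓦) * FreeGCA.gr 𝓦 (n - (i + 1)) := by
      refine Submodule.span_le.2 ?_
      rintro _ ⟨l, rfl, rfl⟩
      cases l with
      | nil => exact Submodule.mem_sup_left (Submodule.mem_span_singleton_self _)
      | cons p l =>
        obtain ⟨i, x⟩ := p
        simp only [List.map_cons, List.sum_cons, List.prod_cons]
        rcases i with - | i
        · have : (x : W) = 0 := (Submodule.mem_bot ℚ).1 (h0.le x.2)
          rw [this, map_zero, zero_mul]
          exact Submodule.zero_mem _
        · refine Submodule.mem_sup_right (Submodule.mem_iSup_of_mem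
            (⟨i, by omega⟩ : Fin (i + 1 + (l.map Sigma.fst).sum)) ?_)
          refine Submodule.mul_mem_mul ⟨x, x.2, rfl⟩ ?_
          simp only [Nat.add_sub_cancel_left]
          exact Submodule.subset_span ⟨l, rfl, rfl⟩
    have hfg : (Submodule.span ℚ {1} ⊔ ⨆ i : Fin n,
        (𝓦 (i + 1)).map (FreeGCA.ι 𝓦) * FreeGCA.gr 𝓦 (n - (i + 1))).FG := by
      refine (Submodule.fg_span_singleton 1).sup (Submodule.fg_iSup _ fun i => ?_)
      have h1 := hW (i + 1)
      have h2 := ih (n - (i + 1)) (by omega)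
      exact ((Module.Finite.iff_fg.1 h1).map _).mul (Module.Finite.iff_fg.1 h2)
    have := Module.Finite.iff_fg.2 hfg
    exact Submodule.finiteDimensional_of_le hle

variable [DirectSum.Decomposition 𝓦]

theorem isFiniteType_gr₁ (h0 : 𝓦 0 = ⊥) (hB : IsFiniteType 𝓑) (hW : IsFiniteType 𝓦) :
    IsFiniteType (gr₁ 𝓑 𝓦) := by
  intro n
  have hle : gr₁ 𝓑 𝓦 n ≤ ⨆ i : Fin (n + 1),
      Submodule.map₂ (tmk 𝓑 (FreeGCA.gr 𝓦)) (𝓑 i) (FreeGCA.gr 𝓦 (n - i)) := by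
    refine Submodule.span_le.2 ?_
    rintro _ ⟨i, j, a, l, rfl, ha, hl, rfl⟩
    refine Submodule.mem_iSup_of_mem (⟨i, by omega⟩ : Fin (i + j + 1)) ?_
    refine Submodule.apply_mem_map₂ _ ha ?_
    simpa using hl
  have hfg : (⨆ i : Fin (n + 1),
      Submodule.map₂ (tmk 𝓑 (FreeGCA.gr 𝓦)) (𝓑 i) (FreeGCA.gr 𝓦 (n - i))).FG := by
    refine Submodule.fg_iSup _ fun i => ?_
    exact (Module.Finite.iff_fg.1 (hB i)).map₂ _
      (Module.Finite.iff_fg.1 (FreeGCA.isFiniteType_gr h0 hW (n - i)))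
  have := Module.Finite.iff_fg.2 hfg
  exact Submodule.finiteDimensional_of_le hle

end FiniteType

/-! ## Trivialisation of the differential -/

section Trivialisation

variable {B : Type u} [Ring B] [Algebra ℚ B] {𝓑 : ℕ → Submodule ℚ B} [GradedAlgebra 𝓑]
variable {W : Type v} [AddCommGroup W] [Module ℚ W] {𝓦 : ℕ → Submodule ℚ W}
  [DirectSum.Decomposition 𝓦]
variable {dB : B →ₗ[ℚ] B} {D : Model₁ 𝓑 𝓦 →ₗ[ℚ] Model₁ 𝓑 𝓦}

/-- Sending `e i` to `x i` is a DG map since both are closed. It is unitriangular on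
indecomposables, hence surjective, and finite type makes it injective. -/
theorem IsModelDiff.exists_iso (h : IsModelDiff 𝓑 𝓦 dB D)
    (h' : IsModelDiff 𝓑 𝓦 dB (trivialDiff 𝓑 𝓦 dB)) (hB : IsFiniteType 𝓑) (hW : IsFiniteType 𝓦)
    {I : Type*} [LinearOrder I] (e : Module.Basis I ℚ W) {n : I → ℕ} (he : ∀ i, e i ∈ 𝓦 (n i))
    {x : I → Model₁ 𝓑 𝓦} (hx : ∀ i, x i ∈ gr₁ 𝓑 𝓦 (n i)) (hDx : ∀ i, D (x i) = 0)
    (hxI : ∀ i, x i ∈ h.m₁.ideal)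
    (hgen : ∀ i, gen 𝓑 𝓦 (e i) - x i ∈ h.m₁.baseSpan (x '' Set.Iio i) ⊔ h.m₁.ideal ^ 2) :
    ∃ φ : DGHom h'.m₁ h.m₁, Function.Bijective φ.hom ∧ ∀ i, φ.hom (gen 𝓑 𝓦 (e i)) = x i := by
  have hsub : ∀ S : Submodule ℚ (Model₁ 𝓑 𝓦), (∀ i, x i ∈ S) → ∀ y, e.constr ℚ x y ∈ S := by
    intro S hS y
    rw [Module.Basis.constr_apply]
    exact Submodule.sum_mem _ fun i _ => Submodule.smul_mem _ _ (hS i)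
  set φ : DGHom h'.m₁ h.m₁ := h'.homOfGen (e.constr ℚ x) (constr_mem e he hx)
    (hsub h.m₁.ideal hxI) (fun y => by
      rw [trivialDiff_gen h.isOddDerivation_base.map_one, map_zero]
      exact (hsub (LinearMap.ker D) hDx y).symm)
  have hφ : ∀ i, φ.hom (gen 𝓑 𝓦 (e i)) = x i := fun i =>
    (h'.homOfGen_gen _ _ _ _ _).trans (Module.Basis.constr_basis _ _ _ _)
  have hx' : ∀ i, x i ∈ h'.m₁.ideal.map φ.hom.toLinearMap := fun i =>
    ⟨_, h'.gen_mem_ideal (e i), hφ i⟩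
  have hbase : ∀ b, ∀ z ∈ h'.m₁.ideal.map φ.hom.toLinearMap,
      h.m₁.base b * z ∈ h'.m₁.ideal.map φ.hom.toLinearMap := by
    rintro b _ ⟨z, hz, rfl⟩
    refine ⟨h'.m₁.base b * z, ?_, ?_⟩
    · rw [SetLike.mem_coe, DGOver.mem_ideal] at hz ⊢
      rw [map_mul, hz, mul_zero]
    · change φ.hom _ = _ * φ.hom z
      rw [map_mul, φ.map_base]
  have hsurj : Function.Surjective φ.hom := by
    refine φ.surjective_of_ideal_le ((h.ideal_le e.span_eq ?_).trans (sup_le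
      (DGOver.baseSpan_le ?_ fun b z hz => ?_) le_sup_right))
    · rintro _ ⟨i, rfl⟩
      exact ⟨_, he i⟩
    · rintro _ ⟨_, ⟨i, rfl⟩, rfl⟩
      have h1 : h.m₁.baseSpan (x '' Set.Iio i) ≤ h'.m₁.ideal.map φ.hom.toLinearMap :=
        DGOver.baseSpan_le (by rintro _ ⟨j, -, rfl⟩; exact hx' j) hbase
      have := Submodule.add_mem _ (sup_le_sup_right h1 _ (hgen i))
        (Submodule.mem_sup_left (hx' i))
      rwa [sub_add_cancel] at this
    · obtain ⟨p, hp, q, hq, rfl⟩ := Submodule.mem_sup.1 hz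
      rw [mul_add]
      exact Submodule.add_mem_sup (hbase b p hp) (DGOver.mul_mem_ideal_pow _ hq)
  exact ⟨φ, ⟨φ.injective_of_surjective (isFiniteType_gr₁ h.pos hB hW) hsurj, hsurj⟩, hφ⟩

end Trivialisation

/-! ## Contraction of the odd part of `B` -/

section Contraction

theorem LinearMap.exists_generalizedInverse {K V V' : Type*} [Field K] [AddCommGroup V] [Module K V]
    [AddCommGroup V'] [Module K V'] (f : V →ₗ[K] V') :
    ∃ g : V' →ₗ[K] V, ∀ x, f (g (f x)) = f x := by
  obtain ⟨g, hg⟩ := f.rangeRestrict.exists_rightInverse_of_surjective f.range_rangeRestrict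
  obtain ⟨g', hg'⟩ := LinearMap.exists_extend g
  refine ⟨g', fun x => ?_⟩
  have h1 : g' (f x) = g (f.rangeRestrict x) := LinearMap.congr_fun hg' (f.rangeRestrict x)
  rw [h1]
  exact congrArg Subtype.val (LinearMap.congr_fun hg (f.rangeRestrict x))

variable {B : Type u} [Ring B] [Algebra ℚ B] {𝓑 : ℕ → Submodule ℚ B} [GradedAlgebra 𝓑]

/-- Vanishing cohomology in odd degrees over a field yields a linear contraction there. Linear
operators are needed, rather than mere existence of primitives, because they can be tensored with
`ΛW ⊗ ΛW`. -/
theorem HasZeroOddCohomology.exists_contraction {d : B →ₗ[ℚ] B} (hH : HasZeroOddCohomology 𝓑 d)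
    (hd : ∀ n b, b ∈ 𝓑 n → d b ∈ 𝓑 (n + 1)) :
    ∃ s t : B →ₗ[ℚ] B, ∀ n b, Odd n → b ∈ 𝓑 n → d (s b) + t (d b) = b := by
  set O : Submodule ℚ B := Submodule.span ℚ {b | ∃ n, Odd n ∧ b ∈ 𝓑 n}
  have hO : ∀ c ∈ O, d c = 0 → c ∈ LinearMap.range d := by
    intro c hc hdc
    refine mem_of_decompose 𝓑 _ c fun n => ?_
    rcases Nat.even_or_odd n with hn | hn
    · have : (DirectSum.decompose 𝓑 c n : B) = 0 := by
        clear hdc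
        induction hc using Submodule.span_induction with
        | mem b hb =>
          obtain ⟨m, hm, hb⟩ := hb
          refine DirectSum.decompose_of_mem_ne 𝓑 hb ?_
          rintro rfl
          exact Nat.not_even_iff_odd.2 hm hn
        | zero => simp
        | add x y _ _ hx hy => simp [DirectSum.decompose_add, hx, hy]
        | smul q x _ hx =>
          rw [DirectSum.decompose_smul]
          exact (congrArg (q • ·) hx).trans (smul_zero q)
      rw [this]
      exact Submodule.zero_mem _
    · refine hH n hn _ (SetLike.coe_mem _) ?_
      rw [← decompose_map 𝓑 𝓑 1 d hd, hdc, DirectSum.decompose_zero]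
      rfl
  obtain ⟨σ, hσ⟩ := LinearMap.exists_generalizedInverse d
  -- `τ` takes values in the odd part `O`, so `b - τ (d b)` is a closed element of `O`, hence exact,
  -- and the generalized inverse `σ` of `d` supplies a primitive.
  obtain ⟨τ, hτ⟩ := LinearMap.exists_generalizedInverse (d ∘ₗ O.subtype)
  refine ⟨σ ∘ₗ (LinearMap.id - O.subtype ∘ₗ τ ∘ₗ d), O.subtype ∘ₗ τ, fun n b hn hb => ?_⟩
  have hbO : b ∈ O := Submodule.subset_span ⟨n, hn, hb⟩
  obtain ⟨y, hy⟩ := hO (b - τ (d b)) (Submodule.sub_mem _ hbO (SetLike.coe_mem _)) (by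
    rw [map_sub, sub_eq_zero]
    exact (hτ ⟨b, hbO⟩).symm)
  change d (σ (b - τ (d b))) + τ (d b) = b
  rw [← hy, hσ, hy, sub_add_cancel]

end Contraction

/-! ## Homotopic maps agree up to coboundaries -/

section Integration

/-- Integration of polynomials over the unit interval. -/
def polyIntegral : ℚ[X] →ₗ[ℚ] ℚ :=
  Polynomial.lsum fun n => ((n : ℚ) + 1)⁻¹ • LinearMap.id

theorem polyIntegral_derivative (p : ℚ[X]) :
    polyIntegral (Polynomial.derivative p) = p.eval 1 - p.eval 0 := by
  induction p using Polynomial.induction_on' with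
  | add p q hp hq => rw [map_add, map_add, hp, hq, Polynomial.eval_add, Polynomial.eval_add]; ring
  | monomial n a =>
    rw [Polynomial.derivative_monomial, polyIntegral, Polynomial.lsum_apply,
      Polynomial.sum_monomial_index _ _ (by simp)]
    rcases n with - | n
    · simp
    · have : (n : ℚ) + 1 ≠ 0 := by positivity
      simp
      field_simp

variable {E : Type w} [Ring E] [Algebra ℚ E] {𝓔 : ℕ → Submodule ℚ E} [GradedAlgebra 𝓔]

/-- Stokes on the unit interval: integrating over `t` intertwines the differentials up to the
difference of the endpoint values. Hence homotopic maps differ by a coboundary on closed elements.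
-/
theorem exists_d_eq_of_pathDiff_eq_zero {dE : E →ₗ[ℚ] E} (hd : IsOddDerivation 𝓔 dE)
    {z : 𝓔 ᵍ⊗[ℚ] LambdaT.gr} (hz : pathDiff 𝓔 dE z = 0) :
    ∃ y, dE y = contract 𝓔 LambdaT.gr (LambdaT.ev 1) LinearMap.id z -
      contract 𝓔 LambdaT.gr (LambdaT.ev 0) LinearMap.id z := by
  set ν : LambdaT →ₗ[ℚ] ℚ := polyIntegral ∘ₗ (TrivSqZeroExt.sndHom ℚ[X] ℚ[X]).restrictScalars ℚ
  set J : (𝓔 ᵍ⊗[ℚ] LambdaT.gr) →ₗ[ℚ] E := contract 𝓔 LambdaT.gr ν LinearMap.id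
  have key : J ∘ₗ pathDiff 𝓔 dE = dE ∘ₗ J + signInv 𝓔 ∘ₗ
      (contract 𝓔 LambdaT.gr (LambdaT.ev 1) LinearMap.id -
        contract 𝓔 LambdaT.gr (LambdaT.ev 0) LinearMap.id) := by
    refine tensor_hom_ext fun i j a u _ _ => ?_
    change ν u • dE a + ν (LambdaT.d u) • signInv 𝓔 a =
      dE (ν u • a) + signInv 𝓔 (u.fst.eval 1 • a - u.fst.eval 0 • a)
    have h1 : ν (LambdaT.d u) = u.fst.eval 1 - u.fst.eval 0 := polyIntegral_derivative u.fst
    rw [h1, ← sub_smul, map_smul, map_smul]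
  have h1 := LinearMap.congr_fun key z
  rw [LinearMap.comp_apply, hz, map_zero] at h1
  -- The boundary term appears with the degree sign; applying the degree involution removes it, at
  -- the cost of a sign since it anticommutes with `dE`.
  refine ⟨signInv 𝓔 (J z), ?_⟩
  rw [hd.map_signInv, ← LinearMap.sub_apply]
  refine Eq.trans ?_ (signInv_signInv 𝓔 _)
  rw [← map_neg]
  exact congrArg _ (neg_eq_of_add_eq_zero_right h1.symm)

end Integration

/-! ## Odd cocycles of word length two -/

section OddCocycle

variable {B : Type u} [Ring B] [Algebra ℚ B] {𝓑 : ℕ → Submodule ℚ B} [GradedAlgebra 𝓑]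
variable {W : Type v} [AddCommGroup W] [Module ℚ W] {𝓦 : ℕ → Submodule ℚ W}
  [DirectSum.Decomposition 𝓦]
variable {dB : B →ₗ[ℚ] B} {D : Model₁ 𝓑 𝓦 →ₗ[ℚ] Model₁ 𝓑 𝓦}

/-- For `W` in odd degrees the algebra map `w ↦ -w` is the degree involution. -/
theorem lift_neg_eq (hW : ∀ n, Even n → 𝓦 n = ⊥) (g : FreeGCA 𝓦 →ₐ[ℚ] FreeGCA 𝓦)
    (hg : ∀ x, g (FreeGCA.ι 𝓦 x) = (-1 : ℚ) • FreeGCA.ι 𝓦 x) {j : ℕ} {l : FreeGCA 𝓦}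
    (hl : l ∈ FreeGCA.gr 𝓦 j) : g l = (-1 : ℚ) ^ j • l := by
  have : FreeGCA.gr 𝓦 j ≤ LinearMap.ker (g.toLinearMap - (-1 : ℚ) ^ j • LinearMap.id) := by
    refine Submodule.span_le.2 ?_
    rintro _ ⟨l, rfl, rfl⟩
    refine sub_eq_zero.2 ?_
    change g _ = (-1 : ℚ) ^ _ • _
    clear hl
    induction l with
    | nil => simp
    | cons p l ih =>
      obtain ⟨i, x⟩ := p
      simp only [List.map_cons, List.sum_cons, List.prod_cons]
      rcases Nat.even_or_odd i with hi | hi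
      · have : (x : W) = 0 := (Submodule.mem_bot ℚ).1 ((hW i hi).le x.2)
        simp [this]
      · rw [map_mul, hg, ih, pow_add, hi.neg_one_pow, smul_mul_smul_comm]
        rfl
  exact sub_eq_zero.1 (this hl)

variable (𝓑 𝓦) in
/-- The map `f ⊗ 1 ⊗ 1` of `B ⊗ ΛW ⊗ ΛW`. -/
def mapBase₂ (f : B →ₗ[ℚ] B) : Model₂ 𝓑 𝓦 →ₗ[ℚ] Model₂ 𝓑 𝓦 :=
  mapLeft (gr₁ 𝓑 𝓦) (gr₁ 𝓑 𝓦) (FreeGCA.gr 𝓦) (mapLeft 𝓑 𝓑 (FreeGCA.gr 𝓦) f)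

theorem mapBase₂_tmul (f : B →ₗ[ℚ] B) (b : B) (l l' : FreeGCA 𝓦) :
    mapBase₂ 𝓑 𝓦 f ((b ᵍ⊗ₜ[ℚ] l : Model₁ 𝓑 𝓦) ᵍ⊗ₜ[ℚ] l') =
      (f b ᵍ⊗ₜ[ℚ] l : Model₁ 𝓑 𝓦) ᵍ⊗ₜ[ℚ] l' := rfl

/-- Homogeneous pure tensors span the homogeneous parts of `B ⊗ ΛW ⊗ ΛW`. -/
theorem mem_of_mem_gr₂ {n : ℕ} {S : Submodule ℚ (Model₂ 𝓑 𝓦)}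
    (hS : ∀ (i j k : ℕ) (b : B) (l l' : FreeGCA 𝓦), i + j + k = n → b ∈ 𝓑 i →
      l ∈ FreeGCA.gr 𝓦 j → l' ∈ FreeGCA.gr 𝓦 k → (b ᵍ⊗ₜ[ℚ] l : Model₁ 𝓑 𝓦) ᵍ⊗ₜ[ℚ] l' ∈ S) :
    gr₂ 𝓑 𝓦 n ≤ S := by
  refine Submodule.span_le.2 ?_
  rintro _ ⟨p, k, x, l', hn, hx, hl', rfl⟩
  have : gr₁ 𝓑 𝓦 p ≤ S.comap ((tmk (gr₁ 𝓑 𝓦) (FreeGCA.gr 𝓦)).flip l') := by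
    refine Submodule.span_le.2 ?_
    rintro _ ⟨i, j, b, l, hp, hb, hl, rfl⟩
    exact hS i j k b l l' (by omega) hb hl hl'
  exact this hx

theorem linearMap_ext_tmul₂ {M : Type*} [AddCommGroup M] [Module ℚ M]
    {f g : Model₂ 𝓑 𝓦 →ₗ[ℚ] M} (hfg : ∀ b l l', f ((b ᵍ⊗ₜ[ℚ] l : Model₁ 𝓑 𝓦) ᵍ⊗ₜ[ℚ] l') =
      g ((b ᵍ⊗ₜ[ℚ] l : Model₁ 𝓑 𝓦) ᵍ⊗ₜ[ℚ] l')) : f = g := by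
  refine LinearMap.ext fun z => sub_eq_zero.1 ?_
  refine mem_of_decompose (gr₂ 𝓑 𝓦) (LinearMap.ker (f - g)) z fun n => ?_
  exact mem_of_mem_gr₂ (fun _ _ _ b l l' _ _ _ _ => sub_eq_zero.2 (hfg b l l'))
    (SetLike.coe_mem (DirectSum.decompose (gr₂ 𝓑 𝓦) z n))

theorem mapBase₂_comp (f f' : B →ₗ[ℚ] B) (y : Model₂ 𝓑 𝓦) :
    mapBase₂ 𝓑 𝓦 (f ∘ₗ f') y = mapBase₂ 𝓑 𝓦 f (mapBase₂ 𝓑 𝓦 f' y) :=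
  LinearMap.congr_fun (f := mapBase₂ 𝓑 𝓦 (f ∘ₗ f')) (g := mapBase₂ 𝓑 𝓦 f ∘ₗ mapBase₂ 𝓑 𝓦 f')
    (linearMap_ext_tmul₂ fun _ _ _ => rfl) y

theorem mapBase₂_add (f f' : B →ₗ[ℚ] B) (y : Model₂ 𝓑 𝓦) :
    mapBase₂ 𝓑 𝓦 (f + f') y = mapBase₂ 𝓑 𝓦 f y + mapBase₂ 𝓑 𝓦 f' y :=
  LinearMap.congr_fun (f := mapBase₂ 𝓑 𝓦 (f + f')) (g := mapBase₂ 𝓑 𝓦 f + mapBase₂ 𝓑 𝓦 f')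
    (linearMap_ext_tmul₂ fun b l l' => by
      rw [LinearMap.add_apply, mapBase₂_tmul, mapBase₂_tmul, mapBase₂_tmul, ← add_tmul,
        ← add_tmul]
      rfl) y

theorem diff₂_trivialDiff (hd : dB 1 = 0) :
    diff₂ 𝓑 𝓦 (trivialDiff 𝓑 𝓦 dB) = mapBase₂ 𝓑 𝓦 dB := by
  refine tensor_hom_ext fun i j x l _ _ => ?_
  change _ + fst₂ 𝓑 𝓦 (signInv (gr₁ 𝓑 𝓦) x) * snd₂ 𝓑 𝓦 (dB 1 ᵍ⊗ₜ[ℚ] l) = _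
  rw [hd, zero_tmul, map_zero, mul_zero, add_zero]
  rfl

namespace IsModelDiff

variable (h : IsModelDiff 𝓑 𝓦 dB (trivialDiff 𝓑 𝓦 dB))

/-- The map `w ↦ -w` for the differential `d_B ⊗ 1`. -/
def negHom : DGHom h.m₁ h.m₁ :=
  h.homOfGen (-gen 𝓑 𝓦) (fun n x hx => Submodule.neg_mem _ (gen_mem hx))
    (fun x => h.m₁.mem_ideal.1 (h.m₁.ideal.neg_mem (h.gen_mem_ideal x)))
    (fun x => by
      rw [trivialDiff_gen h.isOddDerivation_base.map_one, map_zero, LinearMap.neg_apply, map_neg]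
      exact (neg_eq_zero.2 (trivialDiff_gen h.isOddDerivation_base.map_one x)).symm)

theorem negHom_gen (x : W) : h.negHom.hom (gen 𝓑 𝓦 x) = -gen 𝓑 𝓦 x := by
  exact h.homOfGen_gen _ _ _ _ x

theorem negHom_inr (hW : ∀ n, Even n → 𝓦 n = ⊥) {j : ℕ} {l : FreeGCA 𝓦}
    (hl : l ∈ FreeGCA.gr 𝓦 j) : h.negHom.hom (inr 𝓑 𝓦 l) = (-1 : ℚ) ^ j • inr 𝓑 𝓦 l := by
  set g : FreeGCA 𝓦 →ₐ[ℚ] FreeGCA 𝓦 := FreeGCA.liftGr 𝓦 (FreeGCA.gr_comm 𝓦)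
    ((-1 : ℚ) • FreeGCA.ι 𝓦) fun n x hx => Submodule.smul_mem _ _ (FreeGCA.ι_mem_gr 𝓦 hx)
  have hg : ∀ x, g (FreeGCA.ι 𝓦 x) = (-1 : ℚ) • FreeGCA.ι 𝓦 x := FreeGCA.liftGr_ι 𝓦 _ _ _
  have : h.negHom.hom.comp (GradedTensorProduct.includeRight 𝓑 (FreeGCA.gr 𝓦)) =
      (GradedTensorProduct.includeRight 𝓑 (FreeGCA.gr 𝓦)).comp g := by
    refine FreeGCA.algHom_ext 𝓦 fun x => ?_
    change h.negHom.hom (gen 𝓑 𝓦 x) = inr 𝓑 𝓦 (g (FreeGCA.ι 𝓦 x))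
    rw [negHom_gen, hg, map_smul, neg_one_smul]
    rfl
  refine (DFunLike.congr_fun this l).trans ?_
  change inr 𝓑 𝓦 (g l) = _
  rw [lift_neg_eq hW g hg hl, map_smul]

theorem cong_negHom : DGHom.Cong (-1) h.negHom (DGHom.id h.m₁) := by
  intro x hx
  refine h.map_mem_of_gen (Y := h.m₁) (h.negHom.hom.toLinearMap - (-1 : ℚ) • LinearMap.id)
    (fun b z => ?_) (fun z hz => ?_) (fun y => ?_) hx
  · change h.negHom.hom _ - (-1 : ℚ) • _ = _ * (h.negHom.hom z - (-1 : ℚ) • z)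
    rw [map_mul, h.negHom.map_base, mul_sub, mul_smul_comm]
    rfl
  · exact Submodule.sub_mem _ (h.negHom.mem_ideal_pow hz) (Submodule.smul_mem _ _ hz)
  · rw [LinearMap.sub_apply, LinearMap.smul_apply, LinearMap.id_apply, AlgHom.toLinearMap_apply,
      negHom_gen]
    simp

/-- The map `w ↦ -w`, `w' ↦ -w'` for the differential `d_B ⊗ 1`. -/
def negHom₂ : DGHom h.m₂ h.m₂ := h.pair (h.fst.comp h.negHom) (h.snd.comp h.negHom)

theorem cong_negHom₂ : DGHom.Cong (-1) h.negHom₂ (DGHom.id h.m₂) := by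
  have key := h.cong_pair (a := h.fst.comp h.negHom) (b := h.snd.comp h.negHom) (a' := h.fst)
    (b' := h.snd) (c := -1)
    (fun x hx => by
      have := h.fst.mem_ideal_pow (h.cong_negHom x hx)
      rwa [map_sub, map_smul] at this)
    (fun x hx => by
      have := h.snd.mem_ideal_pow (h.cong_negHom x hx)
      rwa [map_sub, map_smul] at this)
  intro x hx
  have := key x hx
  rwa [pair_fst_snd] at this

theorem negHom₂_tmul (hW : ∀ n, Even n → 𝓦 n = ⊥) {j k : ℕ} (b : B) {l l' : FreeGCA 𝓦}
    (hl : l ∈ FreeGCA.gr 𝓦 j) (hl' : l' ∈ FreeGCA.gr 𝓦 k) :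
    h.negHom₂.hom ((b ᵍ⊗ₜ[ℚ] l : Model₁ 𝓑 𝓦) ᵍ⊗ₜ[ℚ] l' : Model₂ 𝓑 𝓦) =
      (-1 : ℚ) ^ (j + k) • ((b ᵍ⊗ₜ[ℚ] l : Model₁ 𝓑 𝓦) ᵍ⊗ₜ[ℚ] l' : Model₂ 𝓑 𝓦) := by
  have e1 : h.negHom.hom (b ᵍ⊗ₜ[ℚ] l : Model₁ 𝓑 𝓦) =
      (-1 : ℚ) ^ j • (b ᵍ⊗ₜ[ℚ] l : Model₁ 𝓑 𝓦) := by
    rw [h.tmul_eq_base_mul, map_mul h.negHom.hom, h.negHom.map_base, h.negHom_inr hW hl,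
      mul_smul_comm]
  rw [h.tmul_eq_fst_mul_snd, map_mul, negHom₂, pair_fst, pair_snd, DGHom.comp_apply,
    DGHom.comp_apply, e1, h.negHom_inr hW hl', map_smul, map_smul, smul_mul_smul_comm, pow_add]

variable {h}

/-- An odd cocycle of `B ⊗ ΛW ⊗ ΛW` with differential `d_B ⊗ 1` which is decomposable is a
coboundary modulo elements of word length three. -/
theorem mem_bdry_three_of_trivial
    (hW : ∀ n, Even n → 𝓦 n = ⊥) (hH : HasZeroOddCohomology 𝓑 dB) {n : ℕ} (hn : Odd n)
    {z : Model₂ 𝓑 𝓦} (hz : z ∈ gr₂ 𝓑 𝓦 n) (hdz : h.m₂.d z = 0)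
    (hzI : z ∈ h.m₂.ideal ^ 2) : z ∈ h.m₂.bdry 3 := by
  obtain ⟨s, t, hst⟩ := hH.exists_contraction h.isOddDerivation_base.map_mem
  have hFd : h.m₂.d = mapBase₂ 𝓑 𝓦 dB := diff₂_trivialDiff h.isOddDerivation_base.map_one
  -- As `W` is odd, `z + negHom₂ z` is twice the part of `z` of even word length. In odd total
  -- degree that part has coefficients of odd degree in `B`, where `dB s + t dB` is the identity.
  have key : gr₂ 𝓑 𝓦 n ≤ LinearMap.ker ((mapBase₂ 𝓑 𝓦 (dB ∘ₗ s + t ∘ₗ dB) - LinearMap.id) ∘ₗ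
      (LinearMap.id + h.negHom₂.hom.toLinearMap)) := by
    refine mem_of_mem_gr₂ fun i j k b l l' hijk hb hl hl' => sub_eq_zero.2 ?_
    rw [LinearMap.add_apply, LinearMap.id_apply, AlgHom.toLinearMap_apply,
      h.negHom₂_tmul hW b hl hl', LinearMap.id_apply]
    rcases Nat.even_or_odd (j + k) with hjk | hjk
    · have hi : Odd i := by
        rw [← hijk, add_assoc] at hn
        exact (Nat.odd_add.1 hn).2 hjk
      rw [hjk.neg_one_pow, one_smul, map_add, mapBase₂_tmul, LinearMap.add_apply,
        LinearMap.comp_apply, LinearMap.comp_apply, hst i b hi hb]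
    · rw [hjk.neg_one_pow, neg_one_smul, add_neg_cancel, map_zero]
  have h2 : mapBase₂ 𝓑 𝓦 (dB ∘ₗ s + t ∘ₗ dB) (z + h.negHom₂.hom z) = z + h.negHom₂.hom z :=
    sub_eq_zero.1 (key hz)
  have h1 : z + h.negHom₂.hom z ∈ LinearMap.range h.m₂.d := by
    refine ⟨mapBase₂ 𝓑 𝓦 s (z + h.negHom₂.hom z), ?_⟩
    rwa [mapBase₂_add, mapBase₂_comp, mapBase₂_comp, ← hFd, map_add h.m₂.d, ← h.negHom₂.map_d,
      hdz, map_zero, add_zero, map_zero, add_zero] at h2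
  have h3 := h.cong_negHom₂.pow 2 z hzI
  rw [DGHom.id_apply] at h3
  -- The first summand is exact. The second lies in `I³`, because `negHom₂` is the identity on `I² /
  -- I³`.
  have h4 : z = (2 : ℚ)⁻¹ • (z + h.negHom₂.hom z) +
      (-(2 : ℚ)⁻¹) • (h.negHom₂.hom z - (-1 : ℚ) ^ 2 • z) := by
    match_scalars <;> norm_num
  rw [h4]
  exact Submodule.add_mem_sup (Submodule.smul_mem _ _ h1) (Submodule.smul_mem _ _ h3)

/-- The statement is transported along `φ ⊗ φ` from the trivial differential, where it was proved
with the contraction of `B`. -/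
theorem mem_bdry_three (h : IsModelDiff 𝓑 𝓦 dB D)
    (h' : IsModelDiff 𝓑 𝓦 dB (trivialDiff 𝓑 𝓦 dB)) {φ : DGHom h'.m₁ h.m₁}
    (hφ : Function.Bijective φ.hom)
    (hW : ∀ n, Even n → 𝓦 n = ⊥) (hH : HasZeroOddCohomology 𝓑 dB) {n : ℕ} (hn : Odd n)
    {z : Model₂ 𝓑 𝓦} (hz : z ∈ gr₂ 𝓑 𝓦 n) (hdz : diff₂ 𝓑 𝓦 D z = 0)
    (hzI : z ∈ h.m₂.ideal ^ 2) : z ∈ h.m₂.bdry 3 := by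
  set ψ := φ.symm hφ
  set φ₂ : DGHom h'.m₂ h.m₂ := h'.pair (h.fst.comp φ) (h.snd.comp φ)
  set ψ₂ : DGHom h.m₂ h'.m₂ := h.pair (h'.fst.comp ψ) (h'.snd.comp ψ)
  have hφψ : φ₂.hom (ψ₂.hom z) = z :=
    h.hom_ext₂ (f := φ₂.comp ψ₂) (g := DGHom.id _)
      (fun x => by
        rw [DGHom.comp_apply, pair_fst, DGHom.comp_apply, pair_fst, DGHom.comp_apply,
          DGHom.hom_symm, DGHom.id_apply])
      (fun x => by
        rw [DGHom.comp_apply, pair_snd, DGHom.comp_apply, pair_snd, DGHom.comp_apply,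
          DGHom.hom_symm, DGHom.id_apply]) z
  rw [← hφψ]
  refine φ₂.mem_bdry (mem_bdry_three_of_trivial hW hH hn (ψ₂.map_mem _ _ hz) ?_
    (ψ₂.mem_ideal_pow hzI))
  refine (ψ₂.map_d z).symm.trans ?_
  have hdz' : h.m₂.d z = 0 := hdz
  rw [hdz', map_zero]

/-- A homotopy associative multiplication is primitive modulo coboundaries on closed odd
eigenvectors of its square. -/
theorem sub_mem_bdry (h : IsModelDiff 𝓑 𝓦 dB D)
    (h' : IsModelDiff 𝓑 𝓦 dB (trivialDiff 𝓑 𝓦 dB)) {φ : DGHom h'.m₁ h.m₁}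
    (hφ : Function.Bijective φ.hom)
    (hW : ∀ n, Even n → 𝓦 n = ⊥) (hH : HasZeroOddCohomology 𝓑 dB) {C : DGHom h.m₁ h.m₂}
    (hC : h.IsUnital C) {n : ℕ} (hn : Odd n) {x : Model₁ 𝓑 𝓦} (hx : x ∈ gr₁ 𝓑 𝓦 n)
    (hDx : D x = 0) (hxI : x ∈ h.m₁.ideal) (hPx : (h.sq C).hom x = (2 : ℚ) • x)
    (hass : (h.left C).hom (C.hom x) - (h.right C).hom (C.hom x) ∈ LinearMap.range h.m₃.d)
    (r : ℕ) : C.hom x - (h.fst.hom x + h.snd.hom x) ∈ h.m₂.bdry (r + 3) := by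
  have hDx' : h.m₁.d x = 0 := hDx
  induction r with
  | zero =>
    refine h.mem_bdry_three h' hφ hW hH hn ?_ ?_ (hC x hxI)
    · exact Submodule.sub_mem _ (C.map_mem _ _ hx)
        (Submodule.add_mem _ (h.fst.map_mem _ _ hx) (h.snd.map_mem _ _ hx))
    · change h.m₂.d _ = 0
      rw [map_sub, map_add, ← C.map_d, ← h.fst.map_d, ← h.snd.map_d, hDx', map_zero, map_zero,
        map_zero, add_zero, sub_zero]
  | succ r ih =>
    obtain ⟨_, ⟨θ, rfl⟩, ρ, hρ, e⟩ := Submodule.mem_sup.1 ih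
    have hρe : ρ = C.hom x - (h.fst.hom x + h.snd.hom x) - h.m₂.d θ := by
      rw [← e, add_sub_cancel_left]
    have key : ρ ∈ h.m₂.bdry (r + 3 + 1) := by
      refine mem_bdry_of_cocycle hC (by omega) hρ (Submodule.mem_sup_left ?_)
        (Submodule.mem_sup_left ?_)
      -- The cocycle combination of `x + x'` cancels identically, that of `C x` is the exact
      -- associator, and that of `d θ` is exact.
      · obtain ⟨y, hy⟩ := hass
        refine ⟨y - (h.in₁₂.hom θ + (h.left C).hom θ - ((h.right C).hom θ + h.in₂₃.hom θ)), ?_⟩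
        rw [hρe]
        simp only [map_sub, map_add, hy, DGHom.map_d, left_fst, left_snd, right_fst, right_snd,
          in₁₂_snd]
        abel
      -- Multiplication sends `C x - x - x'` to `P x - 2 x = 0`, so on `ρ` only the image of `-d θ`
      -- is left.
      · refine ⟨-(h.pair (DGHom.id _) (DGHom.id _)).hom θ, ?_⟩
        have e2 : (h.pair (DGHom.id _) (DGHom.id _)).hom (C.hom x) = (2 : ℚ) • x := hPx
        rw [hρe, map_sub, map_sub, map_add, pair_fst, pair_snd, DGHom.map_d, e2, map_neg,
          DGHom.id_apply, two_smul, sub_self, zero_sub]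
    rw [← e]
    exact Submodule.add_mem _ (Submodule.mem_sup_left ⟨θ, rfl⟩) key

/-- A coboundary modulo a high enough power is a genuine coboundary: for `r = n` the remainder lies
in `I ^ (n + 3)`, which has nothing in degree `n + 1`. The primitive is then corrected by its base
part so that it lies in the ideal, as a homotopy over `B` requires. -/
theorem exists_primitive_homotopy (h : IsModelDiff 𝓑 𝓦 dB D) {C : DGHom h.m₁ h.m₂} {n : ℕ}
    {x : Model₁ 𝓑 𝓦} (hx : x ∈ gr₁ 𝓑 𝓦 (n + 1)) (hxI : x ∈ h.m₁.ideal)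
    (hr : ∀ r, C.hom x - (h.fst.hom x + h.snd.hom x) ∈ h.m₂.bdry (r + 3)) :
    ∃ θ ∈ gr₂ 𝓑 𝓦 n, θ ∈ h.m₂.ideal ∧
      h.m₂.d θ = h.fst.hom x + h.snd.hom x - C.hom x := by
  obtain ⟨_, ⟨θ, rfl⟩, ρ, hρ, e⟩ := Submodule.mem_sup.1 (hr n)
  set z := C.hom x - (h.fst.hom x + h.snd.hom x)
  have hz : z ∈ gr₂ 𝓑 𝓦 (n + 1) := Submodule.sub_mem _ (C.map_mem _ _ hx)
    (Submodule.add_mem _ (h.fst.map_mem _ _ hx) (h.snd.map_mem _ _ hx))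
  have hzI : z ∈ h.m₂.ideal := Submodule.sub_mem _ (C.mem_ideal hxI)
    (Submodule.add_mem _ (h.fst.mem_ideal hxI) (h.snd.mem_ideal hxI))
  obtain ⟨η, hη, hdη⟩ : ∃ η ∈ gr₂ 𝓑 𝓦 n, h.m₂.d η = z := by
    refine ⟨DirectSum.decompose (gr₂ 𝓑 𝓦) θ n, SetLike.coe_mem _, ?_⟩
    rw [← DirectSum.decompose_of_mem_same (gr₂ 𝓑 𝓦) hz, ← e, DirectSum.decompose_add,
      DirectSum.add_apply, Submodule.coe_add,
      DGOver.decompose_eq_zero_of_mem_pow hρ (by omega), add_zero]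
    exact (decompose_map (gr₂ 𝓑 𝓦) (gr₂ 𝓑 𝓦) 1 h.m₂.d h.m₂.isOddDerivation.map_mem θ n).symm
  refine ⟨-(η - h.m₂.base (h.m₂.proj η)), ?_, ?_, ?_⟩
  · exact Submodule.neg_mem _ (Submodule.sub_mem _ hη
      (h.m₂.base_mem _ _ (h.m₂.proj_mem _ _ hη)))
  · exact Submodule.neg_mem _ (h.m₂.sub_base_proj_mem η)
  · rw [map_neg, map_sub, h.m₂.d_base, ← h.m₂.proj_d, hdη, h.m₂.mem_ideal.1 hzI, map_zero,
      sub_zero, neg_sub]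

end IsModelDiff

end OddCocycle

/-! ## Homotopies given on generators -/

namespace LambdaT

theorem gr_comm : IsGradedCommutative gr := by
  intro i j x y hx hy
  match i, j, hx, hy with
  | 0, j, hx, hy => rw [zero_mul, pow_zero, one_smul, mul_comm]
  | i, 0, hx, hy => rw [mul_zero, pow_zero, one_smul, mul_comm]
  | 1, 1, hx, hy =>
    rw [mem_gr_one] at hx hy
    have h1 : x * y = 0 := by ext <;> simp [hx, hy]
    have h2 : y * x = 0 := by rw [mul_comm, h1]
    rw [h1, h2, smul_zero]
  | i + 2, j, hx, hy => rw [mem_gr_add_two] at hx; simp [hx]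
  | i, j + 2, hx, hy => rw [mem_gr_add_two] at hy; simp [hy]

theorem d_mem {n : ℕ} {x : LambdaT} (hx : x ∈ gr n) : d x ∈ gr (n + 1) := by
  match n, hx with
  | 0, hx => exact TrivSqZeroExt.fst_inr _ _
  | 1, hx =>
    rw [mem_gr_one] at hx
    rw [show 1 + 1 = 0 + 2 from rfl, mem_gr_add_two]
    change TrivSqZeroExt.inr (Polynomial.derivative x.fst) = 0
    rw [hx]; simp
  | n + 2, hx => rw [mem_gr_add_two] at hx; rw [hx, map_zero]; exact Submodule.zero_mem _

theorem d_mul {n : ℕ} {x : LambdaT} (hx : x ∈ gr n) (y : LambdaT) :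
    d (x * y) = d x * y + (-1 : ℚ) ^ n • (x * d y) := by
  have key : d (x * y) = d x * y + x * d y := by
    change TrivSqZeroExt.inr (Polynomial.derivative (x * y).fst) =
      TrivSqZeroExt.inr (Polynomial.derivative x.fst) * y +
        x * TrivSqZeroExt.inr (Polynomial.derivative y.fst)
    ext
    · simp
    · simp [Polynomial.derivative_mul, mul_comm]
  have h0 : n ≠ 0 → x * d y = 0 := by
    intro hn
    match n, hx with
    | 0, hx => exact absurd rfl hn
    | 1, hx =>
      rw [mem_gr_one] at hx
      change x * TrivSqZeroExt.inr (Polynomial.derivative y.fst) = 0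
      ext <;> simp [hx]
    | n + 2, hx => rw [mem_gr_add_two] at hx; rw [hx, zero_mul]
  rw [key]
  rcases eq_or_ne n 0 with rfl | hn
  · rw [pow_zero, one_smul]
  · rw [h0 hn, smul_zero]

theorem d_d (x : LambdaT) : d (d x) = 0 := by
  change TrivSqZeroExt.inr (Polynomial.derivative (TrivSqZeroExt.inr _ : LambdaT).fst) = _
  simp

theorem d_one : d 1 = 0 := by
  change TrivSqZeroExt.inr (Polynomial.derivative (1 : LambdaT).fst) = _
  simp

/-- The evaluation `Λ(t, dt) → ℚ` as an algebra map. -/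
def evHom (c : ℚ) : LambdaT →ₐ[ℚ] ℚ :=
  (Polynomial.aeval c).comp (TrivSqZeroExt.fstHom ℚ ℚ[X] ℚ[X])

theorem evHom_apply (c : ℚ) (x : LambdaT) : evHom c x = ev c x :=
  congrFun (Polynomial.coe_aeval_eq_eval c) x.fst

theorem evHom_of_mem (c : ℚ) (j : ℕ) (hj : j ≠ 0) (x : LambdaT) (hx : x ∈ gr j) :
    evHom c x = 0 := by
  rw [evHom_apply]
  match j, hx with
  | 0, hx => exact absurd rfl hj
  | 1, hx => exact (congrArg (Polynomial.eval c) (mem_gr_one.1 hx)).trans Polynomial.eval_zero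
  | n + 2, hx => rw [mem_gr_add_two] at hx; rw [hx, map_zero]

/-- The generator `t`. -/
def t : LambdaT := TrivSqZeroExt.inl Polynomial.X

theorem t_mem : t ∈ gr 0 := TrivSqZeroExt.snd_inl _ _

theorem ev_t (c : ℚ) : ev c t = c := Polynomial.eval_X

theorem ev_d (c : ℚ) (x : LambdaT) : ev c (d x) = 0 := Polynomial.eval_zero

theorem ev_one (c : ℚ) : ev c 1 = 1 := Polynomial.eval_one

end LambdaT

/-! ### The path object `E ⊗ Λ(t, dt)` and homotopies out of `d_B ⊗ 1`. -/

section Path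

variable {E : Type w} [Ring E] [Algebra ℚ E] {𝓔 : ℕ → Submodule ℚ E} [GradedAlgebra 𝓔]

theorem pathDiff_tmul (dE : E →ₗ[ℚ] E) (a : E) (u : LambdaT) :
    pathDiff 𝓔 dE (a ᵍ⊗ₜ[ℚ] u) = dE a ᵍ⊗ₜ[ℚ] u + signInv 𝓔 a ᵍ⊗ₜ[ℚ] LambdaT.d u := rfl

theorem isOddDerivation_pathDiff (hE : IsGradedCommutative 𝓔) {dE : E →ₗ[ℚ] E}
    (hd : IsOddDerivation 𝓔 dE) : IsOddDerivation (tensorGr 𝓔 LambdaT.gr) (pathDiff 𝓔 dE) := by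
  have e : pathDiff 𝓔 dE = tensorDiff 𝓔 LambdaT.gr dE
      ((GradedTensorProduct.includeRight 𝓔 LambdaT.gr).toLinearMap ∘ₗ LambdaT.d) := by
    refine tensor_hom_ext fun i j a u _ _ => ?_
    rw [pathDiff_tmul, tensorDiff, LinearMap.add_apply, mapLeft_tmul, mulExt_tmul]
    congr 1
    exact tmul_eq_mul _ _ _ _
  rw [e]
  refine isOddDerivation_tensorDiff hE LambdaT.gr_comm hd (fun j u hu => ?_) fun j u u' hu => ?_
  · exact inr_mem_tensorGr (LambdaT.d_mem hu)
  · change GradedTensorProduct.includeRight 𝓔 LambdaT.gr _ =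
      GradedTensorProduct.includeRight 𝓔 LambdaT.gr _ *
        GradedTensorProduct.includeRight 𝓔 LambdaT.gr _ +
      _ • (GradedTensorProduct.includeRight 𝓔 LambdaT.gr _ *
        GradedTensorProduct.includeRight 𝓔 LambdaT.gr _)
    rw [← map_mul, ← map_mul, ← map_smul, ← map_add, LambdaT.d_mul hu]

theorem pathDiff_pathDiff_tmul_t {dE : E →ₗ[ℚ] E} (hd : IsOddDerivation 𝓔 dE) {a : E}
    (ha : dE (dE a) = 0) : pathDiff 𝓔 dE (pathDiff 𝓔 dE (a ᵍ⊗ₜ[ℚ] LambdaT.t)) = 0 := by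
  rw [pathDiff_tmul, map_add, pathDiff_tmul, pathDiff_tmul, ha, zero_tmul, zero_add,
    LambdaT.d_d, tmul_zero, add_zero, ← add_tmul, hd.map_signInv, add_neg_cancel, zero_tmul]

variable {B : Type u} [Ring B] [Algebra ℚ B] {𝓑 : ℕ → Submodule ℚ B} [GradedAlgebra 𝓑]
variable {W : Type v} [AddCommGroup W] [Module ℚ W] {𝓦 : ℕ → Submodule ℚ W}
  [DirectSum.Decomposition 𝓦]
variable {dB : B →ₗ[ℚ] B} {Y : DGOver 𝓑 dB 𝓔}

theorem algHom_ext_basis {R : Type*} [Ring R] [Algebra ℚ R] {I : Type*}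
    (e : Module.Basis I ℚ W) {p q : Model₁ 𝓑 𝓦 →ₐ[ℚ] R}
    (h₁ : ∀ b, p (inl 𝓑 𝓦 b) = q (inl 𝓑 𝓦 b))
    (h₂ : ∀ i, p (gen 𝓑 𝓦 (e i)) = q (gen 𝓑 𝓦 (e i))) (x : Model₁ 𝓑 𝓦) : p x = q x := by
  have h₃ : p.toLinearMap ∘ₗ gen 𝓑 𝓦 = q.toLinearMap ∘ₗ gen 𝓑 𝓦 := e.ext h₂
  exact DFunLike.congr_fun (freeExt_algHom_ext h₁ fun y => LinearMap.congr_fun h₃ y) x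

/-- The evaluation `E ⊗ Λ(t, dt) → E` at `t = c`. -/
def pathEv (𝓔 : ℕ → Submodule ℚ E) [GradedAlgebra 𝓔] (c : ℚ) : (𝓔 ᵍ⊗[ℚ] LambdaT.gr) →ₐ[ℚ] E :=
  contractHom (LambdaT.evHom c) (LambdaT.evHom_of_mem c) (AlgHom.id ℚ E)

theorem pathEv_tmul (c : ℚ) (a : E) (u : LambdaT) :
    pathEv 𝓔 c (a ᵍ⊗ₜ[ℚ] u) = LambdaT.ev c u • a := by
  rw [pathEv, contractHom_tmul, LambdaT.evHom_apply]; rfl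

theorem pathEv_apply (c : ℚ) (z : 𝓔 ᵍ⊗[ℚ] LambdaT.gr) :
    pathEv 𝓔 c z = contract 𝓔 LambdaT.gr (LambdaT.ev c) LinearMap.id z :=
  LinearMap.congr_fun (f := (pathEv 𝓔 c).toLinearMap)
    (g := contract 𝓔 LambdaT.gr (LambdaT.ev c) LinearMap.id)
    (tensor_hom_ext fun _ _ a u _ _ => pathEv_tmul (𝓔 := 𝓔) c a u) z

variable (Y) in
/-- The projection `E ⊗ Λ(t, dt) → B ⊗ Λ(t, dt)`. -/
def pathProj (hB : IsGradedCommutative 𝓑) : (𝓔 ᵍ⊗[ℚ] LambdaT.gr) →ₐ[ℚ] (𝓑 ᵍ⊗[ℚ] LambdaT.gr) :=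
  grExtHom (hB.tensor LambdaT.gr_comm)
    ((GradedTensorProduct.includeLeft 𝓑 LambdaT.gr).comp Y.proj)
    (GradedTensorProduct.includeRight 𝓑 LambdaT.gr)
    (fun n x hx => inl_mem_tensorGr (Y.proj_mem n x hx)) (fun _ _ hu => inr_mem_tensorGr hu)

theorem pathProj_tmul (hB : IsGradedCommutative 𝓑) (a : E) (u : LambdaT) :
    pathProj Y hB (a ᵍ⊗ₜ[ℚ] u) = Y.proj a ᵍ⊗ₜ[ℚ] u := (tmul_eq_mul _ _ _ _).symm

theorem pathProj_apply (hB : IsGradedCommutative 𝓑) (z : 𝓔 ᵍ⊗[ℚ] LambdaT.gr) :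
    pathProj Y hB z = mapLeft 𝓔 𝓑 LambdaT.gr Y.proj.toLinearMap z :=
  LinearMap.congr_fun (f := (pathProj Y hB).toLinearMap)
    (g := mapLeft 𝓔 𝓑 LambdaT.gr Y.proj.toLinearMap)
    (tensor_hom_ext fun _ _ a u _ _ => pathProj_tmul (Y := Y) hB a u) z

variable (Y) in
/-- The element `a ⊗ 1 + d(θ ⊗ t)` of `E ⊗ Λ(t, dt)`. -/
def pathElt (a θ : E) : 𝓔 ᵍ⊗[ℚ] LambdaT.gr :=
  a ᵍ⊗ₜ[ℚ] (1 : LambdaT) + pathDiff 𝓔 Y.d (θ ᵍ⊗ₜ[ℚ] LambdaT.t)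

theorem pathElt_mem {a θ : E} {n : ℕ} (ha : a ∈ 𝓔 (n + 1)) (hθ : θ ∈ 𝓔 n) :
    pathElt Y a θ ∈ tensorGr 𝓔 LambdaT.gr (n + 1) := by
  have h1 : a ᵍ⊗ₜ[ℚ] (1 : LambdaT) ∈ tensorGr 𝓔 LambdaT.gr (n + 1) := inl_mem_tensorGr ha
  have h2 : θ ᵍ⊗ₜ[ℚ] LambdaT.t ∈ tensorGr 𝓔 LambdaT.gr (n + 0) :=
    tmul_mem_tensorGr hθ LambdaT.t_mem
  rw [add_zero] at h2
  exact Submodule.add_mem _ h1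
    ((isOddDerivation_pathDiff Y.comm Y.isOddDerivation).map_mem n _ h2)

theorem pathDiff_pathElt {a θ : E} (ha : Y.d a = 0) (hθ : Y.d (Y.d θ) = 0) :
    pathDiff 𝓔 Y.d (pathElt Y a θ) = 0 := by
  rw [pathElt, map_add, pathDiff_pathDiff_tmul_t Y.isOddDerivation hθ, pathDiff_tmul, ha,
    zero_tmul, LambdaT.d_one, tmul_zero, add_zero, add_zero]

theorem pathEv_pathElt (c : ℚ) (a θ : E) : pathEv 𝓔 c (pathElt Y a θ) = a + c • Y.d θ := by
  rw [pathElt, map_add, pathDiff_tmul, map_add, pathEv_tmul, pathEv_tmul, pathEv_tmul,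
    LambdaT.ev_one, LambdaT.ev_t, LambdaT.ev_d, one_smul, zero_smul, add_zero]

theorem pathProj_pathElt (hB : IsGradedCommutative 𝓑) {a θ : E} (ha : a ∈ Y.ideal)
    (hθ : θ ∈ Y.ideal) : pathProj Y hB (pathElt Y a θ) = 0 := by
  rw [pathElt, map_add, pathDiff_tmul, map_add, pathProj_tmul, pathProj_tmul, pathProj_tmul,
    Y.mem_ideal.1 ha, Y.mem_ideal.1 (DGOver.d_mem_ideal hθ),
    Y.mem_ideal.1 (DGOver.signInv_mem_ideal hθ), zero_tmul, zero_tmul, zero_tmul, add_zero,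
    add_zero]

/-- Two maps out of `(B ⊗ ΛW, d_B ⊗ 1)` which differ by coboundaries on a basis of `W` are
homotopic. -/
theorem homotopicUnderOver_of_basis (h : IsModelDiff 𝓑 𝓦 dB (trivialDiff 𝓑 𝓦 dB))
    (f₀ f₁ : DGHom h.m₁ Y) {I : Type*} (e : Module.Basis I ℚ W) {n : I → ℕ}
    (he : ∀ i, e i ∈ 𝓦 (n i + 1)) {θ : I → E} (hθ : ∀ i, θ i ∈ 𝓔 (n i))
    (hθI : ∀ i, θ i ∈ Y.ideal)
    (hdθ : ∀ i, Y.d (θ i) = f₁.hom (gen 𝓑 𝓦 (e i)) - f₀.hom (gen 𝓑 𝓦 (e i))) :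
    HomotopicUnderOver 𝓑 (gr₁ 𝓑 𝓦) 𝓔 (trivialDiff 𝓑 𝓦 dB) (base₁ 𝓑 𝓦) (proj₁ 𝓑 𝓦)
      Y.d Y.base.toLinearMap Y.proj.toLinearMap f₀.hom.toLinearMap f₁.hom.toLinearMap := by
  have hd1 := h.isOddDerivation_base.map_one
  have hclosed : ∀ (f : DGHom h.m₁ Y) x, Y.d (f.hom (gen 𝓑 𝓦 x)) = 0 := fun f x => by
    rw [← f.map_d]
    exact (congrArg f.hom (trivialDiff_gen hd1 x)).trans (map_zero _)
  -- Generators are closed in the source, so `H` may send them to any closed elements. Adding `d (θ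
  -- i ⊗ t)` keeps the value closed and interpolates between `f₀` at `t = 0` and `f₀ + d (θ i) = f₁`
  -- at `t = 1`.
  set u : I → 𝓔 ᵍ⊗[ℚ] LambdaT.gr := fun i => pathElt Y (f₀.hom (gen 𝓑 𝓦 (e i))) (θ i) with hu
  have hdu : ∀ i, pathDiff 𝓔 Y.d (u i) = 0 := fun i =>
    pathDiff_pathElt (hclosed _ _) (by rw [hdθ, map_sub, hclosed, hclosed, sub_zero])
  have hg : ∀ n x, x ∈ 𝓦 n → e.constr ℚ u x ∈ tensorGr 𝓔 LambdaT.gr n :=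
    constr_mem e he fun i => pathElt_mem (f₀.map_mem _ _ (gen_mem (he i))) (hθ i)
  have hdg : ∀ x, pathDiff 𝓔 Y.d (e.constr ℚ u x) = 0 := by
    have : pathDiff 𝓔 Y.d ∘ₗ e.constr ℚ u = 0 := e.ext fun i => by
      rw [LinearMap.comp_apply, Module.Basis.constr_basis, hdu]; rfl
    exact fun x => LinearMap.congr_fun this x
  obtain ⟨H, hHmem, hHb, hHg⟩ : ∃ H : Model₁ 𝓑 𝓦 →ₐ[ℚ] (𝓔 ᵍ⊗[ℚ] LambdaT.gr),
      (∀ n x, x ∈ gr₁ 𝓑 𝓦 n → H x ∈ tensorGr 𝓔 LambdaT.gr n) ∧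
      (∀ b, H (inl 𝓑 𝓦 b) = Y.base b ᵍ⊗ₜ[ℚ] (1 : LambdaT)) ∧
      ∀ x, H (gen 𝓑 𝓦 x) = e.constr ℚ u x :=
    ⟨_, baseGenHom_mem (Y.comm.tensor LambdaT.gr_comm)
      ((GradedTensorProduct.includeLeft 𝓔 LambdaT.gr).comp Y.base)
      (fun n b hb => inl_mem_tensorGr (Y.base_mem n b hb)) (e.constr ℚ u) hg,
      baseGenHom_inl _ _ _ _ _, baseGenHom_gen _ _ _ _ _⟩
  have hHe : ∀ i, H (gen 𝓑 𝓦 (e i)) = u i := fun i =>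
    (hHg _).trans (Module.Basis.constr_basis _ _ _ _)
  have hev : ∀ c (f : DGHom h.m₁ Y), (∀ i, f₀.hom (gen 𝓑 𝓦 (e i)) + c • Y.d (θ i) =
      f.hom (gen 𝓑 𝓦 (e i))) → ∀ x,
        contract 𝓔 LambdaT.gr (LambdaT.ev c) LinearMap.id (H x) = f.hom x := by
    intro c f hf x
    rw [← pathEv_apply]
    refine algHom_ext_basis e (p := (pathEv 𝓔 c).comp H) (fun b => ?_) (fun i => ?_) x
    · rw [AlgHom.comp_apply, hHb, pathEv_tmul, LambdaT.ev_one, one_smul]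
      exact (f.map_base b).symm
    · rw [AlgHom.comp_apply, hHe, hu, pathEv_pathElt, hf]
  refine ⟨H.toLinearMap, ⟨map_one H, map_mul H, hHmem, ?_⟩, hHb, fun x => ?_,
    hev 0 f₀ fun i => by rw [zero_smul, add_zero],
    hev 1 f₁ fun i => by rw [hdθ, one_smul, add_sub_cancel]⟩
  · refine freeExt_map_d h.isOddDerivation (isOddDerivation_pathDiff Y.comm Y.isOddDerivation) H
      hHmem (fun b => ?_) fun _ x _ => ?_
    · have : trivialDiff 𝓑 𝓦 dB (inl 𝓑 𝓦 b) = inl 𝓑 𝓦 (dB b) := rfl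
      rw [this, hHb, hHb, pathDiff_tmul, LambdaT.d_one, tmul_zero, add_zero, Y.d_base]
    · rw [trivialDiff_gen hd1, map_zero, hHg, hdg]
  · refine (pathProj_apply h.comm _).symm.trans ?_
    refine algHom_ext_basis e (p := (pathProj Y h.comm).comp H)
      (q := (GradedTensorProduct.includeLeft 𝓑 LambdaT.gr).comp h.m₁.proj) (fun b => ?_)
      (fun i => ?_) x |>.trans ?_
    · rw [AlgHom.comp_apply, hHb, pathProj_tmul, Y.proj_base, AlgHom.comp_apply]
      exact congrArg (GradedTensorProduct.includeLeft 𝓑 LambdaT.gr) (h.m₁.proj_base b).symm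
    · rw [AlgHom.comp_apply, hHe, hu, pathProj_pathElt _ (f₀.mem_ideal (h.gen_mem_ideal _)) (hθI i),
        AlgHom.comp_apply, h.m₁.mem_ideal.1 (h.gen_mem_ideal _), map_zero]
    · rw [proj₁_eq]; rfl

end Path

/-! ## The standard multiplication -/

section Standard

variable {B : Type u} [Ring B] [Algebra ℚ B] {𝓑 : ℕ → Submodule ℚ B} [GradedAlgebra 𝓑]
variable {W : Type v} [AddCommGroup W] [Module ℚ W] {𝓦 : ℕ → Submodule ℚ W}
  [DirectSum.Decomposition 𝓦]
variable {dB : B →ₗ[ℚ] B} {D : Model₁ 𝓑 𝓦 →ₗ[ℚ] Model₁ 𝓑 𝓦}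

namespace IsModelDiff

variable (h : IsModelDiff 𝓑 𝓦 dB (trivialDiff 𝓑 𝓦 dB))

theorem d_genFst (x : W) : h.m₂.d (genFst 𝓑 𝓦 x) = 0 := by
  have := h.fst.map_d (gen 𝓑 𝓦 x)
  have e : h.m₁.d (gen 𝓑 𝓦 x) = 0 := trivialDiff_gen h.isOddDerivation_base.map_one x
  rw [e, map_zero] at this
  exact this.symm

theorem d_genSnd (x : W) : h.m₂.d (genSnd 𝓑 𝓦 x) = 0 := by
  have := h.snd.map_d (gen 𝓑 𝓦 x)
  have e : h.m₁.d (gen 𝓑 𝓦 x) = 0 := trivialDiff_gen h.isOddDerivation_base.map_one x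
  rw [e, map_zero, h.snd_hom] at this
  exact this.symm

theorem genFst_mem_ideal (x : W) : genFst 𝓑 𝓦 x ∈ h.m₂.ideal :=
  h.fst.mem_ideal (h.gen_mem_ideal x)

theorem genSnd_mem_ideal (x : W) : genSnd 𝓑 𝓦 x ∈ h.m₂.ideal := by
  have := h.snd.mem_ideal (h.gen_mem_ideal x)
  rwa [h.snd_hom] at this

/-- The standard multiplication as a DG map. -/
def std : DGHom h.m₁ h.m₂ :=
  h.homOfGen (genFst 𝓑 𝓦 + genSnd 𝓑 𝓦)
    (fun n x hx => by
      have := h.snd.map_mem n _ (gen_mem hx)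
      rw [h.snd_hom] at this
      exact Submodule.add_mem _ (h.fst.map_mem n _ (gen_mem hx)) this)
    (fun x => h.m₂.mem_ideal.1
      (Submodule.add_mem _ (h.genFst_mem_ideal x) (h.genSnd_mem_ideal x)))
    (fun x => by
      rw [trivialDiff_gen h.isOddDerivation_base.map_one, map_zero, LinearMap.add_apply, map_add,
        d_genFst, d_genSnd, add_zero])

theorem std_gen (x : W) : h.std.hom (gen 𝓑 𝓦 x) = genFst 𝓑 𝓦 x + genSnd 𝓑 𝓦 x :=
  h.homOfGen_gen _ _ _ _ x

theorem std_toLinearMap : h.std.hom.toLinearMap = stdMul 𝓑 𝓦 :=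
  tensor_hom_ext fun _ _ _ _ _ _ => rfl

theorem isUnital_std : h.IsUnital h.std := isUnital_of_gen fun x => by
  rw [h.std_gen, h.snd_hom, h.fst_hom, genFst, genSnd, LinearMap.comp_apply,
    LinearMap.comp_apply, sub_self]
  exact Submodule.zero_mem _

theorem isFibrewiseMultiplication_stdMul
    (hT : IsModelDiff 𝓑 𝓦 dB (trivialDiff 𝓑 𝓦 dB)) :
    IsFibrewiseMultiplication 𝓑 𝓦 (trivialDiff 𝓑 𝓦 dB) (stdMul 𝓑 𝓦) where
  isDGMap := by
    rw [← hT.std_toLinearMap]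
    exact hT.std.isDGMap
  base := stdMul_base 𝓑 𝓦
  proj x := by
    rw [← hT.std_toLinearMap, proj₂_eq, proj₁_eq]
    exact hT.std.proj_map x
  unit x := by
    rw [stdMul_gen, add_sub_cancel_left, sub_self]
    exact Submodule.zero_mem _

end IsModelDiff

/-- The unit condition on `C` is used only through this weakening, namely modulo the square of the
ideal. -/
theorem IsModelDiff.plusPlus_le (h : IsModelDiff 𝓑 𝓦 dB D) :
    plusPlus 𝓑 𝓦 ≤ h.m₂.ideal ^ 2 := by
  refine Submodule.span_le.2 ?_
  rintro _ ⟨b, l, l', hl, hl', rfl⟩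
  rw [h.tmul_eq_fst_mul_snd, pow_two]
  refine Submodule.mul_mem_mul (h.fst.mem_ideal ?_) (h.snd.mem_ideal ?_)
  · refine (projHom_tmul (𝒜 := 𝓑) (AlgHom.id ℚ B) b l).trans ?_
    rw [hl, zero_smul]
  · refine (h.proj_inr l').trans ?_
    rw [hl', zero_smul]

/-- A relative model with compatible projection gives a DG algebra under and over `B`. -/
theorem IsRelativeModel.isModelDiff (hB : IsGradedCommutative 𝓑) (hd : IsDifferential 𝓑 dB)
    (hD : IsRelativeModel 𝓑 𝓦 dB D) (hp : IsDGMap (gr₁ 𝓑 𝓦) D 𝓑 dB (proj₁ 𝓑 𝓦)) :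
    IsModelDiff 𝓑 𝓦 dB D where
  comm := hB
  pos := hD.pos
  isOddDerivation_base := hd.isOddDerivation
  isOddDerivation := hD.isDifferential.isOddDerivation
  d_base := hD.base
  proj_d := hp.map_d

/-- Homotopy associative fibrewise multiplications are standard when `B` has no odd cohomology
and `W` is concentrated in odd degrees. -/
theorem modelEquivalent_trivial (hB : IsGradedCommutative 𝓑) (hW : ∀ n, Even n → 𝓦 n = ⊥)
    {C : Model₁ 𝓑 𝓦 →ₗ[ℚ] Model₂ 𝓑 𝓦} (hd : IsDifferential 𝓑 dB)
    (hD : IsRelativeModel 𝓑 𝓦 dB D) (hp : IsDGMap (gr₁ 𝓑 𝓦) D 𝓑 dB (proj₁ 𝓑 𝓦))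
    (hC : IsFibrewiseMultiplication 𝓑 𝓦 D C) (hBf : IsFiniteType 𝓑) (hWf : IsFiniteType 𝓦)
    (hH : HasZeroOddCohomology 𝓑 dB) (hass : IsAssociative 𝓑 𝓦 D C) :
    ModelEquivalent 𝓑 𝓦 D C (trivialDiff 𝓑 𝓦 dB) (stdMul 𝓑 𝓦) := by
  have h := hD.isModelDiff hB hd hp
  have h' := isModelDiff_trivialDiff hB hD.pos hd.isOddDerivation
  set c : DGHom h.m₁ h.m₂ := DGHom.ofIsDGMap C hC.isDGMap hC.base fun x => by
    have := hC.proj x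
    rwa [proj₂_eq, proj₁_eq] at this
  have hc : h.IsUnital c := IsModelDiff.isUnital_of_gen fun x => by
    have := h.plusPlus_le (hC.unit x)
    rw [sub_sub] at this
    rw [h.snd_hom]
    exact this
  obtain ⟨I, _, _, e, he, hks⟩ := hD.ks
  -- Degrees of the generators are recorded as `n + 1` with `n` even, since the primitives `θ i`
  -- will live in degree `n`.
  have hodd : ∀ i, ∃ n, Even n ∧ e i ∈ 𝓦 (n + 1) := by
    intro i
    obtain ⟨n, hn⟩ := he i
    rcases Nat.even_or_odd n with hn' | ⟨m, rfl⟩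
    · rw [hW n hn', Submodule.mem_bot] at hn
      exact absurd hn (e.ne_zero i)
    · exact ⟨2 * m, even_two_mul m, hn⟩
  choose n hn hen using hodd
  obtain ⟨x, hx⟩ := h.exists_closed_coordinates (h.cong_sq hc) hD.isDifferential.sq_zero hH hen
    (fun i => (hn i).add_one) hks
  obtain ⟨φ, hφ, hφe⟩ := h.exists_iso h' hBf hWf e hen (fun i => (hx i).1)
    (fun i => (hx i).2.1) (fun i => (hx i).2.2.2.1) (fun i => (hx i).2.2.2.2)
  obtain ⟨K, hK, -, -, hK₀, hK₁⟩ := hass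
  -- Only this consequence of homotopy associativity is used: on closed elements the two iterated
  -- multiplications differ by a coboundary.
  have hassoc : ∀ i, (h.left c).hom (c.hom (x i)) - (h.right c).hom (c.hom (x i)) ∈
      LinearMap.range h.m₃.d := by
    intro i
    obtain ⟨y, hy⟩ := exists_d_eq_of_pathDiff_eq_zero h.m₃.isOddDerivation (z := K (x i))
      ((hK.map_d _).symm.trans (by rw [(hx i).2.1, map_zero]))
    refine ⟨-y, ?_⟩
    rw [map_neg, hy, hK₀, hK₁, neg_sub, h.left_apply, h.right_apply]
    rfl
  choose θ hθ hθI hdθ using fun i => h.exists_primitive_homotopy (C := c) (hx i).1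
    (hx i).2.2.2.1 (h.sub_mem_bdry h' hφ hW hH hc (hn i).add_one (hx i).1 (hx i).2.1
      (hx i).2.2.2.1 (hx i).2.2.1 (hassoc i))
  -- On the basis element `e i` the two maps are `C (x i)` and `x i + x i'`, whose difference is `d
  -- (θ i)`.
  have key := homotopicUnderOver_of_basis h' (c.comp φ)
    ((h'.pair (h.fst.comp φ) (h.snd.comp φ)).comp h'.std) e hen hθ hθI (fun i => by
      rw [hdθ, DGHom.comp_apply, DGHom.comp_apply, h'.std_gen, hφe, map_add]
      have e1 : genFst 𝓑 𝓦 (e i) = h'.fst.hom (gen 𝓑 𝓦 (e i)) := rfl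
      have e2 : genSnd 𝓑 𝓦 (e i) = h'.snd.hom (gen 𝓑 𝓦 (e i)) := (h'.snd_hom _).symm
      rw [e1, e2, h'.pair_fst, h'.pair_snd, DGHom.comp_apply, DGHom.comp_apply, hφe])
  refine ⟨(AlgEquiv.ofBijective φ.hom hφ).toLinearEquiv, φ.isDGMap, φ.map_base, fun z => ?_, ?_⟩
  · rw [proj₁_eq, proj₁_eq]
    exact φ.proj_map z
  · have e1 : (c.comp φ).hom.toLinearMap =
        C ∘ₗ (AlgEquiv.ofBijective φ.hom hφ).toLinearEquiv.toLinearMap := rfl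
    have e2 : ((h'.pair (h.fst.comp φ) (h.snd.comp φ)).comp h'.std).hom.toLinearMap =
        tensorSq 𝓑 𝓦 (AlgEquiv.ofBijective φ.hom hφ).toLinearEquiv.toLinearMap ∘ₗ
          stdMul 𝓑 𝓦 := by
      rw [← h'.std_toLinearMap]
      exact LinearMap.ext fun z => h'.pair_comp_apply h φ _
    have e3 : h.m₂.proj.toLinearMap = proj₂ 𝓑 𝓦 := LinearMap.ext fun z => (proj₂_eq z).symm
    rw [e1, e2, e3] at key
    exact key

end Standard

/-! ## Word length -/

namespace FreeGCA

variable {W : Type v} [AddCommGroup W] [Module ℚ W] {𝓦 : ℕ → Submodule ℚ W}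

theorem map_word {E : Type w} [Ring E] [Algebra ℚ E] {f g : FreeGCA 𝓦 →ₐ[ℚ] E} {c : ℚ}
    (hfg : ∀ x, f (ι 𝓦 x) = c • g (ι 𝓦 x)) {r : ℕ} {l : FreeGCA 𝓦} (hl : l ∈ word 𝓦 r) :
    f l = c ^ r • g l := by
  induction r generalizing l with
  | zero =>
    rw [word, pow_zero] at hl
    obtain ⟨q, rfl⟩ := Submodule.mem_one.1 hl
    rw [AlgHom.commutes, AlgHom.commutes, pow_zero, one_smul]
  | succ r ih =>
    rw [word, pow_succ] at hl
    induction hl using Submodule.mul_induction_on' with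
    | mem_mul_mem m hm n hn =>
      obtain ⟨x, rfl⟩ := hn
      rw [map_mul, map_mul, ih hm, hfg, smul_mul_smul_comm, pow_succ]
    | add x _ y _ hx hy => rw [map_add, map_add, hx, hy, smul_add]

theorem mul_mem_word {s s' : ℕ} {l l' : FreeGCA 𝓦} (hl : l ∈ word 𝓦 s) (hl' : l' ∈ word 𝓦 s') :
    l * l' ∈ word 𝓦 (s + s') := by
  rw [word, pow_add]
  exact Submodule.mul_mem_mul hl hl'

variable [DirectSum.Decomposition 𝓦]

theorem ι_mul_ι_of_odd (hW : ∀ n, Even n → 𝓦 n = ⊥) (x y : W) :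
    ι 𝓦 x * ι 𝓦 y = -(ι 𝓦 y * ι 𝓦 x) := by
  induction x using DirectSum.Decomposition.inductionOn 𝓦 with
  | zero => simp
  | add x x' hx hx' => rw [map_add, add_mul, mul_add, hx, hx', neg_add]
  | @homogeneous i x =>
    induction y using DirectSum.Decomposition.inductionOn 𝓦 with
    | zero => simp
    | add y y' hy hy' => rw [map_add, add_mul, mul_add, hy, hy', neg_add]
    | @homogeneous j y =>
      rcases Nat.even_or_odd i with hi | hi
      · have : (x : W) = 0 := by simpa [hW i hi] using x.2
        simp [this]
      rcases Nat.even_or_odd j with hj | hj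
      · have : (y : W) = 0 := by simpa [hW j hj] using y.2
        simp [this]
      rw [ι_mul_ι 𝓦 x.2 y.2, (hi.mul hj).neg_one_pow]
      exact neg_one_smul ℚ (ι 𝓦 (y : W) * ι 𝓦 (x : W))

theorem ι_mul_self_of_odd (hW : ∀ n, Even n → 𝓦 n = ⊥) (x : W) : ι 𝓦 x * ι 𝓦 x = 0 := by
  have h := ι_mul_ι_of_odd hW x x
  rw [eq_neg_iff_add_eq_zero, ← two_smul ℚ] at h
  exact (smul_eq_zero.1 h).resolve_left two_ne_zero

/-- The words of length `r` are spanned by the increasing products of basis elements. -/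
theorem word_le_span (hW : ∀ n, Even n → 𝓦 n = ⊥) {I : Type*} [LinearOrder I]
    (e : Module.Basis I ℚ W) (r : ℕ) :
    word 𝓦 r ≤ Submodule.span ℚ
      (Set.range fun J : Fin r ↪o I => (List.ofFn fun k => ι 𝓦 (e (J k))).prod) := by
  -- Elements of the odd space `W` square to zero in `ΛW`, so `Λ^r W` is the image of an exterior
  -- power, which the increasing products of a basis span.
  set f := ExteriorAlgebra.lift ℚ ⟨ι 𝓦, ι_mul_self_of_odd hW⟩
  have hf : word 𝓦 r = (⋀[ℚ]^r W).map f.toLinearMap := by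
    rw [word, Submodule.map_pow]
    congr 1
    rw [← LinearMap.range_comp]
    congr 1
    exact LinearMap.ext fun x => (ExteriorAlgebra.lift_ι_apply ℚ (ι 𝓦) _ x).symm
  rw [hf, ← exteriorPower.ιMulti_family_span_fixedDegree_of_span ℚ e.span_eq, Submodule.map_span]
  refine Submodule.span_mono ?_
  rintro _ ⟨_, ⟨s, rfl⟩, rfl⟩
  refine ⟨Set.powersetCard.ofFinEmbEquiv.symm s, ?_⟩
  change (List.ofFn fun k => ι 𝓦 (e (Set.powersetCard.ofFinEmbEquiv.symm s k))).prod =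
    f (ExteriorAlgebra.ιMulti ℚ r _)
  rw [ExteriorAlgebra.ιMulti_apply, map_list_prod, List.map_ofFn]
  congr 2
  funext k
  exact (ExteriorAlgebra.lift_ι_apply ℚ (ι 𝓦) _ _).symm

end FreeGCA

/-! ### Word length in `B ⊗ ΛW` and its eigenvalues. -/

section Words

variable {B : Type u} [Ring B] [Algebra ℚ B] {𝓑 : ℕ → Submodule ℚ B} [GradedAlgebra 𝓑]
variable {W : Type v} [AddCommGroup W] [Module ℚ W] {𝓦 : ℕ → Submodule ℚ W}
  [DirectSum.Decomposition 𝓦]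

variable (𝓑 𝓦) in
/-- The subspace `B ⊗ Λ^r W`. -/
def baseWord (r : ℕ) : Submodule ℚ (Model₁ 𝓑 𝓦) :=
  Submodule.span ℚ {z | ∃ (b : B) (l : FreeGCA 𝓦), l ∈ FreeGCA.word 𝓦 r ∧ z = b ᵍ⊗ₜ[ℚ] l}

theorem exists_finsupp_of_mem_baseWord (hW : ∀ n, Even n → 𝓦 n = ⊥) {I : Type*} [LinearOrder I]
    (e : Module.Basis I ℚ W) {r : ℕ} {z : Model₁ 𝓑 𝓦} (hz : z ∈ baseWord 𝓑 𝓦 r) :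
    ∃ b : (Fin r ↪o I) →₀ B, z = b.sum fun J c =>
      c ᵍ⊗ₜ[ℚ] (List.ofFn fun k => FreeGCA.ι 𝓦 (e (J k))).prod := by
  set Φ : ((Fin r ↪o I) →₀ B) →ₗ[ℚ] Model₁ 𝓑 𝓦 := Finsupp.lsum ℚ fun J =>
    (tmk 𝓑 (FreeGCA.gr 𝓦)).flip (List.ofFn fun k => FreeGCA.ι 𝓦 (e (J k))).prod
  have key : baseWord 𝓑 𝓦 r ≤ LinearMap.range Φ := by
    refine Submodule.span_le.2 ?_
    rintro _ ⟨b, l, hl, rfl⟩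
    have : FreeGCA.word 𝓦 r ≤ (LinearMap.range Φ).comap (tmk 𝓑 (FreeGCA.gr 𝓦) b) := by
      refine (FreeGCA.word_le_span hW e r).trans (Submodule.span_le.2 ?_)
      rintro _ ⟨J, rfl⟩
      refine ⟨Finsupp.single J b, ?_⟩
      rw [Finsupp.lsum_single]
      rfl
    exact this hl
  obtain ⟨b, rfl⟩ := key hz
  exact ⟨b, rfl⟩

namespace IsModelDiff

variable {dB : B →ₗ[ℚ] B} {D : Model₁ 𝓑 𝓦 →ₗ[ℚ] Model₁ 𝓑 𝓦} (h : IsModelDiff 𝓑 𝓦 dB D)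
variable {E : Type w} [Ring E] [Algebra ℚ E] {𝓔 : ℕ → Submodule ℚ E} [GradedAlgebra 𝓔]
variable {Y : DGOver 𝓑 dB 𝓔}

theorem hom_tmul (f : DGHom h.m₁ Y) (b : B) (l : FreeGCA 𝓦) :
    f.hom (b ᵍ⊗ₜ[ℚ] l) = Y.base b * f.hom (inr 𝓑 𝓦 l) := by
  rw [h.tmul_eq_base_mul, map_mul, f.map_base]

/-- Scaling the generators by `c` scales words of length `r` by `c ^ r` exactly, not just modulo
higher powers of the ideal. -/
theorem hom_baseWord {f g : DGHom h.m₁ Y} {c : ℚ}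
    (hfg : ∀ x, f.hom (gen 𝓑 𝓦 x) = c • g.hom (gen 𝓑 𝓦 x)) {r : ℕ} {z : Model₁ 𝓑 𝓦}
    (hz : z ∈ baseWord 𝓑 𝓦 r) : f.hom z = c ^ r • g.hom z := by
  induction hz using Submodule.span_induction with
  | mem z hz =>
    obtain ⟨b, l, hl, rfl⟩ := hz
    have := FreeGCA.map_word
      (f := f.hom.comp (GradedTensorProduct.includeRight 𝓑 (FreeGCA.gr 𝓦)))
      (g := g.hom.comp (GradedTensorProduct.includeRight 𝓑 (FreeGCA.gr 𝓦))) hfg hl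
    rw [h.hom_tmul, h.hom_tmul, ← mul_smul_comm]
    exact congrArg _ this
  | zero => simp
  | add x y _ _ hx hy => rw [map_add, map_add, hx, hy, smul_add]
  | smul q x _ hx => rw [map_smul, map_smul, hx, smul_comm]

theorem baseWord_le {r : ℕ} (hr : 1 ≤ r) : baseWord 𝓑 𝓦 r ≤ h.m₁.ideal ^ r := by
  refine Submodule.span_le.2 ?_
  rintro _ ⟨b, l, hl, rfl⟩
  rw [h.tmul_eq_base_mul]
  obtain ⟨r, rfl⟩ := Nat.exists_eq_add_of_le' hr
  refine DGOver.mul_mem_ideal_pow (X := h.m₁) _ ?_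
  have key : (FreeGCA.word 𝓦 (r + 1)).map
      (GradedTensorProduct.includeRight 𝓑 (FreeGCA.gr 𝓦)).toLinearMap ≤
        h.m₁.ideal ^ (r + 1) := by
    rw [FreeGCA.word, Submodule.map_pow]
    refine pow_le_pow_left₀ bot_le ?_ (r + 1)
    rintro _ ⟨_, ⟨x, rfl⟩, rfl⟩
    exact h.gen_mem_ideal x
  exact key ⟨l, hl, rfl⟩

theorem mixed_induction {r : ℕ} {S : Submodule ℚ (Model₂ 𝓑 𝓦)}
    (hS : ∀ s s', 1 ≤ s → 1 ≤ s' → s + s' = r → ∀ x ∈ baseWord 𝓑 𝓦 s, ∀ y ∈ baseWord 𝓑 𝓦 s',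
      h.fst.hom x * h.snd.hom y ∈ S) : mixed 𝓑 𝓦 r ≤ S := by
  refine Submodule.span_le.2 ?_
  rintro _ ⟨s, s', b, l, l', hs, hs', hr, hl, hl', rfl⟩
  rw [h.tmul_eq_fst_mul_snd]
  exact hS s s' hs hs' hr _ (Submodule.subset_span ⟨b, l, hl, rfl⟩) _
    (Submodule.subset_span ⟨1, l', hl', rfl⟩)

end IsModelDiff

end Words

/-! ## Strictly associative perturbations of the standard multiplication -/

section Strict

variable {B : Type u} [Ring B] [Algebra ℚ B] {𝓑 : ℕ → Submodule ℚ B} [GradedAlgebra 𝓑]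
variable {W : Type v} [AddCommGroup W] [Module ℚ W] {𝓦 : ℕ → Submodule ℚ W}
  [DirectSum.Decomposition 𝓦]
variable {dB : B →ₗ[ℚ] B}

namespace IsModelDiff

variable (h : IsModelDiff 𝓑 𝓦 dB (trivialDiff 𝓑 𝓦 dB))

theorem left_std (z : Model₁ 𝓑 𝓦) :
    (h.left h.std).hom (h.std.hom z) = (h.right h.std).hom (h.std.hom z) := by
  have e1 : ∀ x, genFst 𝓑 𝓦 x = h.fst.hom (gen 𝓑 𝓦 x) := fun _ => rfl
  have e2 : ∀ x, genSnd 𝓑 𝓦 x = h.snd.hom (gen 𝓑 𝓦 x) := fun x => (h.snd_hom _).symm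
  have : (h.left h.std).hom.comp h.std.hom = (h.right h.std).hom.comp h.std.hom := by
    refine freeExt_algHom_ext (fun b => ?_) (fun x => ?_)
    · exact (((h.left h.std).comp h.std).map_base b).trans
        (((h.right h.std).comp h.std).map_base b).symm
    · rw [AlgHom.comp_apply, AlgHom.comp_apply, h.std_gen, map_add, map_add, e1, e2, left,
        right, pair_fst, pair_snd, pair_fst, pair_snd]
      simp only [DGHom.comp_apply, h.std_gen, map_add, e1, e2, h.in₁₂_snd]
      abel
  exact DFunLike.congr_fun this z

theorem sq_std_gen (x : W) : (h.sq h.std).hom (gen 𝓑 𝓦 x) = (2 : ℚ) • gen 𝓑 𝓦 x := by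
  have e1 : genFst 𝓑 𝓦 x = h.fst.hom (gen 𝓑 𝓦 x) := rfl
  have e2 : genSnd 𝓑 𝓦 x = h.snd.hom (gen 𝓑 𝓦 x) := (h.snd_hom _).symm
  rw [sq, DGHom.comp_apply, h.std_gen, map_add, e1, e2, pair_fst, pair_snd, two_smul]
  rfl

theorem sq_std_baseWord {r : ℕ} {z : Model₁ 𝓑 𝓦} (hz : z ∈ baseWord 𝓑 𝓦 r) :
    (h.sq h.std).hom z = (2 : ℚ) ^ r • z :=
  h.hom_baseWord (g := DGHom.id _) h.sq_std_gen hz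

/-- The deviation of `z` from being primitive. -/
def cobd (z : Model₁ 𝓑 𝓦) : Model₂ 𝓑 𝓦 := h.std.hom z - h.fst.hom z - h.snd.hom z

/-- Every coboundary of a one-cochain is a two-cocycle; this uses the strict associativity
`left_std` of the standard multiplication. -/
theorem cobd_cocycle (z : Model₁ 𝓑 𝓦) :
    h.in₁₂.hom (h.cobd z) + (h.left h.std).hom (h.cobd z) =
      (h.right h.std).hom (h.cobd z) + h.in₂₃.hom (h.cobd z) := by
  simp only [cobd, map_sub, left_std]
  simp only [left, right, pair_fst, pair_snd, DGHom.comp_apply, h.in₁₂_snd]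
  abel

/-- The solutions of the associativity equation in word length `r ≥ 3`. -/
theorem exists_eq_cobd (hd : dB = 0) {r : ℕ} (hr : 3 ≤ r) {χ : Model₂ 𝓑 𝓦}
    (hχ : χ ∈ mixed 𝓑 𝓦 r)
    (hcoc : h.in₁₂.hom χ + (h.left h.std).hom χ =
      (h.right h.std).hom χ + h.in₂₃.hom χ) :
    ∃ ξ ∈ baseWord 𝓑 𝓦 r, χ = h.cobd ξ := by
  set m := h.pair (DGHom.id _) (DGHom.id _)
  set P := h.sq h.std
  set Q := h.pair (h.fst.comp P) (h.snd.comp P)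
  have hχI : mixed 𝓑 𝓦 r ≤ h.m₂.ideal ^ r := h.mixed_induction fun s s' h1 h1' hs x hx y hy => by
    rw [← hs, pow_add]
    exact Submodule.mul_mem_mul (h.fst.mem_ideal_pow (h.baseWord_le h1 hx))
      (h.snd.mem_ideal_pow (h.baseWord_le h1' hy))
  have hχQ : Q.hom χ = (2 : ℚ) ^ r • χ := by
    have : mixed 𝓑 𝓦 r ≤
        LinearMap.eqLocus Q.hom.toLinearMap ((2 : ℚ) ^ r • LinearMap.id) :=
      h.mixed_induction fun s s' _ _ hs x hx y hy => by
        change Q.hom _ = (2 : ℚ) ^ r • _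
        rw [map_mul, pair_fst, pair_snd, DGHom.comp_apply, DGHom.comp_apply,
          h.sq_std_baseWord hx, h.sq_std_baseWord hy, map_smul, map_smul, smul_mul_smul_comm,
          ← pow_add, hs]
        rfl
    exact this hχ
  have hmχ : m.hom χ ∈ baseWord 𝓑 𝓦 r := by
    have : mixed 𝓑 𝓦 r ≤ (baseWord 𝓑 𝓦 r).comap m.hom.toLinearMap := by
      refine Submodule.span_le.2 ?_
      rintro _ ⟨s, s', b, l, l', -, -, hs, hl, hl', rfl⟩
      refine Submodule.subset_span ⟨b, l * l', hs ▸ FreeGCA.mul_mem_word hl hl', ?_⟩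
      rw [AlgHom.toLinearMap_apply, h.tmul_eq_fst_mul_snd, map_mul, pair_fst, pair_snd, h.tmul_eq_base_mul,
        h.tmul_eq_base_mul b (l * l'), inr_mul, ← mul_assoc]
      rfl
    exact this hχ
  -- For `ξ` of word length `r` the multiplication sends `cobd ξ` to `2 ^ r ξ - ξ - ξ`. The factor
  -- `2 ^ r - 2` is divided out so that `χ` and `cobd ξ` have the same image.
  set c : ℚ := (2 ^ r - 2)⁻¹
  have hc : c * (2 ^ r - 2) = 1 := inv_mul_cancel₀ (by
    simpa using two_pow_sub_ne_zero (r := r) (s := 1) (by omega))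
  obtain ⟨ξ, hξ⟩ : ∃ ξ, ξ = c • m.hom χ := ⟨_, rfl⟩
  have hξr : ξ ∈ baseWord 𝓑 𝓦 r := hξ ▸ Submodule.smul_mem _ _ hmχ
  have hξI := h.baseWord_le (by omega) hξr
  refine ⟨ξ, hξr, sub_eq_zero.1 ?_⟩
  have hmξ : m.hom (h.cobd ξ) = m.hom χ := by
    have e : m.hom (h.std.hom ξ) = (2 : ℚ) ^ r • ξ := h.sq_std_baseWord hξr
    rw [cobd, map_sub, map_sub, e, pair_fst, pair_snd, DGHom.id_apply]
    have : (2 : ℚ) ^ r • ξ - ξ - ξ = (2 ^ r - 2 : ℚ) • ξ := by module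
    rw [this, hξ, smul_smul, mul_comm, hc, one_smul]
  have hQgen : ∀ x, (Q.comp h.std).hom (gen 𝓑 𝓦 x) = (2 : ℚ) • h.std.hom (gen 𝓑 𝓦 x) := by
    intro x
    have e1 : genFst 𝓑 𝓦 x = h.fst.hom (gen 𝓑 𝓦 x) := rfl
    have e2 : genSnd 𝓑 𝓦 x = h.snd.hom (gen 𝓑 𝓦 x) := (h.snd_hom _).symm
    rw [DGHom.comp_apply, h.std_gen, e1, e2, map_add, pair_fst, pair_snd, DGHom.comp_apply,
      DGHom.comp_apply, h.sq_std_gen, map_smul, map_smul, smul_add]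
  have hQξ : Q.hom (h.cobd ξ) = (2 : ℚ) ^ r • h.cobd ξ := by
    have e : Q.hom (h.std.hom ξ) = (2 : ℚ) ^ r • h.std.hom ξ := h.hom_baseWord hQgen hξr
    rw [cobd, map_sub, map_sub, e, pair_fst, pair_snd, DGHom.comp_apply, DGHom.comp_apply,
      h.sq_std_baseWord hξr, map_smul, map_smul, smul_sub, smul_sub]
  have hI : χ - h.cobd ξ ∈ h.m₂.ideal ^ r :=
    Submodule.sub_mem _ (hχI hχ) (Submodule.sub_mem _ (Submodule.sub_mem _
      (h.std.mem_ideal_pow hξI) (h.fst.mem_ideal_pow hξI)) (h.snd.mem_ideal_pow hξI))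
  -- `χ - cobd ξ` is a cocycle killed by the multiplication; with zero differential, being a
  -- coboundary modulo `I ^ (r + 1)` means lying in `I ^ (r + 1)`.
  have hbd := mem_bdry_of_cocycle h.isUnital_std hr hI
    (by
      rw [map_sub, map_sub, map_sub, map_sub, sub_add_sub_comm, sub_add_sub_comm, hcoc,
        h.cobd_cocycle, sub_self]
      exact Submodule.zero_mem _)
    (by
      change m.hom _ ∈ _
      rw [map_sub, hmξ, sub_self]
      exact Submodule.zero_mem _)
  have hd₂ : h.m₂.d = 0 := by
    change diff₂ 𝓑 𝓦 (trivialDiff 𝓑 𝓦 dB) = 0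
    rw [diff₂_trivialDiff h.isOddDerivation_base.map_one, hd]
    refine linearMap_ext_tmul₂ fun b l l' => ?_
    rw [mapBase₂_tmul, LinearMap.zero_apply, zero_tmul, zero_tmul, LinearMap.zero_apply]
  rw [DGOver.bdry, hd₂, LinearMap.range_zero, bot_sup_eq] at hbd
  have hQ : DGHom.Cong 2 Q (DGHom.id _) := by
    have hP := h.cong_sq h.isUnital_std
    have e := h.cong_pair (c := 2) (a := h.fst.comp P) (b := h.snd.comp P) (a' := h.fst)
      (b' := h.snd) (fun x hx => by
        have := h.fst.mem_ideal_pow (hP x hx)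
        rwa [map_sub, map_smul] at this) (fun x hx => by
        have := h.snd.mem_ideal_pow (hP x hx)
        rwa [map_sub, map_smul] at this)
    intro x hx
    have := e x hx
    rwa [h.pair_fst_snd] at this
  -- `Q` doubles both sets of generators, so `χ - cobd ξ` has eigenvalue `2 ^ r` exactly, which is
  -- impossible for a nonzero element of `I ^ (r + 1)`.
  exact hQ.eq_zero_of_eigen (Nat.lt_succ_self r) hbd (by
    rw [map_sub, hχQ, hQξ, smul_sub]) (by omega)

/-- The deviation from primitivity in terms of a basis. -/
theorem cobd_finsupp {I : Type*} [LinearOrder I] (e : Module.Basis I ℚ W) {r : ℕ}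
    (b : (Fin r ↪o I) →₀ B) :
    h.cobd (b.sum fun J c => c ᵍ⊗ₜ[ℚ] (List.ofFn fun k => FreeGCA.ι 𝓦 (e (J k))).prod) =
      b.sum fun J c => base₂ 𝓑 𝓦 c *
        (wordProd 𝓑 𝓦 (genFst 𝓑 𝓦 + genSnd 𝓑 𝓦) (e ∘ J) -
          wordProd 𝓑 𝓦 (genFst 𝓑 𝓦) (e ∘ J) - wordProd 𝓑 𝓦 (genSnd 𝓑 𝓦) (e ∘ J)) := by
  have key : ∀ (f : DGHom h.m₁ h.m₂) (g : W →ₗ[ℚ] Model₂ 𝓑 𝓦),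
      (∀ x, f.hom (gen 𝓑 𝓦 x) = g x) → ∀ (c : B) (J : Fin r ↪o I),
      f.hom (c ᵍ⊗ₜ[ℚ] (List.ofFn fun k => FreeGCA.ι 𝓦 (e (J k))).prod) =
        base₂ 𝓑 𝓦 c * wordProd 𝓑 𝓦 g (e ∘ J) := by
    intro f g hfg c J
    rw [h.hom_tmul]
    congr 1
    change (f.hom.comp (GradedTensorProduct.includeRight 𝓑 (FreeGCA.gr 𝓦))) _ = _
    rw [map_list_prod, List.map_ofFn, wordProd]
    congr 2
    funext k
    exact hfg _
  simp only [cobd, map_finsuppSum, ← Finsupp.sum_sub]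
  refine Finsupp.sum_congr fun J _ => ?_
  rw [key h.std (genFst 𝓑 𝓦 + genSnd 𝓑 𝓦) h.std_gen, key h.fst (genFst 𝓑 𝓦) fun _ => rfl,
    key h.snd (genSnd 𝓑 𝓦) fun x => h.snd_hom _, mul_sub, mul_sub]

end IsModelDiff

end Strict


end FibrewiseModels

end

open FibrewiseModels in
theorem mainTheorem3 {B : Type*} [Ring B] [Algebra ℚ B]
    (𝓑 : ℕ → Submodule ℚ B) [GradedAlgebra 𝓑] (hB : IsGradedCommutative 𝓑)
    {W : Type*} [AddCommGroup W] [Module ℚ W]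
    (𝓦 : ℕ → Submodule ℚ W) [DirectSum.Decomposition 𝓦]
    (hW : ∀ n, Even n → 𝓦 n = ⊥) :
    (∀ (dB : B →ₗ[ℚ] B) (D : Model₁ 𝓑 𝓦 →ₗ[ℚ] Model₁ 𝓑 𝓦)
        (C : Model₁ 𝓑 𝓦 →ₗ[ℚ] Model₂ 𝓑 𝓦),
      IsDifferential 𝓑 dB →
      IsRelativeModel 𝓑 𝓦 dB D →
      IsDGMap (gr₁ 𝓑 𝓦) D 𝓑 dB (proj₁ 𝓑 𝓦) →
      IsFibrewiseMultiplication 𝓑 𝓦 D C →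
      IsFiniteType 𝓑 → IsFiniteType 𝓦 →
      HasZeroOddCohomology 𝓑 dB →
      IsAssociative 𝓑 𝓦 D C →
      IsFibrewiseMultiplication 𝓑 𝓦 (trivialDiff 𝓑 𝓦 dB) (stdMul 𝓑 𝓦) ∧
        ModelEquivalent 𝓑 𝓦 D C (trivialDiff 𝓑 𝓦 dB) (stdMul 𝓑 𝓦)) ∧
    (∀ (I : Type*) [LinearOrder I] (e : Module.Basis I ℚ W), (∀ i, ∃ n, e i ∈ 𝓦 n) →
      ∀ (r : ℕ) (χ : Model₂ 𝓑 𝓦), 3 ≤ r → χ ∈ mixed 𝓑 𝓦 r →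
        alphaMap 𝓑 𝓦 χ + betaMap 𝓑 𝓦 χ = gammaMap 𝓑 𝓦 χ + deltaMap 𝓑 𝓦 χ →
        ∃ b : (Fin r ↪o I) →₀ B,
          χ = b.sum fun J c => base₂ 𝓑 𝓦 c *
            (wordProd 𝓑 𝓦 (genFst 𝓑 𝓦 + genSnd 𝓑 𝓦) (e ∘ J) -
              wordProd 𝓑 𝓦 (genFst 𝓑 𝓦) (e ∘ J) -
              wordProd 𝓑 𝓦 (genSnd 𝓑 𝓦) (e ∘ J))) := by
  refine ⟨fun dB D C hd hD hp hC hBf hWf hH hass =>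
    ⟨(isModelDiff_trivialDiff hB hD.pos hd.isOddDerivation).isFibrewiseMultiplication_stdMul,
      modelEquivalent_trivial hB hW hd hD hp hC hBf hWf hH hass⟩,
    fun I _ e _ r χ hr hχ hcoc => ?_⟩
  -- Part (2) is purely algebraic, so the zero differential on `B` puts it in the framework above.
  have h := isModelDiff_trivialDiff (𝓑 := 𝓑) (𝓦 := 𝓦) hB (hW 0 Even.zero) isOddDerivation_zero
  obtain ⟨ξ, hξ, rfl⟩ := h.exists_eq_cobd rfl hr hχ (by
    rw [h.left_apply, h.right_apply, h.std_toLinearMap]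
    refine hcoc.trans (congrArg _ (h.in₂₃Hom_apply χ).symm))
  obtain ⟨b, rfl⟩ := exists_finsupp_of_mem_baseWord hW e hξ
  exact ⟨b, h.cobd_finsupp e b⟩
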